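/- Let $N\ge 2$, let $l_1,\dots,l_N>0$ and let $\mathcal G$ be the star graph with edges $I_1=(-l_1,0)$ and $I_j=(0,l_j)$ for $2\le j\le N$, joined at $0$. Write $f=(f_1,\dots,f_N)$ with $f_j:I_j\to\mathbb C$ for a function on $\mathcal G$. Let $H^m(\mathcal G)=\bigoplus_{j} H^m(I_j)$ with $\|f\|_{H^m(\mathcal G)}^2=\sum_{k\le m}\sum_{j}\int_{I_j}|\partial_x^kf_j|^2dx$. Let $\alpha_2,\dots,\alpha_N>0$ satisfy $$\sum_{j=2}^N\frac1{\alpha_j^2}=1\qquad\text{and}\qquad \frac1{\alpha_j^2}\le\frac1{N-1}\quad(2\le j\le N).$$ Let $H^2_0(\mathcal G)$ be the set of $f\in H^2(\mathcal G)$ with $f_1(-l_1)=\partial_xf_1(-l_1)=0$ and $f_j(l_j)=\partial_xf_j(l_j)=0$, $f_1(0)=\alpha_jf_j(0)$ for $2\le j\le N$, with the norm of $H^2(\mathcal G)$. Consider the adjoint system $$i\partial_tv_j+\partial_x^2v_j-\partial_x^4v_j=0\ \text{ on } I_j\times(0,T)\ (1\le j\le N),\qquad v(\cdot,T)=v_T,$$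 with the boundary conditions, for $2\le j\le N$, $$v_1(-l_1,t)=\partial_xv_1(-l_1,t)=0,\quad v_j(l_j,t)=\partial_xv_j(l_j,t)=0,\quad v_1(0,t)=\alpha_jv_j(0,t),\quad \partial_x^2v_1(0,t)=\alpha_j\partial_x^2v_j(0,t),$$ $$\partial_xv_1(0,t)=\sum_{k=2}^N\frac{\partial_xv_k(0,t)}{\alpha_k},\qquad \partial_x^3v_1(0,t)=\sum_{k=2}^N\frac{\partial_x^3v_k(0,t)}{\alpha_k}.$$ Let $D(A)$ be the set of functions in $H^4(\mathcal G)$ satisfying all these boundary conditions and $Au=i\partial_x^2u-i\partial_x^4u$. A solution with final data $v_T\in H^2_0(\mathcal G)$ is a mild solution $v\in C([0,T];H^2_0(\mathcal G))$: for all $t\in[0,T]$, $\int_T^tv(s)\,ds\in D(A)$ and $v(t)=v_T+A\int_T^tv(s)\,ds$. Its boundary value $\partial_x^2v_j(l_j,\cdot)$ is understood as the function $g_j\in L^2(0,T)$ such that $\bigl(\partial_x^2\int_T^tv_j(s)\,ds\bigr)(l_j)=\int_T^tg_j(s)\,ds$ for all $t\in[0,T]$. Put $L=\max\{l_1,\dots,l_N\}$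 and $\overline L=\max\{2l_1,\ \max\{l_2,\dots,l_N\}+l_1\}$, and suppose that $$0<\varepsilon<\frac1{\overline L},\qquad T>T_{min}:=\sqrt{\frac{\overline L(L^2+\pi^2)}{\pi^2\varepsilon(1-\overline L\varepsilon)}}.$$ Then there is a constant $C>0$ (not depending on the solution) such that, for every $v_T\in H^2_0(\mathcal G)$ and every solution $v$ of the adjoint system with final data $v_T$, the boundary values $\partial_x^2v_j(l_j,\cdot)$, $2\le j\le N$, exist in $L^2(0,T)$ and $$\|v(\cdot,T)\|_{H^2_0(\mathcal G)}^2\le C\sum_{j=2}^N\|\partial_x^2v_j(l_j,\cdot)\|_{L^2(0,T)}^2 .$$ -/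

import Mathlib

open MeasureTheory Set
open scoped ContDiff

noncomputable section

namespace StarGraph

/-! ### Sobolev functions on a bounded interval -/

/-- The complex Hilbert space `L²(a, b)`. -/
abbrev L2I (a b : ℝ) : Type := Lp ℂ 2 (volume.restrict (Ioo a b))

/-- `g` is the weak derivative of `f` on `(a, b)` : `∫ φ' f = - ∫ φ g` for all test functions `φ`. -/
def IsWeakDeriv {a b : ℝ} (f g : L2I a b) : Prop :=
  ∀ φ : ℝ → ℝ, ContDiff ℝ ∞ φ → HasCompactSupport φ → tsupport φ ⊆ Ioo a b →
    ∫ x in Ioo a b, ((deriv φ x : ℝ) : ℂ) * f x = -∫ x in Ioo a b, ((φ x : ℝ) : ℂ) * g x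

open Classical in
/-- The value at `c ∈ [a, b]` of the representative of `f` that is continuous on `[a, b]`. Such a
representative exists for every `f ∈ H¹(a, b)`, and it is unique; the value `0` used when there is
none is never relevant. -/
def trace {a b : ℝ} (f : L2I a b) (c : ℝ) : ℂ :=
  if h : ∃ w : ℝ → ℂ, ContinuousOn w (Icc a b) ∧ f =ᵐ[volume.restrict (Ioo a b)] w
  then h.choose c else 0

/-- `trace` is well defined: it does not depend on the choice of the continuous representative. -/
theorem trace_eq {a b c : ℝ} (hab : a < b) (hc : c ∈ Icc a b) (f : L2I a b) (w : ℝ → ℂ)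
    (hw : ContinuousOn w (Icc a b)) (hf : f =ᵐ[volume.restrict (Ioo a b)] w) :
    trace f c = w c := by
  have h : ∃ w : ℝ → ℂ, ContinuousOn w (Icc a b) ∧ f =ᵐ[volume.restrict (Ioo a b)] w := ⟨w, hw, hf⟩
  rw [trace, dif_pos h]
  have h1 : h.choose =ᵐ[volume.restrict (Ioo a b)] w := h.choose_spec.2.symm.trans hf
  have h2 : EqOn h.choose w (Ioo a b) :=
    Measure.eqOn_open_of_ae_eq h1 isOpen_Ioo
      (h.choose_spec.1.mono Ioo_subset_Icc_self) (hw.mono Ioo_subset_Icc_self)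
  exact h2.of_subset_closure h.choose_spec.1 hw Ioo_subset_Icc_self
    (by rw [closure_Ioo hab.ne]) hc

/-! ### The star graph

There are `n + 1` edges. Edge `0` is the interval `(-l 0, 0)`; every other edge `j` is the interval
`(0, l j)`. All edges are joined at the point `0`. -/

variable {n : ℕ}

/-- Left endpoint of edge `j`. -/
def left (l : Fin (n + 1) → ℝ) (j : Fin (n + 1)) : ℝ := if j = 0 then -l 0 else 0

/-- Right endpoint of edge `j`. -/
def right (l : Fin (n + 1) → ℝ) (j : Fin (n + 1)) : ℝ := if j = 0 then 0 else l j

/-- The endpoint of edge `j` other than the central node. -/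
def outer (l : Fin (n + 1) → ℝ) (j : Fin (n + 1)) : ℝ := if j = 0 then -l 0 else l j

/-- `L²(𝒢)`, the Hilbert sum of the spaces `L²` of the edges. -/
abbrev L2G (l : Fin (n + 1) → ℝ) : Type := PiLp 2 fun j => L2I (left l j) (right l j)

/-- The Hilbert space of `(m + 1)`-tuples in `L²(𝒢)`. A function `f ∈ H^m(𝒢)` is represented by its
tuple of weak derivatives `(f, ∂ₓ f, …, ∂ₓ^m f)`; the norm of the tuple is the `H^m`-norm of `f`. -/
abbrev Jet (l : Fin (n + 1) → ℝ) (m : ℕ) : Type := PiLp 2 fun _ : Fin (m + 1) => L2G l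

/-- `H^m(𝒢) = ⨁ H^m(I_j)`. -/
def sobolev (l : Fin (n + 1) → ℝ) (m : ℕ) : Set (Jet l m) :=
  {u | ∀ (k : Fin m) (j : Fin (n + 1)), IsWeakDeriv (u k.castSucc j) (u k.succ j)}

/-- `bd u k j c` is the boundary value of `∂ₓ^k u_j` at the endpoint `c` of edge `j`. -/
def bd {l : Fin (n + 1) → ℝ} {m : ℕ} (u : Jet l m) (k : Fin (m + 1)) (j : Fin (n + 1)) (c : ℝ) : ℂ :=
  trace (u k j) c

/-- `H²₀(𝒢)` : the functions in `H²(𝒢)` that vanish together with their first derivative at the outer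
endpoints and satisfy `f_1(0) = α_j f_j(0)`. -/
def H20 (l : Fin (n + 1) → ℝ) (α : Fin n → ℝ) : Set (Jet l 2) :=
  {u | u ∈ sobolev l 2 ∧
    (∀ j, bd u 0 j (outer l j) = 0 ∧ bd u 1 j (outer l j) = 0) ∧
    ∀ j : Fin n, bd u 0 0 0 = α j * bd u 0 j.succ 0}

/-- The domain of the operator `A = i ∂ₓ² - i ∂ₓ⁴` : functions in `H⁴(𝒢)` satisfying all the boundary
and transmission conditions. -/
def domA (l : Fin (n + 1) → ℝ) (α : Fin n → ℝ) : Set (Jet l 4) :=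
  {u | u ∈ sobolev l 4 ∧
    (∀ j, bd u 0 j (outer l j) = 0 ∧ bd u 1 j (outer l j) = 0) ∧
    (∀ j : Fin n, bd u 0 0 0 = α j * bd u 0 j.succ 0) ∧
    bd u 1 0 0 = ∑ j : Fin n, bd u 1 j.succ 0 / α j ∧
    (∀ j : Fin n, bd u 2 0 0 = α j * bd u 2 j.succ 0) ∧
    bd u 3 0 0 = ∑ j : Fin n, bd u 3 j.succ 0 / α j}

/-- The operator `A u = i ∂ₓ² u - i ∂ₓ⁴ u`. -/
def opA {l : Fin (n + 1) → ℝ} (u : Jet l 4) : L2G l := Complex.I • u 2 - Complex.I • u 4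

/-- `v ∈ C([0,T]; H²₀(𝒢))` is the (mild) solution, with final state `vT`, of the backward system
`i ∂ₜ v + ∂ₓ² v - ∂ₓ⁴ v = 0` with the boundary and transmission conditions in `domA`, that is,
`∫_T^t v ds ∈ D(A)` and `v(t) = v(T) + A ∫_T^t v ds` for all `t ∈ [0,T]`. -/
structure IsAdjointSolution (l : Fin (n + 1) → ℝ) (α : Fin n → ℝ) (T : ℝ) (vT : Jet l 2)
    (v : ℝ → Jet l 2) : Prop where
  mem : ∀ t ∈ Icc 0 T, v t ∈ H20 l α
  cont : ContinuousOn v (Icc 0 T)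
  final : v T = vT
  mild : ∀ t ∈ Icc 0 T, ∃ U ∈ domA l α,
    U 0 = (∫ s in T..t, v s 0) ∧ v t 0 = v T 0 + opA U

/-- `g ∈ L²(0,T)` is the boundary value `∂ₓ² v_j(l_j, ·)` of a mild solution `v`. As `v(t)` is only in
`H²`, this is read as the time derivative of the boundary value of `∂ₓ² ∫_T^t v_j ds`, where
`∫_T^t v ds ∈ D(A) ⊆ H⁴(𝒢)`. For solutions continuous with values in `D(A)` it is the pointwise
boundary value, and `g` is unique up to null sets. -/
def IsSecondTrace (l : Fin (n + 1) → ℝ) (α : Fin n → ℝ) (T : ℝ) (v : ℝ → Jet l 2)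
    (j : Fin (n + 1)) (g : ℝ → ℂ) : Prop :=
  MemLp g 2 (volume.restrict (Ioo 0 T)) ∧
  ∀ t ∈ Icc 0 T, ∃ U ∈ domA l α,
    U 0 = (∫ s in T..t, v s 0) ∧ bd U 2 j (outer l j) = ∫ s in T..t, g s

/-- `L`, the maximal length of the edges. -/
def maxLength (l : Fin (n + 1) → ℝ) : ℝ := ⨆ j, l j

/-- `L̄ = max {2 l_1, max_{j ≥ 2} l_j + l_1}`. -/
def barLength (l : Fin (n + 1) → ℝ) : ℝ := max (2 * l 0) ((⨆ j : Fin n, l j.succ) + l 0)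

/-- The time `T_min = √(L̄ (L² + π²) / (π² ε (1 - L̄ ε)))`. -/
def Tmin (l : Fin (n + 1) → ℝ) (ε : ℝ) : ℝ :=
  Real.sqrt (barLength l * (maxLength l ^ 2 + Real.pi ^ 2) /
    (Real.pi ^ 2 * ε * (1 - barLength l * ε)))

end StarGraph

end

noncomputable section

namespace StarGraph

/-! ### Primitives of integrable functions and weak derivatives -/

/-! Write `n` for the number of edges other than edge `0`. The `n` numbers `1 / α j ^ 2` add up to
`1` and none exceeds `1 / n`, so they are all equal and every weight is `√n`. For equal weights
observability holds in every time `T > 0`, and the positive lower bound on `T` is used only in that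
form. The proof combines multipliers with a compactness and uniqueness argument.

Multipliers. For a regular solution `u` with time derivative `w = A u`, the derivative of `Re i ∫ q
u ∂ₓū` is an interior term plus boundary terms (`multiplier_identity`). The weight `q = x + l 0`
gives the interior term `2‖u'‖² + 4‖u''‖²`; at the outer endpoints only the observed second
derivatives survive, because the weight vanishes at the outer end of edge `0`. For equal weights the
vertex terms collapse to a sum over pairs of edges of `|a|² - 2 Re(b ā)`, where `a` and `b` are the
differences of first and third derivatives at the vertex (`bdryForm_vertex`). This has no sign.
However, the difference of two edges solves the same equation and vanishes at the vertex together
with its second derivative, so a second multiplier, supported near the vertex, produces the same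
expression (`pair_estimate`). Subtracting the two identities leaves an estimate of the `H²` norm by
the observed traces and the `L²` norm (`exists_observability_form`). Since `A` is skew, the `L²` and
`H²` norms are conserved and the static estimate can be integrated in time. The weight `x ^ 3` gives
the converse bound, hidden regularity, by which the traces of a mild solution exist in `L²`: they
are limits of the traces of its time averages.

Compactness. The `L²` norm is at most a small multiple of the `H²` norm plus finitely many point
values (`exists_sampling`), so observability holds up to finitely many functionals.
`exists_bound_of_finite_rank` removes them if no nonzero solution has vanishing traces.

Uniqueness. The solutions with vanishing traces on `[0, τ]` form a finite dimensional space, which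
cannot keep shrinking as `τ` grows. Hence some time shift acts on one of these spaces, and an
eigenvector is a solution periodic up to a phase. Its Fourier coefficients in time are
eigenfunctions of `A` with vanishing traces, that is, solutions of `u'''' = u'' + κ u`. For `κ ≤ 0`
testing with `u` gives `u = 0`. For `κ > 0` a first integral of the equation and the Cauchy–Schwarz
inequality at the vertex give `u = 0` (`vertex_relations`). -/

theorem integral_deriv_mul_primitive_real {a b : ℝ} {g p : ℝ → ℝ}
    (hg : IntervalIntegrable g volume a b) (hp : ContDiff ℝ 1 p) :
    ∫ x in a..b, deriv p x * (∫ y in a..x, g y)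
      = p b * (∫ y in a..b, g y) - ∫ x in a..b, p x * g x := by
  have hG := hg.absolutelyContinuousOnInterval_intervalIntegral (c := a) (by simp)
  have hP : AbsolutelyContinuousOnInterval p a b :=
    hp.contDiffOn.absolutelyContinuousOnInterval
  have h := hP.integral_mul_deriv_eq_deriv_mul hG
  have h2 : ∫ x in a..b, p x * deriv (fun x => ∫ y in a..x, g y) x = ∫ x in a..b, p x * g x := by
    apply intervalIntegral.integral_congr_ae
    filter_upwards [hg.ae_hasDerivAt_integral] with x hx hx'
    rw [(hx (uIoc_subset_uIcc hx') a (by simp)).deriv]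
  rw [h2] at h
  simp only [intervalIntegral.integral_same, mul_zero, sub_zero] at h
  linarith

theorem integral_deriv_mul_primitive {a b : ℝ} {g : ℝ → ℂ} {p : ℝ → ℝ}
    (hg : IntervalIntegrable g volume a b) (hp : ContDiff ℝ 1 p) :
    ∫ x in a..b, ((deriv p x : ℝ) : ℂ) * (∫ y in a..x, g y)
      = p b * (∫ y in a..b, g y) - ∫ x in a..b, (p x : ℂ) * g x := by
  have hcp : Continuous p := hp.continuous
  have hcd : Continuous (deriv p) := hp.continuous_deriv le_rfl
  have hre : IntervalIntegrable (fun x => (g x).re) volume a b :=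
    ⟨hg.1.re, hg.2.re⟩
  have him : IntervalIntegrable (fun x => (g x).im) volume a b :=
    ⟨hg.1.im, hg.2.im⟩
  -- Applying the real identity to `L ∘ g` reduces the claim to real and imaginary parts.
  have key : ∀ L : ℂ →L[ℝ] ℝ, L (∫ x in a..b, ((deriv p x : ℝ) : ℂ) * (∫ y in a..x, g y))
      = L (p b * (∫ y in a..b, g y) - ∫ x in a..b, (p x : ℂ) * g x) := by
    intro L
    have hL : IntervalIntegrable (fun x => L (g x)) volume a b :=
      ⟨L.integrable_comp hg.1, L.integrable_comp hg.2⟩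
    have hs : ∀ (r : ℝ) (z : ℂ), L ((r : ℂ) * z) = r * L z := by
      intro r z
      rw [← Complex.real_smul, map_smul, smul_eq_mul]
    have hsub : ∀ x ∈ uIcc a b, IntervalIntegrable g volume a x := fun x hx =>
      hg.mono_set (uIcc_subset_uIcc_left hx)
    have h := integral_deriv_mul_primitive_real hL hp
    have hGc : ContinuousOn (fun x => ∫ y in a..x, g y) (uIcc a b) :=
      intervalIntegral.continuousOn_primitive_interval' hg (by simp)
    have hi1 : IntervalIntegrable (fun x => ((deriv p x : ℝ) : ℂ) * (∫ y in a..x, g y)) volume a b :=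
      ((Complex.continuous_ofReal.comp hcd).continuousOn.mul hGc).intervalIntegrable
    have hi2 : IntervalIntegrable (fun x => (p x : ℂ) * g x) volume a b :=
      hg.continuousOn_mul (Complex.continuous_ofReal.comp hcp).continuousOn
    rw [← L.intervalIntegral_comp_comm hi1, map_sub, hs, ← L.intervalIntegral_comp_comm hi2,
      ← L.intervalIntegral_comp_comm hg]
    simp only [hs]
    rw [← h]
    apply intervalIntegral.integral_congr
    intro x hx
    simp only
    rw [L.intervalIntegral_comp_comm (hsub x hx)]
  apply Complex.ext
  · exact key Complex.reCLM
  · exact key Complex.imCLM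

theorem L2I.integrable {a b : ℝ} (f : L2I a b) : Integrable f (volume.restrict (Ioo a b)) :=
  (Lp.memLp f).integrable one_le_two

theorem L2I.intervalIntegrable {a b : ℝ} (f : L2I a b) {x y : ℝ} (hx : x ∈ Icc a b)
    (hy : y ∈ Icc a b) : IntervalIntegrable f volume x y := by
  have h : IntegrableOn f (Icc a b) volume := by
    rw [integrableOn_Icc_iff_integrableOn_Ioo]
    exact L2I.integrable f
  exact (h.mono_set (uIcc_subset_Icc hx hy)).intervalIntegrable

theorem integral_Ioo_eq {a b : ℝ} (hab : a ≤ b) (f : ℝ → ℂ) :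
    ∫ x in Ioo a b, f x = ∫ x in a..b, f x := by
  rw [intervalIntegral.integral_of_le hab, integral_Ioc_eq_integral_Ioo]

theorem exists_Icc_of_compact_subset_Ioo {a b : ℝ} {K : Set ℝ} (hab : a < b) (hK : IsCompact K)
    (h : K ⊆ Ioo a b) : ∃ c d, a < c ∧ c ≤ d ∧ d < b ∧ K ⊆ Icc c d := by
  rcases K.eq_empty_or_nonempty with rfl | hne
  · exact ⟨(a + b) / 2, (a + b) / 2, by linarith, le_rfl, by linarith, empty_subset _⟩
  · refine ⟨sInf K, sSup K, (h (hK.sInf_mem hne)).1, ?_, (h (hK.sSup_mem hne)).2, ?_⟩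
    · exact (csInf_le hK.bddBelow hne.some_mem).trans (le_csSup hK.bddAbove hne.some_mem)
    · exact fun x hx => ⟨csInf_le hK.bddBelow hx, le_csSup hK.bddAbove hx⟩

/-- A test function on `(a, b)` with integral `1`. -/
theorem exists_test_integral_eq_one {a b : ℝ} (hab : a < b) :
    ∃ η : ℝ → ℝ, ContDiff ℝ ∞ η ∧ HasCompactSupport η ∧ tsupport η ⊆ Ioo a b ∧
      ∫ x in a..b, η x = 1 := by
  let f : ContDiffBump ((a + b) / 2) := ⟨(b - a) / 8, (b - a) / 4, by linarith, by linarith⟩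
  have hs : tsupport (f.normed volume) ⊆ Ioo a b := by
    rw [f.tsupport_normed_eq]
    intro x hx
    rw [Metric.mem_closedBall, Real.dist_eq] at hx
    have hx' := abs_le.1 hx
    have e : f.rOut = (b - a) / 4 := rfl
    rw [e] at hx'
    constructor <;> linarith
  refine ⟨f.normed volume, f.contDiff_normed, f.hasCompactSupport_normed, hs, ?_⟩
  rw [← f.integral_normed (μ := volume)]
  apply intervalIntegral.integral_eq_integral_of_support_subset
  exact (subset_tsupport _).trans (hs.trans Ioo_subset_Ioc_self)

/-- A test function with integral `0` is the derivative of a test function. -/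
theorem exists_test_primitive {a b : ℝ} (hab : a < b) {ψ : ℝ → ℝ} (hψ : ContDiff ℝ ∞ ψ)
    (hc : HasCompactSupport ψ) (hs : tsupport ψ ⊆ Ioo a b) (h0 : ∫ x in a..b, ψ x = 0) :
    ∃ φ : ℝ → ℝ, ContDiff ℝ ∞ φ ∧ HasCompactSupport φ ∧ tsupport φ ⊆ Ioo a b ∧ deriv φ = ψ := by
  obtain ⟨c, d, hac, hcd, hdb, hK⟩ := exists_Icc_of_compact_subset_Ioo hab hc hs
  have hcont : Continuous ψ := hψ.continuous
  have hd : ∀ x, HasDerivAt (fun x => ∫ y in a..x, ψ y) (ψ x) x := fun x =>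
    intervalIntegral.integral_hasDerivAt_right (hcont.intervalIntegrable _ _)
      hcont.stronglyMeasurable.stronglyMeasurableAtFilter hcont.continuousAt
  have hderiv : deriv (fun x => ∫ y in a..x, ψ y) = ψ := funext fun x => (hd x).deriv
  have hz : ∀ y, y ∉ Icc c d → ψ y = 0 := fun y hy =>
    image_eq_zero_of_notMem_tsupport fun h => hy (hK h)
  have hsupp : ∀ x, x ∉ Icc c d → (∫ y in a..x, ψ y) = 0 := by
    intro x hx
    -- Left of the support the integrand vanishes between `a` and `x`. Right of it the integrand
    -- vanishes between `x` and `b`, and the total integral is zero.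
    by_cases hxc : x < c
    · apply intervalIntegral.integral_zero_ae
      refine Filter.Eventually.of_forall fun y hy => hz y fun hy' => ?_
      rcases le_total a x with h | h
      · rw [uIoc_of_le h] at hy
        linarith [hy.2, hy'.1]
      · rw [uIoc_of_ge h] at hy
        linarith [hy.2, hy'.1]
    · have hxd : d < x := by
        by_contra h
        exact hx ⟨not_lt.1 hxc, not_lt.1 h⟩
      have h1 : ∫ y in x..b, ψ y = 0 := by
        apply intervalIntegral.integral_zero_ae
        refine Filter.Eventually.of_forall fun y hy => hz y fun hy' => ?_
        rcases le_total x b with h | h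
        · rw [uIoc_of_le h] at hy
          linarith [hy.1, hy'.2]
        · rw [uIoc_of_ge h] at hy
          linarith [hy.1, hy'.2]
      rw [← intervalIntegral.integral_add_adjacent_intervals (hcont.intervalIntegrable a x)
        (hcont.intervalIntegrable x b), h1, add_zero] at h0
      exact h0
  have hts : tsupport (fun x => ∫ y in a..x, ψ y) ⊆ Icc c d := by
    apply closure_minimal _ isClosed_Icc
    intro x hx
    by_contra h
    exact hx (hsupp x h)
  refine ⟨fun x => ∫ y in a..x, ψ y, ?_, ?_, ?_, hderiv⟩
  · rw [contDiff_infty_iff_deriv, hderiv]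
    exact ⟨fun x => (hd x).differentiableAt, hψ⟩
  · exact isCompact_Icc.of_isClosed_subset (isClosed_tsupport _) hts
  · exact hts.trans fun x hx => ⟨hac.trans_le hx.1, hx.2.trans_lt hdb⟩

/-- du Bois-Reymond: a function whose weak derivative vanishes is constant. -/
theorem ae_eq_const_of_integral_deriv_eq_zero {a b : ℝ} (hab : a < b) {h : ℝ → ℂ}
    (hi : IntervalIntegrable h volume a b)
    (H : ∀ φ : ℝ → ℝ, ContDiff ℝ ∞ φ → HasCompactSupport φ → tsupport φ ⊆ Ioo a b →
      ∫ x in a..b, ((deriv φ x : ℝ) : ℂ) * h x = 0) :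
    ∃ c : ℂ, ∀ᵐ x ∂(volume.restrict (Ioo a b)), h x = c := by
  obtain ⟨η, hη, hηc, hηs, hη1⟩ := exists_test_integral_eq_one hab
  have hmul : ∀ ψ : ℝ → ℝ, Continuous ψ →
      IntervalIntegrable (fun x => (ψ x : ℂ) * h x) volume a b := fun ψ hψ =>
    hi.continuousOn_mul (Complex.continuous_ofReal.comp hψ).continuousOn
  refine ⟨∫ x in a..b, (η x : ℂ) * h x, ?_⟩
  set c := ∫ x in a..b, (η x : ℂ) * h x with hc
  have key : ∀ ψ : ℝ → ℝ, ContDiff ℝ ∞ ψ → HasCompactSupport ψ → tsupport ψ ⊆ Ioo a b →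
      ∫ x in a..b, (ψ x : ℂ) * (h x - c) = 0 := by
    intro ψ hψ hψc hψs
    set s := ∫ x in a..b, ψ x with hsdef
    -- Removing the mean of `ψ` by a multiple of `η` makes it the derivative of a test function, to
    -- which the hypothesis applies.
    have h1 : ContDiff ℝ ∞ (fun x => ψ x - s * η x) := hψ.sub (contDiff_const.mul hη)
    have hsub : Function.support (fun x => ψ x - s * η x) ⊆ tsupport ψ ∪ tsupport η := by
      intro x hx
      by_contra hcon
      rw [mem_union, not_or] at hcon
      apply hx
      simp [image_eq_zero_of_notMem_tsupport hcon.1, image_eq_zero_of_notMem_tsupport hcon.2]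
    have hts : tsupport (fun x => ψ x - s * η x) ⊆ tsupport ψ ∪ tsupport η :=
      closure_minimal hsub ((isClosed_tsupport _).union (isClosed_tsupport _))
    have h2 : HasCompactSupport (fun x => ψ x - s * η x) :=
      (hψc.isCompact.union hηc.isCompact).of_isClosed_subset (isClosed_tsupport _) hts
    have h3 : ∫ x in a..b, (ψ x - s * η x) = 0 := by
      rw [intervalIntegral.integral_sub (hψ.continuous.intervalIntegrable _ _)
        ((hη.continuous.const_mul s).intervalIntegrable _ _),
        intervalIntegral.integral_const_mul, hη1, ← hsdef]
      ring
    obtain ⟨φ, hφ, hφc, hφs, hφd⟩ :=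
      exists_test_primitive hab h1 h2 (hts.trans (union_subset hψs hηs)) h3
    have h4 := H φ hφ hφc hφs
    rw [hφd] at h4
    have e1 : ∀ x, ((ψ x - s * η x : ℝ) : ℂ) * h x = (ψ x : ℂ) * h x - s * ((η x : ℂ) * h x) := by
      intro x; push_cast; ring
    simp only [e1] at h4
    rw [intervalIntegral.integral_sub (hmul ψ hψ.continuous) ((hmul η hη.continuous).const_mul _),
      intervalIntegral.integral_const_mul, ← hc] at h4
    have e2 : ∀ x, (ψ x : ℂ) * (h x - c) = (ψ x : ℂ) * h x - (ψ x : ℂ) * c := fun x => by ring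
    simp only [e2]
    rw [intervalIntegral.integral_sub (hmul ψ hψ.continuous)
      (((Complex.continuous_ofReal.comp' hψ.continuous).mul_const c).intervalIntegrable _ _),
      intervalIntegral.integral_mul_const, intervalIntegral.integral_ofReal, ← hsdef]
    linear_combination h4
  have hloc : LocallyIntegrableOn (fun x => h x - c) (Ioo a b) volume := by
    apply IntegrableOn.locallyIntegrableOn
    have := (hi.sub (intervalIntegrable_const (c := c))).1
    exact this.mono_set Ioo_subset_Ioc_self
  have h5 := isOpen_Ioo.ae_eq_zero_of_integral_contDiff_smul_eq_zero (U := Ioo a b) hloc (by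
    intro ψ hψ hψc hψs
    have h6 := key ψ hψ hψc hψs
    have h7 : Function.support (fun x => ψ x • (h x - c)) ⊆ Ioc a b :=
      (Function.support_smul_subset_left _ _).trans
        ((subset_tsupport _).trans (hψs.trans Ioo_subset_Ioc_self))
    rw [← intervalIntegral.integral_eq_integral_of_support_subset h7, ← h6]
    simp only [Complex.real_smul])
  rw [ae_restrict_iff' measurableSet_Ioo]
  filter_upwards [h5] with x hx hx'
  exact sub_eq_zero.1 (hx hx')

/-- A function with a weak derivative in `L²` has a representative that is a primitive of its
weak derivative. -/
theorem IsWeakDeriv.exists_primitive {a b : ℝ} (hab : a < b) {f g : L2I a b}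
    (h : IsWeakDeriv f g) :
    ∃ F : ℝ → ℂ, ContinuousOn F (Icc a b) ∧ f =ᵐ[volume.restrict (Ioo a b)] F ∧
      ∀ x ∈ Icc a b, ∀ y ∈ Icc a b, F y - F x = ∫ t in x..y, g t := by
  have ha : a ∈ Icc a b := left_mem_Icc.2 hab.le
  have hb : b ∈ Icc a b := right_mem_Icc.2 hab.le
  have hgi := L2I.intervalIntegrable g ha hb
  have hfi := L2I.intervalIntegrable f ha hb
  set G : ℝ → ℂ := fun x => ∫ t in a..x, g t with hG
  have hGc : ContinuousOn G (uIcc a b) :=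
    intervalIntegral.continuousOn_primitive_interval' hgi (by simp)
  have hGi : IntervalIntegrable G volume a b := hGc.intervalIntegrable
  obtain ⟨c, hc⟩ := ae_eq_const_of_integral_deriv_eq_zero hab (hfi.sub hGi) (by
    intro φ hφ hφc hφs
    have h1 := h φ hφ hφc hφs
    rw [integral_Ioo_eq hab.le, integral_Ioo_eq hab.le] at h1
    have h2 := integral_deriv_mul_primitive hgi (hφ.of_le (by exact_mod_cast le_top))
    have hφb : φ b = 0 := image_eq_zero_of_notMem_tsupport fun hh => (hφs hh).2.false
    rw [hφb] at h2
    have hdc : Continuous (deriv φ) :=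
      hφ.continuous_deriv (by exact_mod_cast le_top)
    have hdc' : Continuous fun x => ((deriv φ x : ℝ) : ℂ) := Complex.continuous_ofReal.comp hdc
    simp only [mul_sub]
    rw [intervalIntegral.integral_sub (hfi.continuousOn_mul hdc'.continuousOn)
      (hGi.continuousOn_mul hdc'.continuousOn), h1, h2]
    simp)
  refine ⟨fun x => c + G x, ?_, ?_, ?_⟩
  · rw [uIcc_of_le hab.le] at hGc
    exact continuousOn_const.add hGc
  · filter_upwards [hc] with x hx
    rw [← hx]; simp
  · intro x hx y hy
    simp only [hG, add_sub_add_left_eq_sub]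
    exact intervalIntegral.integral_interval_sub_left (L2I.intervalIntegrable g ha hy)
      (L2I.intervalIntegrable g ha hx)

/-! ### Functionals on `L²(a, b)` -/

theorem L2I.exists_pairing {a b : ℝ} {k : ℝ → ℝ} (hk : Continuous k) :
    ∃ Λ : L2I a b →L[ℂ] ℂ, ∀ f : L2I a b, Λ f = ∫ x in Ioo a b, ((k x : ℝ) : ℂ) * f x := by
  have hm : MemLp (fun x => ((k x : ℝ) : ℂ)) 2 (volume.restrict (Ioo a b)) := by
    obtain ⟨C, hC⟩ := isCompact_Icc.exists_bound_of_continuousOn (s := Icc a b) hk.continuousOn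
    refine MemLp.of_bound (Complex.continuous_ofReal.comp hk).aestronglyMeasurable C ?_
    rw [ae_restrict_iff' measurableSet_Ioo]
    refine Filter.Eventually.of_forall fun x hx => ?_
    simpa using hC x (Ioo_subset_Icc_self hx)
  refine ⟨innerSL ℂ (hm.toLp _), fun f => ?_⟩
  rw [innerSL_apply_apply, L2.inner_def]
  apply integral_congr_ae
  filter_upwards [hm.coeFn_toLp] with x hx
  simp only [hx]
  simp [mul_comm]

theorem L2I.exists_integral {a b c d : ℝ} (hac : a ≤ c) (hcd : c ≤ d) (hdb : d ≤ b) :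
    ∃ Λ : L2I a b →L[ℂ] ℂ, (∀ f : L2I a b, Λ f = ∫ x in c..d, f x) ∧
      ∀ f, ‖Λ f‖ ≤ √(d - c) * ‖f‖ := by
  have hs : (Ioc c d ∩ Ioo a b : Set ℝ) =ᵐ[volume] (Ioc c d : Set ℝ) := by
    have h1 : Ioo c d ⊆ Ioc c d ∩ Ioo a b := fun x hx =>
      ⟨Ioo_subset_Ioc_self hx, hac.trans_lt hx.1, hx.2.trans_le hdb⟩
    exact inter_subset_left.eventuallyLE.antisymm
      (Ioo_ae_eq_Ioc.symm.le.trans h1.eventuallyLE)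
  have hfin : (volume.restrict (Ioo a b)) (Ioc c d) ≠ ⊤ := by
    rw [Measure.restrict_apply measurableSet_Ioc, measure_congr hs]
    simp
  refine ⟨innerSL ℂ (indicatorConstLp 2 measurableSet_Ioc hfin (1 : ℂ)), fun f => ?_, fun f => ?_⟩
  · rw [innerSL_apply_apply, L2.inner_indicatorConstLp_one, intervalIntegral.integral_of_le hcd,
      Measure.restrict_restrict measurableSet_Ioc]
    exact setIntegral_congr_set hs
  · rw [innerSL_apply_apply]
    refine (norm_inner_le_norm _ _).trans (mul_le_mul_of_nonneg_right ?_ (norm_nonneg _))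
    rw [norm_indicatorConstLp (by simp) (by simp), norm_one, one_mul, measureReal_def,
      Measure.restrict_apply measurableSet_Ioc, measure_congr hs, Real.volume_Ioc,
      ENNReal.toReal_ofReal (sub_nonneg.2 hcd), ENNReal.toReal_ofNat, ← Real.sqrt_eq_rpow]

theorem L2I.norm_integral_le {a b : ℝ} (f : L2I a b) {x y : ℝ} (hx : x ∈ Icc a b)
    (hy : y ∈ Icc a b) : ‖∫ t in x..y, f t‖ ≤ √|y - x| * ‖f‖ := by
  rcases le_total x y with h | h
  · obtain ⟨Λ, h1, h2⟩ := L2I.exists_integral (a := a) (b := b) hx.1 h hy.2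
    rw [← h1, abs_of_nonneg (sub_nonneg.2 h)]
    exact h2 f
  · obtain ⟨Λ, h1, h2⟩ := L2I.exists_integral (a := a) (b := b) hy.1 h hx.2
    rw [intervalIntegral.integral_symm, norm_neg, ← h1, abs_sub_comm, abs_of_nonneg (sub_nonneg.2 h)]
    exact h2 f

theorem L2I.norm_sq_eq {a b : ℝ} (hab : a ≤ b) (f : L2I a b) {F : ℝ → ℂ}
    (hF : f =ᵐ[volume.restrict (Ioo a b)] F) : ‖f‖ ^ 2 = ∫ x in a..b, ‖F x‖ ^ 2 := by
  have h1 := congrArg Complex.re (L2.inner_def (𝕜 := ℂ) f f)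
  rw [inner_self_eq_norm_sq_to_K] at h1
  have h2 : ∀ᵐ x ∂(volume.restrict (Ioo a b)), inner ℂ (f x) (f x) = ((‖F x‖ ^ 2 : ℝ) : ℂ) := by
    filter_upwards [hF] with x hx
    rw [hx, inner_self_eq_norm_sq_to_K]
    push_cast; rfl
  rw [integral_congr_ae h2, integral_complex_ofReal, integral_Ioc_eq_integral_Ioo.symm,
    ← intervalIntegral.integral_of_le hab] at h1
  have h3 : ((‖f‖ : ℂ) ^ 2).re = ‖f‖ ^ 2 := by norm_cast
  have h4 : ((∫ x in a..b, ‖F x‖ ^ 2 : ℝ) : ℂ).re = ∫ x in a..b, ‖F x‖ ^ 2 := by norm_cast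
  rw [← h3, ← h4]
  exact h1

theorem L2I.norm_le_of_bound {a b : ℝ} (hab : a ≤ b) (f : L2I a b) {F : ℝ → ℂ} {M : ℝ}
    (hF : f =ᵐ[volume.restrict (Ioo a b)] F) (hc : ContinuousOn F (Icc a b))
    (hM : ∀ x ∈ Icc a b, ‖F x‖ ^ 2 ≤ M) : ‖f‖ ^ 2 ≤ (b - a) * M := by
  rw [L2I.norm_sq_eq hab f hF]
  have h1 : ∫ x in a..b, ‖F x‖ ^ 2 ≤ ∫ x in a..b, M := by
    apply intervalIntegral.integral_mono_on hab _ _ hM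
    · apply ContinuousOn.intervalIntegrable
      rw [uIcc_of_le hab]
      exact hc.norm.pow 2
    · simp
  simpa using h1

/-! ### Weak derivatives -/

namespace IsWeakDeriv

variable {a b : ℝ} {f g h f' g' : L2I a b}

theorem ae_eq_trace (hab : a < b) (H : IsWeakDeriv f g) :
    f =ᵐ[volume.restrict (Ioo a b)] trace f := by
  obtain ⟨F, hF, hfF, -⟩ := H.exists_primitive hab
  rw [Filter.EventuallyEq, ae_restrict_iff' measurableSet_Ioo] at hfF ⊢
  have hfF' := (ae_restrict_iff' measurableSet_Ioo).2 hfF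
  filter_upwards [hfF] with x hx hx'
  rw [trace_eq hab (Ioo_subset_Icc_self hx') f F hF hfF', hx hx']

theorem continuousOn_trace (hab : a < b) (H : IsWeakDeriv f g) :
    ContinuousOn (trace f) (Icc a b) := by
  obtain ⟨F, hF, hfF, -⟩ := H.exists_primitive hab
  exact hF.congr fun x hx => trace_eq hab hx f F hF hfF

theorem trace_sub (hab : a < b) (H : IsWeakDeriv f g) {x y : ℝ} (hx : x ∈ Icc a b)
    (hy : y ∈ Icc a b) : trace f y - trace f x = ∫ t in x..y, g t := by
  obtain ⟨F, hF, hfF, h⟩ := H.exists_primitive hab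
  rw [trace_eq hab hx f F hF hfF, trace_eq hab hy f F hF hfF, h x hx y hy]

theorem trace_sub' (hab : a < b) (H : IsWeakDeriv f g) (H' : IsWeakDeriv g h) {x y : ℝ}
    (hx : x ∈ Icc a b) (hy : y ∈ Icc a b) : trace f y - trace f x = ∫ t in x..y, trace g t := by
  rw [H.trace_sub hab hx hy]
  apply intervalIntegral.integral_congr_ae
  have h1 := (ae_restrict_iff' measurableSet_Ioo).1 (H'.ae_eq_trace hab)
  -- The half-open interval of integration may contain `b`, which lies outside the open interval on
  -- which the representatives are compared.
  have h2 : ∀ᵐ t : ℝ, t ≠ b := by simp [ae_iff]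
  filter_upwards [h1, h2] with t ht ht' htt
  apply ht
  have h3 : a ≤ min x y := le_min hx.1 hy.1
  have h4 : max x y ≤ b := max_le hx.2 hy.2
  exact ⟨h3.trans_lt htt.1, lt_of_le_of_ne (htt.2.trans h4) ht'⟩

theorem hasDerivAt_trace (hab : a < b) (H : IsWeakDeriv f g) (H' : IsWeakDeriv g h) {x : ℝ}
    (hx : x ∈ Ioo a b) : HasDerivAt (trace f) (trace g x) x := by
  have hc := H'.continuousOn_trace hab
  have hm : Icc a b ∈ nhds x := Icc_mem_nhds hx.1 hx.2
  have ha : a ∈ Icc a b := left_mem_Icc.2 hab.le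
  have h1 : HasDerivAt (fun y => ∫ t in a..y, trace g t) (trace g x) x := by
    apply intervalIntegral.integral_hasDerivAt_right
    · apply ContinuousOn.intervalIntegrable
      exact hc.mono (uIcc_subset_Icc ha (Ioo_subset_Icc_self hx))
    · exact (hc.mono Ioo_subset_Icc_self).stronglyMeasurableAtFilter isOpen_Ioo x hx
    · exact hc.continuousAt hm
  refine (h1.const_add (trace f a)).congr_of_eventuallyEq ?_
  filter_upwards [hm] with y hy
  rw [← H.trace_sub' hab H' ha hy]
  ring

theorem unique (hab : a < b) (H : IsWeakDeriv f g) (H' : IsWeakDeriv f g') : g = g' := by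
  have ha : a ∈ Icc a b := left_mem_Icc.2 hab.le
  have hb : b ∈ Icc a b := right_mem_Icc.2 hab.le
  have hi : Integrable (fun x => g x - g' x) (volume.restrict (Ioo a b)) :=
    g.integrable.sub g'.integrable
  have hI : ∀ (k : L2I a b) (φ : ℝ → ℝ), Continuous φ →
      Integrable (fun x => ((φ x : ℝ) : ℂ) * k x) (volume.restrict (Ioo a b)) := fun k φ hφ => by
    have := (L2I.intervalIntegrable k ha hb).continuousOn_mul
      (Complex.continuous_ofReal.comp hφ).continuousOn
    exact this.1.mono_set Ioo_subset_Ioc_self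
  have h5 := isOpen_Ioo.ae_eq_zero_of_integral_contDiff_smul_eq_zero (U := Ioo a b)
    (f := fun x => g x - g' x) (μ := volume) (IntegrableOn.locallyIntegrableOn hi) (by
    intro ψ hψ hψc hψs
    have h1 := H ψ hψ hψc hψs
    have h2 := H' ψ hψ hψc hψs
    rw [h1, neg_inj] at h2
    have h7 : ∀ x, x ∉ Ioo a b → ψ x • (g x - g' x) = 0 := fun x hx => by
      rw [image_eq_zero_of_notMem_tsupport fun hh => hx (hψs hh), zero_smul]
    rw [← setIntegral_eq_integral_of_forall_compl_eq_zero h7]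
    simp only [Complex.real_smul, mul_sub]
    rw [integral_sub (hI g ψ hψ.continuous) (hI g' ψ hψ.continuous), h2, sub_self])
  apply Lp.ext
  rw [Filter.EventuallyEq, ae_restrict_iff' measurableSet_Ioo]
  filter_upwards [h5] with x hx hx'
  exact sub_eq_zero.1 (hx hx')

/-- `IsWeakDeriv` is the vanishing of a family of continuous functionals. -/
theorem exists_functionals (a b : ℝ) :
    ∃ (ι : Type) (Λ : ι → (L2I a b × L2I a b →L[ℂ] ℂ)),
      ∀ f g : L2I a b, IsWeakDeriv f g ↔ ∀ i, Λ i (f, g) = 0 := by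
  let ι : Type := {φ : ℝ → ℝ // ContDiff ℝ ∞ φ ∧ HasCompactSupport φ ∧ tsupport φ ⊆ Ioo a b}
  have hd : ∀ φ : ι, Continuous (deriv φ.1) := fun φ =>
    φ.2.1.continuous_deriv (by exact_mod_cast le_top)
  choose Λ₁ h₁ using fun φ : ι => L2I.exists_pairing (a := a) (b := b) (hd φ)
  choose Λ₂ h₂ using fun φ : ι => L2I.exists_pairing (a := a) (b := b) φ.2.1.continuous
  refine ⟨ι, fun φ => (Λ₁ φ).comp (ContinuousLinearMap.fst ℂ _ _) +
    (Λ₂ φ).comp (ContinuousLinearMap.snd ℂ _ _), fun f g => ?_⟩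
  simp only [_root_.add_apply, ContinuousLinearMap.comp_apply,
    ContinuousLinearMap.coe_fst', ContinuousLinearMap.coe_snd', h₁, h₂]
  constructor
  · intro H φ
    rw [H φ.1 φ.2.1 φ.2.2.1 φ.2.2.2]
    ring
  · intro H φ h1 h2 h3
    exact eq_neg_of_add_eq_zero_left (H ⟨φ, h1, h2, h3⟩)

/-- Integrating the derivative of `(x - b) f` over `(a, b)` gives `(b - a) f(a) = ∫ f + ∫ (x - b)
f'`, and the right side is continuous in the pair. -/
theorem exists_trace_left (hab : a < b) :
    ∃ Λ : L2I a b × L2I a b →L[ℂ] ℂ, ∀ f g, IsWeakDeriv f g → trace f a = Λ (f, g) := by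
  have hbne : ((b - a : ℝ) : ℂ) ≠ 0 := by exact_mod_cast (sub_pos.2 hab).ne'
  obtain ⟨Λ₁, h₁⟩ := L2I.exists_pairing (a := a) (b := b) (k := fun _ => 1) continuous_const
  obtain ⟨Λ₂, h₂⟩ := L2I.exists_pairing (a := a) (b := b) (k := fun x => x - b) (by fun_prop)
  refine ⟨((b - a : ℝ) : ℂ)⁻¹ • (Λ₁.comp (ContinuousLinearMap.fst ℂ _ _) +
    (Λ₂).comp (ContinuousLinearMap.snd ℂ _ _)), fun f g H => ?_⟩
  have ha : a ∈ Icc a b := left_mem_Icc.2 hab.le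
  have hb : b ∈ Icc a b := right_mem_Icc.2 hab.le
  simp only [_root_.smul_apply, _root_.add_apply,
    ContinuousLinearMap.comp_apply, ContinuousLinearMap.coe_fst', ContinuousLinearMap.coe_snd',
    h₁, h₂, smul_eq_mul]
  rw [eq_inv_mul_iff_mul_eq₀ hbne, integral_congr_ae (g := fun x => trace f x)
    (by filter_upwards [H.ae_eq_trace hab] with x hx; simp [hx]), integral_Ioo_eq hab.le,
    integral_Ioo_eq hab.le]
  have h := integral_deriv_mul_primitive (p := fun x => x - b) (L2I.intervalIntegrable g ha hb)
    (by fun_prop)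
  have hd : ∀ x, deriv (fun x => x - b) x = 1 := fun x => by simp
  simp only [hd, sub_self, Complex.ofReal_zero, zero_mul, zero_sub, Complex.ofReal_one,
    one_mul] at h
  have h3 : ∫ x in a..b, (∫ y in a..x, g y) = ∫ x in a..b, (trace f x - trace f a) := by
    apply intervalIntegral.integral_congr
    intro x hx
    rw [uIcc_of_le hab.le] at hx
    simp only
    rw [H.trace_sub hab ha hx]
  rw [h3, intervalIntegral.integral_sub] at h
  · simp only [intervalIntegral.integral_const] at h
    rw [Complex.real_smul] at h
    linear_combination -h
  · apply ContinuousOn.intervalIntegrable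
    rw [uIcc_of_le hab.le]
    exact H.continuousOn_trace hab
  · simp

/-- On pairs `(f, f')` the trace at a point is a continuous functional. -/
theorem exists_trace (hab : a < b) {c : ℝ} (hc : c ∈ Icc a b) :
    ∃ Λ : L2I a b × L2I a b →L[ℂ] ℂ, ∀ f g, IsWeakDeriv f g → trace f c = Λ (f, g) := by
  obtain ⟨Λ₁, h₁⟩ := exists_trace_left hab
  obtain ⟨Λ₂, h₂, -⟩ := L2I.exists_integral (a := a) (b := b) le_rfl hc.1 hc.2
  refine ⟨Λ₁ + Λ₂.comp (ContinuousLinearMap.snd ℂ _ _), fun f g H => ?_⟩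
  simp only [_root_.add_apply, ContinuousLinearMap.comp_apply,
    ContinuousLinearMap.coe_snd', h₂]
  rw [← h₁ f g H, ← H.trace_sub hab (left_mem_Icc.2 hab.le) hc]
  ring

/-- Interpolation: the first derivative is controlled by the function and its second derivative. -/
theorem exists_norm_le (hab : a < b) :
    ∃ C : ℝ, 0 ≤ C ∧ ∀ f g h : L2I a b, IsWeakDeriv f g → IsWeakDeriv g h →
      ‖g‖ ≤ C * (‖f‖ + ‖h‖) := by
  obtain ⟨η, hη, hηc, hηs, hη1⟩ := exists_test_integral_eq_one hab
  have hd : Continuous (deriv η) := hη.continuous_deriv (by exact_mod_cast le_top)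
  obtain ⟨Λ, hΛ⟩ := L2I.exists_pairing (a := a) (b := b) hd
  obtain ⟨M, hM⟩ := isCompact_Icc.exists_bound_of_continuousOn (s := Icc a b)
    hη.continuous.continuousOn
  have ha : a ∈ Icc a b := left_mem_Icc.2 hab.le
  have hb : b ∈ Icc a b := right_mem_Icc.2 hab.le
  have hM0 : 0 ≤ M := (norm_nonneg _).trans (hM a ha)
  have hba : 0 < b - a := sub_pos.2 hab
  set K : ℝ := ‖Λ‖ + M * √(b - a) * (b - a) with hK
  have hK0 : 0 ≤ K := by positivity
  refine ⟨√(b - a) * K, by positivity, fun f g h H H' => ?_⟩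
  -- Averaging `g(x)` against `η` splits it into `∫ η g = -∫ η' f`, controlled by `f`, and the mean
  -- of `η(y) (g(x) - g(y))`, controlled by `h = g'`.
  have hbound : ∀ x ∈ Icc a b, ‖trace g x‖ ≤ K * (‖f‖ + ‖h‖) := by
    intro x hx
    have h1 := H η hη hηc hηs
    have hcg := H'.continuousOn_trace hab
    have hηC : Continuous fun y => ((η y : ℝ) : ℂ) := Complex.continuous_ofReal.comp hη.continuous
    have h2 : ∫ y in Ioo a b, ((η y : ℝ) : ℂ) * g y = ∫ y in a..b, ((η y : ℝ) : ℂ) * trace g y := by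
      rw [← integral_Ioo_eq hab.le]
      apply integral_congr_ae
      filter_upwards [H'.ae_eq_trace hab] with y hy
      rw [hy]
    have h3 : trace g x = (∫ y in a..b, ((η y : ℝ) : ℂ) * trace g y) +
        ∫ y in a..b, ((η y : ℝ) : ℂ) * (trace g x - trace g y) := by
      rw [← intervalIntegral.integral_add]
      · have : ∀ y, ((η y : ℝ) : ℂ) * trace g y + ((η y : ℝ) : ℂ) * (trace g x - trace g y)
            = ((η y : ℝ) : ℂ) * trace g x := fun y => by ring
        simp only [this]
        rw [intervalIntegral.integral_mul_const, intervalIntegral.integral_ofReal, hη1]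
        simp
      · apply ContinuousOn.intervalIntegrable
        rw [uIcc_of_le hab.le]
        exact hηC.continuousOn.mul hcg
      · apply ContinuousOn.intervalIntegrable
        rw [uIcc_of_le hab.le]
        exact hηC.continuousOn.mul (continuousOn_const.sub hcg)
    have h4 : ‖∫ y in a..b, ((η y : ℝ) : ℂ) * (trace g x - trace g y)‖
        ≤ (M * (√(b - a) * ‖h‖)) * |b - a| := by
      apply intervalIntegral.norm_integral_le_of_norm_le_const
      intro y hy
      rw [uIoc_of_le hab.le] at hy
      have hy' : y ∈ Icc a b := Ioc_subset_Icc_self hy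
      rw [norm_mul, H'.trace_sub hab hy' hx]
      refine mul_le_mul ?_ ?_ (norm_nonneg _) hM0
      · simpa using hM y hy'
      · refine (L2I.norm_integral_le h hy' hx).trans ?_
        refine mul_le_mul_of_nonneg_right (Real.sqrt_le_sqrt ?_) (norm_nonneg _)
        rw [abs_le]
        constructor <;> linarith [hx.1, hx.2, hy'.1, hy'.2]
    have h5 : ‖∫ y in a..b, ((η y : ℝ) : ℂ) * trace g y‖ ≤ ‖Λ‖ * ‖f‖ := by
      rw [← h2, ← norm_neg, ← h1, ← hΛ]
      exact Λ.le_opNorm f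
    rw [h3]
    refine (norm_add_le _ _).trans ((add_le_add h5 h4).trans ?_)
    rw [abs_of_pos hba, hK]
    have e1 : 0 ≤ ‖Λ‖ * ‖h‖ := by positivity
    have e2 : 0 ≤ M * √(b - a) * (b - a) * ‖f‖ := by positivity
    nlinarith [e1, e2]
  have h6 := L2I.norm_le_of_bound (M := (K * (‖f‖ + ‖h‖)) ^ 2) hab.le g (H'.ae_eq_trace hab)
    (H'.continuousOn_trace hab)
    (fun x hx => pow_le_pow_left₀ (norm_nonneg _) (hbound x hx) 2)
  refine le_of_sq_le_sq ?_ (by positivity)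
  refine h6.trans (le_of_eq ?_)
  have : (√(b - a)) ^ 2 = b - a := Real.sq_sqrt hba.le
  linear_combination (-(K * (‖f‖ + ‖h‖)) ^ 2) * this

/-- A form of Rellich's theorem: up to a small multiple of the norm of the derivative, the norm of
a function is controlled by finitely many functionals. -/
theorem exists_sampling (hab : a < b) {δ : ℝ} (hδ : 0 < δ) :
    ∃ (K : ℕ) (Λ : Fin K → (L2I a b × L2I a b →L[ℂ] ℂ)) (C : ℝ), 0 ≤ C ∧
      ∀ f g : L2I a b, IsWeakDeriv f g →
        ‖f‖ ^ 2 ≤ δ * ‖g‖ ^ 2 + C * ∑ i, ‖Λ i (f, g)‖ ^ 2 := by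
  have hba : 0 < b - a := sub_pos.2 hab
  -- On a grid of mesh `(b - a) / K` the functionals are the grid values. The error between grid
  -- points, squared, doubled and integrated over `(a, b)`, is `2 (b - a) ^ 2 / K` times `‖g‖ ^ 2`,
  -- which is to be at most `δ`.
  obtain ⟨K, hK⟩ := exists_nat_gt (2 * (b - a) ^ 2 / δ)
  have hK0 : (0 : ℝ) < K := lt_of_le_of_lt (by positivity) hK
  have hpt : ∀ i : Fin (K + 1), a + i * ((b - a) / K) ∈ Icc a b := by
    intro i
    have hi : (i : ℝ) ≤ K := by exact_mod_cast Nat.lt_succ_iff.1 i.2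
    constructor
    · have : 0 ≤ (i : ℝ) * ((b - a) / K) := by positivity
      linarith
    · have : (i : ℝ) * ((b - a) / K) ≤ K * ((b - a) / K) :=
        mul_le_mul_of_nonneg_right hi (by positivity)
      rw [mul_div_cancel₀ _ hK0.ne'] at this
      linarith
  choose Λ hΛ using fun i : Fin (K + 1) => exists_trace hab (hpt i)
  refine ⟨K + 1, Λ, 2 * (b - a), by positivity, fun f g H => ?_⟩
  have hbd : ∀ x ∈ Icc a b,
      ‖trace f x‖ ^ 2 ≤ 2 * ∑ i, ‖Λ i (f, g)‖ ^ 2 + 2 * ((b - a) / K) * ‖g‖ ^ 2 := by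
    intro x hx
    -- The index of the last grid point not to the right of `x`.
    set j := ⌊(x - a) / ((b - a) / K)⌋₊ with hj
    have hq : 0 < (b - a) / K := by positivity
    have hx0 : 0 ≤ (x - a) / ((b - a) / K) := div_nonneg (by linarith [hx.1]) hq.le
    have hj1 : (j : ℝ) ≤ (x - a) / ((b - a) / K) := Nat.floor_le hx0
    have hj2 : (x - a) / ((b - a) / K) < j + 1 := Nat.lt_floor_add_one _
    have hj3 : (x - a) / ((b - a) / K) ≤ K := by
      rw [div_le_iff₀ hq, mul_div_cancel₀ _ hK0.ne']
      linarith [hx.2]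
    have hjK : j < K + 1 := Nat.lt_succ_of_le (by exact_mod_cast hj1.trans hj3)
    rw [le_div_iff₀ hq] at hj1
    rw [div_lt_iff₀ hq] at hj2
    have h1 := H.trace_sub hab (hpt ⟨j, hjK⟩) hx
    have h2 := L2I.norm_integral_le g (hpt ⟨j, hjK⟩) hx
    rw [← h1] at h2
    have h3 : |x - (a + j * ((b - a) / K))| ≤ (b - a) / K := by
      rw [abs_le]; constructor <;> linarith
    have h4 : √|x - (a + j * ((b - a) / K))| ^ 2 ≤ (b - a) / K := by
      rw [Real.sq_sqrt (abs_nonneg _)]; exact h3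
    have h5 : ‖trace f (a + j * ((b - a) / K))‖ ^ 2 ≤ ∑ i, ‖Λ i (f, g)‖ ^ 2 := by
      have := Finset.single_le_sum (f := fun i => ‖Λ i (f, g)‖ ^ 2)
        (fun i _ => by positivity) (Finset.mem_univ (⟨j, hjK⟩ : Fin (K + 1)))
      rwa [← hΛ ⟨j, hjK⟩ f g H] at this
    have h6 : ‖trace f x‖ ≤ ‖trace f (a + j * ((b - a) / K))‖ +
        √|x - (a + j * ((b - a) / K))| * ‖g‖ := by
      have := norm_add_le (trace f (a + j * ((b - a) / K)))
        (trace f x - trace f (a + j * ((b - a) / K)))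
      rw [add_sub_cancel] at this
      exact this.trans (by gcongr)
    have h7 : ‖trace f x‖ ^ 2 ≤ (‖trace f (a + j * ((b - a) / K))‖ +
        √|x - (a + j * ((b - a) / K))| * ‖g‖) ^ 2 := by gcongr
    refine h7.trans (add_sq_le.trans ?_)
    rw [mul_pow, mul_add]
    have h8 := mul_le_mul_of_nonneg_right h4 (sq_nonneg ‖g‖)
    linarith
  have h9 := L2I.norm_le_of_bound hab.le f (H.ae_eq_trace hab) (H.continuousOn_trace hab) hbd
  have h10 : (b - a) * (2 * ((b - a) / K)) ≤ δ := by
    rw [div_lt_iff₀ hδ] at hK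
    rw [show (b - a) * (2 * ((b - a) / K)) = 2 * (b - a) ^ 2 / K by ring, div_le_iff₀ hK0]
    linarith
  have h11 := mul_le_mul_of_nonneg_right h10 (sq_nonneg ‖g‖)
  linarith

end IsWeakDeriv

/-! ### Linear operations on weak derivatives and traces -/

namespace IsWeakDeriv

variable {a b : ℝ} {f g h f' g' : L2I a b}

theorem add (H : IsWeakDeriv f g) (H' : IsWeakDeriv f' g') : IsWeakDeriv (f + f') (g + g') := by
  obtain ⟨ι, Λ, hΛ⟩ := exists_functionals a b
  rw [hΛ] at H H' ⊢
  intro i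
  rw [← Prod.mk_add_mk, map_add, H, H', add_zero]

theorem smul (c : ℂ) (H : IsWeakDeriv f g) : IsWeakDeriv (c • f) (c • g) := by
  obtain ⟨ι, Λ, hΛ⟩ := exists_functionals a b
  rw [hΛ] at H ⊢
  intro i
  rw [← Prod.smul_mk, map_smul, H, smul_zero]

theorem sub (H : IsWeakDeriv f g) (H' : IsWeakDeriv f' g') : IsWeakDeriv (f - f') (g - g') := by
  have := H.add (H'.smul (-1))
  simpa [sub_eq_add_neg] using this

theorem trace_comb (hab : a < b) (H : IsWeakDeriv f g) (H' : IsWeakDeriv f' g') {c : ℝ}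
    (hc : c ∈ Icc a b) : trace (f - f') c = trace f c - trace f' c := by
  apply trace_eq hab hc (f - f') (fun x => trace f x - trace f' x)
  · exact (H.continuousOn_trace hab).sub (H'.continuousOn_trace hab)
  · filter_upwards [H.ae_eq_trace hab, H'.ae_eq_trace hab, Lp.coeFn_sub f f'] with x h1 h2 h3
    rw [h3, Pi.sub_apply, h1, h2]

end IsWeakDeriv

/-- Restriction of a square integrable function to a smaller interval. -/
theorem L2I.exists_restrict {a b c d : ℝ} (hac : a ≤ c) (hdb : d ≤ b) :
    ∃ R : L2I a b →L[ℂ] L2I c d,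
      (∀ f : L2I a b, R f =ᵐ[volume.restrict (Ioo c d)] f) ∧ ∀ f, ‖R f‖ ≤ ‖f‖ := by
  have hμ : (volume.restrict (Ioo c d) : Measure ℝ) ≤ volume.restrict (Ioo a b) :=
    Measure.restrict_mono (Ioo_subset_Ioo hac hdb) le_rfl
  have hm : ∀ f : L2I a b, MemLp f 2 (volume.restrict (Ioo c d)) := fun f =>
    (Lp.memLp f).mono_measure hμ
  let R : L2I a b →ₗ[ℂ] L2I c d :=
    { toFun := fun f => (hm f).toLp f
      map_add' := fun f g => by
        rw [← MemLp.toLp_add]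
        apply MemLp.toLp_congr
        exact ae_mono hμ (Lp.coeFn_add f g)
      map_smul' := fun r f => by
        rw [RingHom.id_apply, ← MemLp.toLp_const_smul]
        apply MemLp.toLp_congr
        exact ae_mono hμ (Lp.coeFn_smul r f) }
  have hR : ∀ f, ‖R f‖ ≤ ‖f‖ := fun f => by
    change ‖(hm f).toLp f‖ ≤ ‖f‖
    rw [Lp.norm_toLp, Lp.norm_def]
    exact ENNReal.toReal_mono (Lp.eLpNorm_ne_top f) (eLpNorm_mono_measure f hμ)
  exact ⟨R.mkContinuous 1 fun f => by rw [one_mul]; exact hR f,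
    fun f => (hm f).coeFn_toLp, hR⟩

theorem IsWeakDeriv.restrict {a b c d : ℝ} (hac : a ≤ c) (hdb : d ≤ b) {f g : L2I a b}
    {f' g' : L2I c d} (hf : f' =ᵐ[volume.restrict (Ioo c d)] f)
    (hg : g' =ᵐ[volume.restrict (Ioo c d)] g) (H : IsWeakDeriv f g) : IsWeakDeriv f' g' := by
  intro φ hφ hφc hφs
  have hsub : Ioo c d ⊆ Ioo a b := Ioo_subset_Ioo hac hdb
  have h := H φ hφ hφc (hφs.trans hsub)
  have e1 : ∫ x in Ioo a b, ((deriv φ x : ℝ) : ℂ) * f x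
      = ∫ x in Ioo c d, ((deriv φ x : ℝ) : ℂ) * f x := by
    apply setIntegral_eq_of_subset_of_forall_sdiff_eq_zero measurableSet_Ioo hsub
    intro x hx
    have : deriv φ x = 0 := by
      by_contra h
      exact hx.2 (hφs (support_deriv_subset h))
    simp [this]
  have e2 : ∫ x in Ioo a b, ((φ x : ℝ) : ℂ) * g x = ∫ x in Ioo c d, ((φ x : ℝ) : ℂ) * g x := by
    apply setIntegral_eq_of_subset_of_forall_sdiff_eq_zero measurableSet_Ioo hsub
    intro x hx
    simp [image_eq_zero_of_notMem_tsupport fun h => hx.2 (hφs h)]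
  rw [e1, e2] at h
  calc _ = ∫ x in Ioo c d, ((deriv φ x : ℝ) : ℂ) * f x := by
        apply integral_congr_ae; filter_upwards [hf] with x hx; rw [hx]
    _ = _ := h
    _ = _ := by
        congr 1; apply integral_congr_ae; filter_upwards [hg] with x hx; rw [hx]

theorem IsWeakDeriv.trace_restrict {a b c d : ℝ} (hab : a < b) (hcd : c < d) (hac : a ≤ c)
    (hdb : d ≤ b) {f g : L2I a b} {f' : L2I c d} (hf : f' =ᵐ[volume.restrict (Ioo c d)] f)
    (H : IsWeakDeriv f g) {x : ℝ} (hx : x ∈ Icc c d) : trace f' x = trace f x := by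
  apply trace_eq hcd hx
  · exact (H.continuousOn_trace hab).mono (Icc_subset_Icc hac hdb)
  · exact hf.trans (ae_mono (Measure.restrict_mono (Ioo_subset_Ioo hac hdb) le_rfl)
      (H.ae_eq_trace hab))

/-- The bilinear form `(f, g) ↦ Re i ∫ q f ḡ`. -/
theorem L2I.exists_form {a b : ℝ} {q : ℝ → ℝ} (hq : Continuous q) :
    ∃ Φ : L2I a b →L[ℝ] L2I a b →L[ℝ] ℝ, ∀ f g : L2I a b, ∀ F G : ℝ → ℂ,
      f =ᵐ[volume.restrict (Ioo a b)] F → g =ᵐ[volume.restrict (Ioo a b)] G →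
      Φ f g = ∫ x in Ioo a b, q x * inner ℝ (Complex.I * F x) (G x) := by
  have hm : MemLp q ⊤ (volume.restrict (Ioo a b)) := by
    obtain ⟨C, hC⟩ := isCompact_Icc.exists_bound_of_continuousOn (s := Icc a b) hq.continuousOn
    refine memLp_top_of_bound hq.aestronglyMeasurable C ?_
    rw [ae_restrict_iff' measurableSet_Ioo]
    exact Filter.Eventually.of_forall fun x hx => hC x (Ioo_subset_Icc_self hx)
  -- Multiplication by the bounded weight `q`, as an operator on `L²` through Hölder's inequality
  -- with exponents `∞` and `2`.
  let Mq : L2I a b →L[ℝ] L2I a b :=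
    (ContinuousLinearMap.lsmul ℝ ℝ (E := ℂ)).holderL (volume.restrict (Ioo a b)) ⊤ 2 2 (hm.toLp _)
  have hMq : ∀ f : L2I a b, Mq f =ᵐ[volume.restrict (Ioo a b)] fun x => q x • f x := by
    intro f
    have := (ContinuousLinearMap.lsmul ℝ ℝ (E := ℂ)).coeFn_holder (r := 2) (hm.toLp _) f
    filter_upwards [this, hm.coeFn_toLp] with x h1 h2
    change (Mq f : ℝ → ℂ) x = _ at h1
    rw [h1, h2]; rfl
  let B : ℂ →L[ℝ] ℂ →L[ℝ] ℝ := (innerSL ℝ).comp (ContinuousLinearMap.mul ℝ ℂ Complex.I)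
  have hB : ∀ z w, B z w = inner ℝ (Complex.I * z) w := fun z w => rfl
  refine ⟨(B.lpPairing (volume.restrict (Ioo a b)) 2 2).comp Mq, fun f g F G hF hG => ?_⟩
  change B.lpPairing (volume.restrict (Ioo a b)) 2 2 (Mq f) g = _
  rw [ContinuousLinearMap.lpPairing_eq_integral]
  apply integral_congr_ae
  filter_upwards [hMq f, hF, hG] with x h1 h2 h3
  rw [h1, h2, h3, hB, mul_smul_comm, real_inner_smul_left]

/-! ### The multiplier identity -/

theorem hasDerivAt_re {f : ℝ → ℂ} {f' : ℂ} {x : ℝ} (h : HasDerivAt f f' x) :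
    HasDerivAt (fun y => (f y).re) f'.re x :=
  Complex.reCLM.hasFDerivAt.comp_hasDerivAt x h

theorem hasDerivAt_im {f : ℝ → ℂ} {f' : ℂ} {x : ℝ} (h : HasDerivAt f f' x) :
    HasDerivAt (fun y => (f y).im) f'.im x :=
  Complex.imCLM.hasFDerivAt.comp_hasDerivAt x h

/-- The boundary expression in the multiplier identity with weight `q`. -/
def bdryForm (q₀ q₁ q₂ : ℝ) (u₀ u₁ u₂ u₃ w₀ : ℂ) : ℝ :=
  q₀ * (-‖u₁‖ ^ 2 + 2 * inner ℝ u₃ u₁ - ‖u₂‖ ^ 2 + inner ℝ (Complex.I * u₀) w₀)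
    + q₁ * (-2 * inner ℝ u₂ u₁ - inner ℝ u₀ u₁ + inner ℝ u₀ u₃ - inner ℝ u₁ u₂)
    - q₂ * inner ℝ u₀ u₂

theorem inner_eq (z w : ℂ) : inner ℝ z w = z.re * w.re + z.im * w.im := by
  rw [Complex.inner]; simp; ring

theorem norm_sq_eq (z : ℂ) : ‖z‖ ^ 2 = z.re * z.re + z.im * z.im := by
  rw [← Complex.normSq_eq_norm_sq, Complex.normSq_apply]

/-- The right side minus the left is the fundamental theorem of calculus for `bdryForm`. Time does
not appear: `w₀` plays the role of the time derivative of `u₀`, so the left side is what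
differentiating the quadratic form along a solution would give. -/
theorem multiplier_identity {a b : ℝ} (hab : a ≤ b) {q₀ q₁ q₂ q₃ : ℝ → ℝ}
    (hq₀ : ∀ x, HasDerivAt q₀ (q₁ x) x) (hq₁ : ∀ x, HasDerivAt q₁ (q₂ x) x)
    (hq₂ : ∀ x, HasDerivAt q₂ (q₃ x) x) (hq₃ : Continuous q₃)
    {u₀ u₁ u₂ u₃ u₄ w₀ w₁ : ℝ → ℂ}
    (c₀ : ContinuousOn u₀ (Icc a b)) (c₁ : ContinuousOn u₁ (Icc a b))
    (c₂ : ContinuousOn u₂ (Icc a b)) (c₃ : ContinuousOn u₃ (Icc a b))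
    (d₀ : ContinuousOn w₀ (Icc a b)) (d₁ : ContinuousOn w₁ (Icc a b))
    (h₀ : ∀ x ∈ Ioo a b, HasDerivAt u₀ (u₁ x) x) (h₁ : ∀ x ∈ Ioo a b, HasDerivAt u₁ (u₂ x) x)
    (h₂ : ∀ x ∈ Ioo a b, HasDerivAt u₂ (u₃ x) x) (h₃ : ∀ x ∈ Ioo a b, HasDerivAt u₃ (u₄ x) x)
    (k₀ : ∀ x ∈ Ioo a b, HasDerivAt w₀ (w₁ x) x)
    (heq : ∀ x ∈ Ioo a b, w₀ x = Complex.I * (u₂ x - u₄ x)) :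
    ∫ x in a..b, q₀ x * (inner ℝ (Complex.I * w₀ x) (u₁ x) + inner ℝ (Complex.I * u₀ x) (w₁ x))
      = bdryForm (q₀ b) (q₁ b) (q₂ b) (u₀ b) (u₁ b) (u₂ b) (u₃ b) (w₀ b)
        - bdryForm (q₀ a) (q₁ a) (q₂ a) (u₀ a) (u₁ a) (u₂ a) (u₃ a) (w₀ a)
        + ∫ x in a..b, (q₁ x * (2 * ‖u₁ x‖ ^ 2 + 4 * ‖u₂ x‖ ^ 2)
            + q₂ x * (inner ℝ (u₀ x) (u₁ x) + 4 * inner ℝ (u₁ x) (u₂ x))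
            + q₃ x * inner ℝ (u₀ x) (u₂ x)) := by
  have cq₀ : Continuous q₀ := continuous_iff_continuousAt.2 fun x => (hq₀ x).continuousAt
  have cq₁ : Continuous q₁ := continuous_iff_continuousAt.2 fun x => (hq₁ x).continuousAt
  have cq₂ : Continuous q₂ := continuous_iff_continuousAt.2 fun x => (hq₂ x).continuousAt
  have r₀ := cq₀.continuousOn (s := Icc a b)
  have r₁ := cq₁.continuousOn (s := Icc a b)
  have r₂ := cq₂.continuousOn (s := Icc a b)
  have r₃ := hq₃.continuousOn (s := Icc a b)
  have cI : ContinuousOn (fun _ : ℝ => Complex.I) (Icc a b) := continuousOn_const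
  have iL : IntervalIntegrable (fun x => q₀ x * (inner ℝ (Complex.I * w₀ x) (u₁ x)
      + inner ℝ (Complex.I * u₀ x) (w₁ x))) volume a b := by
    apply ContinuousOn.intervalIntegrable
    rw [uIcc_of_le hab]
    exact r₀.mul (((cI.mul d₀).inner c₁).add ((cI.mul c₀).inner d₁))
  have iR : IntervalIntegrable (fun x => q₁ x * (2 * ‖u₁ x‖ ^ 2 + 4 * ‖u₂ x‖ ^ 2)
      + q₂ x * (inner ℝ (u₀ x) (u₁ x) + 4 * inner ℝ (u₁ x) (u₂ x))
      + q₃ x * inner ℝ (u₀ x) (u₂ x)) volume a b := by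
    apply ContinuousOn.intervalIntegrable
    rw [uIcc_of_le hab]
    exact ((r₁.mul ((continuousOn_const.mul (c₁.norm.pow 2)).add
      (continuousOn_const.mul (c₂.norm.pow 2)))).add
      (r₂.mul ((c₀.inner c₁).add (continuousOn_const.mul (c₁.inner c₂))))).add
      (r₃.mul (c₀.inner c₂))
  rw [← sub_eq_iff_eq_add, ← intervalIntegral.integral_sub iL iR]
  apply intervalIntegral.integral_eq_sub_of_hasDerivAt_of_le hab
    (f := fun x => bdryForm (q₀ x) (q₁ x) (q₂ x) (u₀ x) (u₁ x) (u₂ x) (u₃ x) (w₀ x)) _ _ (iL.sub iR)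
  · unfold bdryForm
    exact ((r₀.mul ((((c₁.norm.pow 2).neg.add (continuousOn_const.mul (c₃.inner c₁))).sub
      (c₂.norm.pow 2)).add ((cI.mul c₀).inner d₀))).add
      (r₁.mul ((((continuousOn_const.mul (c₂.inner c₁)).sub (c₀.inner c₁)).add
      (c₀.inner c₃)).sub (c₁.inner c₂)))).sub (r₂.mul (c₀.inner c₂))
  · intro x hx
    have e := heq x hx
    -- The derivative of `u₃` introduces `u₄`; the equation replaces it by `u₂` and `w₀`.
    have e1 : (u₄ x).re = (u₂ x).re - (w₀ x).im := by rw [e]; simp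
    have e2 : (u₄ x).im = (u₂ x).im + (w₀ x).re := by rw [e]; simp
    have a0 := hasDerivAt_re (h₀ x hx)
    have a0' := hasDerivAt_im (h₀ x hx)
    have a1 := hasDerivAt_re (h₁ x hx)
    have a1' := hasDerivAt_im (h₁ x hx)
    have a2 := hasDerivAt_re (h₂ x hx)
    have a2' := hasDerivAt_im (h₂ x hx)
    have a3 := hasDerivAt_re (h₃ x hx)
    have a3' := hasDerivAt_im (h₃ x hx)
    have b0 := hasDerivAt_re (k₀ x hx)
    have b0' := hasDerivAt_im (k₀ x hx)
    simp only [bdryForm, inner_eq, norm_sq_eq, Complex.mul_re, Complex.mul_im, Complex.I_re,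
      Complex.I_im, zero_mul, one_mul, zero_sub, zero_add]
    have D := (((hq₀ x).fun_mul ((((((a1.fun_mul a1).fun_add (a1'.fun_mul a1')).fun_neg).fun_add
      (((a3.fun_mul a1).fun_add (a3'.fun_mul a1')).const_mul 2)).fun_sub
      ((a2.fun_mul a2).fun_add (a2'.fun_mul a2'))).fun_add
      ((a0'.fun_neg.fun_mul b0).fun_add (a0.fun_mul b0')))).fun_add
      ((hq₁ x).fun_mul ((((((a2.fun_mul a1).fun_add (a2'.fun_mul a1')).const_mul (-2)).fun_sub
      ((a0.fun_mul a1).fun_add (a0'.fun_mul a1'))).fun_add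
      ((a0.fun_mul a3).fun_add (a0'.fun_mul a3'))).fun_sub
      ((a1.fun_mul a2).fun_add (a1'.fun_mul a2'))))).fun_sub
      ((hq₂ x).fun_mul ((a0.fun_mul a2).fun_add (a0'.fun_mul a2')))
    convert D using 1
    rw [e1, e2]
    ring

/-! ### Closed subspaces -/

/-- `S` is (the carrier of) a closed subspace. -/
def IsClosedSubspace {E : Type*} [NormedAddCommGroup E] [NormedSpace ℂ E] (S : Set E) : Prop :=
  ∃ D : Submodule ℂ E, IsClosed (D : Set E) ∧ (D : Set E) = S

namespace IsClosedSubspace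

variable {E F : Type*} [NormedAddCommGroup E] [NormedSpace ℂ E] [NormedAddCommGroup F]
  [NormedSpace ℂ F] {S S' : Set E}

theorem zero_mem (h : IsClosedSubspace S) : (0 : E) ∈ S := by
  obtain ⟨D, -, rfl⟩ := h
  exact D.zero_mem

theorem add_mem (h : IsClosedSubspace S) {x y : E} (hx : x ∈ S) (hy : y ∈ S) : x + y ∈ S := by
  obtain ⟨D, -, rfl⟩ := h
  exact D.add_mem hx hy

theorem sub_mem (h : IsClosedSubspace S) {x y : E} (hx : x ∈ S) (hy : y ∈ S) : x - y ∈ S := by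
  obtain ⟨D, -, rfl⟩ := h
  exact D.sub_mem hx hy

theorem smul_mem (h : IsClosedSubspace S) (c : ℂ) {x : E} (hx : x ∈ S) : c • x ∈ S := by
  obtain ⟨D, -, rfl⟩ := h
  exact D.smul_mem c hx

theorem isClosed (h : IsClosedSubspace S) : IsClosed S := by
  obtain ⟨D, hD, rfl⟩ := h
  exact hD

theorem inter (h : IsClosedSubspace S) (h' : IsClosedSubspace S') : IsClosedSubspace (S ∩ S') := by
  obtain ⟨D, hD, rfl⟩ := h
  obtain ⟨D', hD', rfl⟩ := h'
  exact ⟨D ⊓ D', by simpa using hD.inter hD', by simp⟩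

theorem ker (f : E →L[ℂ] F) : IsClosedSubspace {u | f u = 0} :=
  ⟨LinearMap.ker f.toLinearMap, f.isClosed_ker, by ext; simp⟩

theorem forall_mem {ι : Sort*} {T : ι → Set E} (h : ∀ i, IsClosedSubspace (T i)) :
    IsClosedSubspace {u | ∀ i, u ∈ T i} := by
  choose D hD hDT using h
  refine ⟨⨅ i, D i, ?_, ?_⟩
  · rw [Submodule.coe_iInf]
    exact isClosed_iInter hD
  · ext u
    simp [← hDT]

/-- A closed subspace is complete, so the integral can be computed inside it. Membership is known
only on the interval of integration, hence the composition with the projection onto that interval.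
-/
theorem integral_mem [CompleteSpace E] [NormedSpace ℝ E] [IsScalarTower ℝ ℂ E] (h : IsClosedSubspace S) {f : ℝ → E} (hf : Continuous f)
    {a b : ℝ} (hS : ∀ s ∈ uIcc a b, f s ∈ S) : ∫ s in a..b, f s ∈ S := by
  have key : ∀ a b : ℝ, a ≤ b → (∀ s ∈ Icc a b, f s ∈ S) → ∫ s in a..b, f s ∈ S := by
    intro a b hab hS
    obtain ⟨D, hD, rfl⟩ := h
    have : CompleteSpace D := hD.completeSpace_coe
    let g : ℝ → D := fun s => ⟨f (projIcc a b hab s), hS _ (projIcc a b hab s).2⟩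
    have hg : Continuous g :=
      (hf.comp (continuous_subtype_val.comp continuous_projIcc)).subtype_mk _
    have h1 := D.subtypeL.intervalIntegral_comp_comm (hg.intervalIntegrable (μ := volume) a b)
    have h2 : ∫ s in a..b, f s = ∫ s in a..b, D.subtypeL (g s) := by
      apply intervalIntegral.integral_congr
      intro s hs
      rw [uIcc_of_le hab] at hs
      simp [g, projIcc_of_mem hab hs]
    rw [h2, h1]
    exact (∫ s in a..b, g s).2
  rcases le_total a b with hab | hab
  · rw [uIcc_of_le hab] at hS
    exact key a b hab hS
  · rw [uIcc_of_ge hab] at hS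
    rw [intervalIntegral.integral_symm]
    have := h.smul_mem (-1) (key b a hab hS)
    simpa using this

/-- The image of a closed subspace under a map that is bounded below on it. -/
theorem image [CompleteSpace E] (h : IsClosedSubspace S) (f : E →L[ℂ] F) {C : ℝ}
    (hC : ∀ u ∈ S, ‖u‖ ≤ C * ‖f u‖) : IsClosedSubspace (f '' S) := by
  obtain ⟨D, hD, rfl⟩ := h
  refine ⟨D.map f.toLinearMap, ?_, by simp⟩
  have : CompleteSpace D := hD.completeSpace_coe
  have h1 : AntilipschitzWith (Real.toNNReal C) (f.comp D.subtypeL) := by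
    apply AddMonoidHomClass.antilipschitz_of_bound
    intro x
    refine (hC x.1 x.2).trans ?_
    exact mul_le_mul_of_nonneg_right (Real.le_coe_toNNReal C) (norm_nonneg _)
  have h2 := h1.isClosed_range (f.comp D.subtypeL).uniformContinuous
  convert h2
  ext y
  simp

end IsClosedSubspace

/-! ### The spaces on the graph as closed subspaces -/

variable {n : ℕ} {l : Fin (n + 1) → ℝ} {α : Fin n → ℝ}

theorem left_lt_right (hl : ∀ j, 0 < l j) (j : Fin (n + 1)) : left l j < right l j := by
  unfold left right
  split_ifs with h
  · rw [← h]; linarith [hl j]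
  · exact hl j

theorem left_zero : left l 0 = -l 0 := by simp [left]
theorem right_zero : right l 0 = 0 := by simp [right]
theorem outer_zero : outer l 0 = -l 0 := by simp [outer]
theorem left_succ (j : Fin n) : left l j.succ = 0 := by simp [left, Fin.succ_ne_zero]
theorem right_succ (j : Fin n) : right l j.succ = l j.succ := by simp [right, Fin.succ_ne_zero]
theorem outer_succ (j : Fin n) : outer l j.succ = l j.succ := by simp [outer, Fin.succ_ne_zero]

theorem outer_mem (hl : ∀ j, 0 < l j) (j : Fin (n + 1)) :
    outer l j ∈ Icc (left l j) (right l j) := by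
  have := hl j
  unfold left right outer
  split_ifs with h
  · rw [← h]; constructor <;> linarith
  · constructor <;> linarith

theorem zero_mem_edge (hl : ∀ j, 0 < l j) (j : Fin (n + 1)) :
    (0 : ℝ) ∈ Icc (left l j) (right l j) := by
  have := hl j
  unfold left right
  split_ifs with h
  · rw [← h]; constructor <;> linarith
  · constructor <;> linarith

/-- The component `∂ₓ^k u_j` as a continuous linear map. -/
def compL (l : Fin (n + 1) → ℝ) (m : ℕ) (k : Fin (m + 1)) (j : Fin (n + 1)) :
    Jet l m →L[ℂ] L2I (left l j) (right l j) :=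
  (PiLp.proj 2 (fun j => L2I (left l j) (right l j)) j : L2G l →L[ℂ] _).comp
    (PiLp.proj 2 (fun _ : Fin (m + 1) => L2G l) k)

theorem isClosedSubspace_sobolev (m : ℕ) : IsClosedSubspace (sobolev l m) := by
  have h : sobolev l m = {u | ∀ p : Fin m × Fin (n + 1),
      u ∈ {u : Jet l m | IsWeakDeriv (u p.1.castSucc p.2) (u p.1.succ p.2)}} := by
    ext u; simp [sobolev, Prod.forall]
  rw [h]
  apply IsClosedSubspace.forall_mem
  rintro ⟨k, j⟩
  obtain ⟨ι, Λ, hΛ⟩ := IsWeakDeriv.exists_functionals (left l j) (right l j)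
  have h2 : {u : Jet l m | IsWeakDeriv (u k.castSucc j) (u k.succ j)} =
      {u | ∀ i, u ∈ {u | ((Λ i).comp ((compL l m k.castSucc j).prod (compL l m k.succ j))) u = 0}} := by
    ext u
    simp only [mem_ofPred_eq, hΛ]
    rfl
  rw [h2]
  exact IsClosedSubspace.forall_mem fun i => IsClosedSubspace.ker _

theorem exists_bd (hl : ∀ j, 0 < l j) {m : ℕ} (k : Fin m) (j : Fin (n + 1)) {c : ℝ}
    (hc : c ∈ Icc (left l j) (right l j)) :
    ∃ Λ : Jet l m →L[ℂ] ℂ, ∀ u ∈ sobolev l m, bd u k.castSucc j c = Λ u := by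
  obtain ⟨Λ, hΛ⟩ := IsWeakDeriv.exists_trace (left_lt_right hl j) hc
  exact ⟨Λ.comp ((compL l m k.castSucc j).prod (compL l m k.succ j)), fun u hu => hΛ _ _ (hu k j)⟩

/-- Cutting a closed subspace by a condition that is linear on it. -/
theorem IsClosedSubspace.sep {E : Type*} [NormedAddCommGroup E] [NormedSpace ℂ E] {S : Set E}
    (h : IsClosedSubspace S) {ι : Sort*} {P : ι → E → Prop}
    (hP : ∀ i, ∃ Λ : E →L[ℂ] ℂ, ∀ u ∈ S, P i u ↔ Λ u = 0) :
    IsClosedSubspace {u | u ∈ S ∧ ∀ i, P i u} := by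
  choose Λ hΛ using hP
  have h2 : {u | u ∈ S ∧ ∀ i, P i u} = S ∩ {u | ∀ i, u ∈ {u | Λ i u = 0}} := by
    ext u
    simp only [mem_ofPred_eq, mem_inter_iff]
    exact and_congr_right fun hu => forall_congr' fun i => hΛ i u hu
  rw [h2]
  exact h.inter (IsClosedSubspace.forall_mem fun i => IsClosedSubspace.ker _)

/-- The closure of the domain of the operator in `H²` : `H²₀` together with the transmission
condition for the first derivative. -/
def energySpace (l : Fin (n + 1) → ℝ) (α : Fin n → ℝ) : Set (Jet l 2) :=
  {u | u ∈ H20 l α ∧ bd u 1 0 0 = ∑ j : Fin n, bd u 1 j.succ 0 / α j}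

/-- The functions in the domain of the operator whose second derivative vanishes at the outer
endpoints of the edges other than edge `0`. -/
def domObs (l : Fin (n + 1) → ℝ) (α : Fin n → ℝ) : Set (Jet l 4) :=
  {u | u ∈ domA l α ∧ ∀ j : Fin n, bd u 2 j.succ (outer l j.succ) = 0}

theorem isClosedSubspace_H20 (hl : ∀ j, 0 < l j) : IsClosedSubspace (H20 l α) := by
  have hS := isClosedSubspace_sobolev (l := l) 2
  have o := outer_mem hl
  have z := zero_mem_edge hl
  choose Λo hΛo using fun (k : Fin 2) j => exists_bd (m := 2) hl k j (o j)
  choose Λz hΛz using fun (k : Fin 2) j => exists_bd (m := 2) hl k j (z j)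
  have h1 := hS.sep (P := fun j (u : Jet l 2) => bd u 0 j (outer l j) = 0)
    fun j => ⟨Λo 0 j, fun u hu => by rw [← hΛo 0 j u hu]; rfl⟩
  have h2 := hS.sep (P := fun j (u : Jet l 2) => bd u 1 j (outer l j) = 0)
    fun j => ⟨Λo 1 j, fun u hu => by rw [← hΛo 1 j u hu]; rfl⟩
  have h3 := hS.sep (P := fun (j : Fin n) (u : Jet l 2) => bd u 0 0 0 = α j * bd u 0 j.succ 0)
    fun j => ⟨Λz 0 0 - (α j : ℂ) • Λz 0 j.succ, fun u hu => by
      rw [_root_.sub_apply, _root_.smul_apply, smul_eq_mul, ← hΛz 0 0 u hu,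
        ← hΛz 0 j.succ u hu, sub_eq_zero]; rfl⟩
  convert (h1.inter h2).inter h3 using 1
  ext u
  simp only [H20, mem_ofPred_eq, mem_inter_iff, forall_and]
  tauto

theorem isClosedSubspace_energySpace (hl : ∀ j, 0 < l j) :
    IsClosedSubspace (energySpace l α) := by
  have z := zero_mem_edge hl
  choose Λz hΛz using fun (k : Fin 2) j => exists_bd (m := 2) hl k j (z j)
  have h := (isClosedSubspace_H20 (α := α) hl).sep (ι := Unit)
    (P := fun _ (u : Jet l 2) => bd u 1 0 0 = ∑ j : Fin n, bd u 1 j.succ 0 / α j)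
    fun _ => ⟨Λz 1 0 - ∑ j : Fin n, ((α j : ℂ)⁻¹) • Λz 1 j.succ, fun u hu => by
      have e : ∀ j, bd u 1 j 0 = Λz 1 j u := fun j => hΛz 1 j u hu.1
      rw [_root_.sub_apply, _root_.sum_apply, sub_eq_zero, e]
      simp only [e, _root_.smul_apply, smul_eq_mul, div_eq_inv_mul]⟩
  convert h using 1
  ext u
  simp [energySpace]

theorem isClosedSubspace_domA (hl : ∀ j, 0 < l j) : IsClosedSubspace (domA l α) := by
  have hS := isClosedSubspace_sobolev (l := l) 4
  have o := outer_mem hl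
  have z := zero_mem_edge hl
  choose Λo hΛo using fun (k : Fin 4) j => exists_bd (m := 4) hl k j (o j)
  choose Λz hΛz using fun (k : Fin 4) j => exists_bd (m := 4) hl k j (z j)
  have h1 := hS.sep (P := fun j (u : Jet l 4) => bd u 0 j (outer l j) = 0)
    fun j => ⟨Λo 0 j, fun u hu => by rw [← hΛo 0 j u hu]; rfl⟩
  have h2 := hS.sep (P := fun j (u : Jet l 4) => bd u 1 j (outer l j) = 0)
    fun j => ⟨Λo 1 j, fun u hu => by rw [← hΛo 1 j u hu]; rfl⟩
  have h3 := hS.sep (P := fun (j : Fin n) (u : Jet l 4) => bd u 0 0 0 = α j * bd u 0 j.succ 0)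
    fun j => ⟨Λz 0 0 - (α j : ℂ) • Λz 0 j.succ, fun u hu => by
      rw [_root_.sub_apply, _root_.smul_apply, smul_eq_mul, ← hΛz 0 0 u hu,
        ← hΛz 0 j.succ u hu, sub_eq_zero]; rfl⟩
  have h4 := hS.sep (ι := Unit)
    (P := fun _ (u : Jet l 4) => bd u 1 0 0 = ∑ j : Fin n, bd u 1 j.succ 0 / α j)
    fun _ => ⟨Λz 1 0 - ∑ j : Fin n, ((α j : ℂ)⁻¹) • Λz 1 j.succ, fun u hu => by
      have e : ∀ j, bd u 1 j 0 = Λz 1 j u := fun j => hΛz 1 j u hu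
      rw [_root_.sub_apply, _root_.sum_apply, sub_eq_zero, e]
      simp only [e, _root_.smul_apply, smul_eq_mul, div_eq_inv_mul]⟩
  have h5 := hS.sep (P := fun (j : Fin n) (u : Jet l 4) => bd u 2 0 0 = α j * bd u 2 j.succ 0)
    fun j => ⟨Λz 2 0 - (α j : ℂ) • Λz 2 j.succ, fun u hu => by
      rw [_root_.sub_apply, _root_.smul_apply, smul_eq_mul, ← hΛz 2 0 u hu,
        ← hΛz 2 j.succ u hu, sub_eq_zero]; rfl⟩
  have h6 := hS.sep (ι := Unit)
    (P := fun _ (u : Jet l 4) => bd u 3 0 0 = ∑ j : Fin n, bd u 3 j.succ 0 / α j)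
    fun _ => ⟨Λz 3 0 - ∑ j : Fin n, ((α j : ℂ)⁻¹) • Λz 3 j.succ, fun u hu => by
      have e : ∀ j, bd u 3 j 0 = Λz 3 j u := fun j => hΛz 3 j u hu
      rw [_root_.sub_apply, _root_.sum_apply, sub_eq_zero, e]
      simp only [e, _root_.smul_apply, smul_eq_mul, div_eq_inv_mul]⟩
  convert ((((h1.inter h2).inter h3).inter h4).inter h5).inter h6 using 1
  ext u
  simp only [domA, mem_ofPred_eq, mem_inter_iff, forall_and, forall_const]
  tauto

theorem isClosedSubspace_domObs (hl : ∀ j, 0 < l j) : IsClosedSubspace (domObs l α) := by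
  have o := outer_mem hl
  choose Λo hΛo using fun (k : Fin 4) j => exists_bd (m := 4) hl k j (o j)
  exact (isClosedSubspace_domA (α := α) hl).sep
    (P := fun (j : Fin n) (u : Jet l 4) => bd u 2 j.succ (outer l j.succ) = 0)
    fun j => ⟨Λo 2 j.succ, fun u hu => by rw [← hΛo 2 j.succ u hu.1]; rfl⟩

/-! ### The graph of the operator -/

/-- The first three components of a jet of order four. -/
def truncL (l : Fin (n + 1) → ℝ) : Jet l 4 →L[ℂ] Jet l 2 :=
  (PiLp.continuousLinearEquiv 2 ℂ (fun _ : Fin 3 => L2G l)).symm.toContinuousLinearMap.comp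
    (ContinuousLinearMap.pi fun k : Fin 3 =>
      PiLp.proj 2 (fun _ : Fin 5 => L2G l) (Fin.castLE (by norm_num) k))

theorem truncL_zero (u : Jet l 4) : truncL l u 0 = u 0 := rfl
theorem truncL_one (u : Jet l 4) : truncL l u 1 = u 1 := rfl
theorem truncL_two (u : Jet l 4) : truncL l u 2 = u 2 := rfl

/-- The operator `A` as a continuous linear map on jets. -/
def opAL (l : Fin (n + 1) → ℝ) : Jet l 4 →L[ℂ] L2G l :=
  Complex.I • (PiLp.proj 2 (fun _ : Fin 5 => L2G l) 2 : Jet l 4 →L[ℂ] L2G l)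
    - Complex.I • (PiLp.proj 2 (fun _ : Fin 5 => L2G l) 4 : Jet l 4 →L[ℂ] L2G l)

theorem four_eq_of_opA {u : Jet l 4} : u 4 = u 2 + Complex.I • opA u := by
  rw [opA, ← smul_sub, smul_smul, Complex.I_mul_I]
  simp

theorem PiLp_norm_le_sum {ι : Type*} [Fintype ι] {β : ι → Type*}
    [∀ i, NormedAddCommGroup (β i)] (x : PiLp 2 β) : ‖x‖ ≤ ∑ i, ‖x i‖ := by
  refine le_of_sq_le_sq ?_ (Finset.sum_nonneg fun i _ => norm_nonneg _)
  rw [PiLp.norm_sq_eq_of_L2]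
  exact Finset.sum_sq_le_sq_sum_of_nonneg fun i _ => norm_nonneg _

/-- The graph norm contains derivatives `0`, `1` and `2`. The fourth is recovered from `A u` and the
second, and the third by interpolation between these two. This makes the restriction of `A` to any
closed subspace of `H⁴` a closed operator. -/
theorem exists_norm_le_graph (hl : ∀ j, 0 < l j) :
    ∃ C : ℝ, 0 ≤ C ∧ ∀ u ∈ sobolev l 4, ‖u‖ ≤ C * ‖(truncL l u, opAL l u)‖ := by
  choose K hK0 hK using fun j => IsWeakDeriv.exists_norm_le (left_lt_right hl j)
  refine ⟨5 + ∑ j, K j * 3, ?_, fun u hu => ?_⟩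
  · have : 0 ≤ ∑ j, K j * 3 := Finset.sum_nonneg fun j _ => mul_nonneg (hK0 j) (by norm_num)
    linarith
  set N := ‖(truncL l u, opAL l u)‖ with hN
  have hN1 : ‖truncL l u‖ ≤ N := le_max_left _ _
  have hN2 : ‖opA u‖ ≤ N := le_max_right _ _
  have h0 : ‖u 0‖ ≤ N := (PiLp.norm_apply_le (truncL l u) 0).trans hN1
  have h1 : ‖u 1‖ ≤ N := (PiLp.norm_apply_le (truncL l u) 1).trans hN1
  have h2 : ‖u 2‖ ≤ N := (PiLp.norm_apply_le (truncL l u) 2).trans hN1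
  have h4 : ‖u 4‖ ≤ 2 * N := by
    rw [four_eq_of_opA]
    refine (norm_add_le _ _).trans ?_
    rw [norm_smul, Complex.norm_I, one_mul]
    linarith
  have h3 : ‖u 3‖ ≤ ∑ j, K j * (3 * N) := by
    refine (PiLp_norm_le_sum _).trans (Finset.sum_le_sum fun j _ => ?_)
    refine (hK j (u 2 j) (u 3 j) (u 4 j) (hu 2 j) (hu 3 j)).trans ?_
    refine mul_le_mul_of_nonneg_left ?_ (hK0 j)
    linarith [PiLp.norm_apply_le (u 2) j, PiLp.norm_apply_le (u 4) j]
  refine (PiLp_norm_le_sum u).trans ?_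
  rw [Fin.sum_univ_five, add_mul, Finset.sum_mul]
  simp only [mul_assoc]
  linarith

/-- The graph of the restriction of the operator to `S`. -/
def graphOn (S : Set (Jet l 4)) : Set (Jet l 2 × L2G l) := (truncL l).prod (opAL l) '' S

theorem isClosedSubspace_graphOn (hl : ∀ j, 0 < l j) {S : Set (Jet l 4)}
    (h : IsClosedSubspace S) (hS : S ⊆ sobolev l 4) : IsClosedSubspace (graphOn S) := by
  obtain ⟨C, -, hC⟩ := exists_norm_le_graph hl
  exact h.image _ fun u hu => hC u (hS hu)

/-- Weak derivatives are unique, so the whole jet is determined by its lowest component. -/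
theorem sobolev_ext (hl : ∀ j, 0 < l j) {m : ℕ} {u v : Jet l m} (hu : u ∈ sobolev l m)
    (hv : v ∈ sobolev l m) (h : u 0 = v 0) : u = v := by
  ext1 k
  induction k using Fin.induction with
  | zero => exact h
  | succ k ih =>
    ext1 j
    have h1 := hu k j
    rw [ih] at h1
    exact h1.unique (left_lt_right hl j) (hv k j)

theorem truncL_mem_sobolev {u : Jet l 4} (hu : u ∈ sobolev l 4) : truncL l u ∈ sobolev l 2 := by
  intro k j
  have := hu (Fin.castLE (by norm_num) k) j
  exact this

theorem truncL_mem_energySpace {u : Jet l 4} (hu : u ∈ domA l α) :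
    truncL l u ∈ energySpace l α :=
  ⟨⟨truncL_mem_sobolev hu.1, hu.2.1, hu.2.2.1⟩, hu.2.2.2.1⟩

/-! ### Integration by parts -/

theorem integral_parts_real {a b c d : ℝ} {f' g' : ℝ → ℝ}
    (hf : IntervalIntegrable f' volume a b) (hg : IntervalIntegrable g' volume a b) :
    ∫ x in a..b, (f' x * (d + ∫ y in a..x, g' y) + (c + ∫ y in a..x, f' y) * g' x)
      = (c + ∫ y in a..b, f' y) * (d + ∫ y in a..b, g' y) - c * d := by
  have hF := hf.absolutelyContinuousOnInterval_intervalIntegral (c := a) (by simp)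
  have hG := hg.absolutelyContinuousOnInterval_intervalIntegral (c := a) (by simp)
  have hc : ∀ r : ℝ, AbsolutelyContinuousOnInterval (fun _ => r) a b := fun r =>
    (contDiff_const (n := 1)).contDiffOn.absolutelyContinuousOnInterval
  have h := ((hc c).add hF).integral_deriv_mul_eq_sub ((hc d).add hG)
  simp only [Pi.add_apply, intervalIntegral.integral_same, add_zero] at h
  rw [← h]
  apply intervalIntegral.integral_congr_ae
  filter_upwards [hf.ae_hasDerivAt_integral, hg.ae_hasDerivAt_integral] with x h1 h2 hx
  have e1 := ((h1 (uIoc_subset_uIcc hx) a (by simp)).const_add c).deriv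
  have e2 := ((h2 (uIoc_subset_uIcc hx) a (by simp)).const_add d).deriv
  have e1' : deriv ((fun _ => c) + fun x => ∫ v in a..x, f' v) x = f' x := e1
  have e2' : deriv ((fun _ => d) + fun x => ∫ v in a..x, g' v) x = g' x := e2
  rw [e1', e2']

/-- The representatives are only absolutely continuous, so the product rule is used almost
everywhere, separately for real and imaginary parts. -/
theorem IsWeakDeriv.inner_parts {a b : ℝ} (hab : a < b) {f f' g g' : L2I a b}
    (H : IsWeakDeriv f f') (H' : IsWeakDeriv g g') :
    (inner ℂ f' g).re + (inner ℂ f g').re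
      = inner ℝ (trace f b) (trace g b) - inner ℝ (trace f a) (trace g a) := by
  have ha : a ∈ Icc a b := left_mem_Icc.2 hab.le
  have hb : b ∈ Icc a b := right_mem_Icc.2 hab.le
  have hf := L2I.intervalIntegrable f' ha hb
  have hg := L2I.intervalIntegrable g' ha hb
  have key : ∀ L : ℂ →L[ℝ] ℝ, (∫ x in a..b, (L (f' x) * L (trace g x) + L (trace f x) * L (g' x)))
      = L (trace f b) * L (trace g b) - L (trace f a) * L (trace g a) := by
    intro L
    have tr : ∀ {h h' : L2I a b}, IsWeakDeriv h h' → ∀ x ∈ Icc a b,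
        L (trace h x) = L (trace h a) + ∫ y in a..x, L (h' y) := by
      intro h h' Hh x hx
      rw [L.intervalIntegral_comp_comm (L2I.intervalIntegrable h' ha hx), ← Hh.trace_sub hab ha hx,
        map_sub]
      ring
    have hfL : IntervalIntegrable (fun x => L (f' x)) volume a b :=
      ⟨L.integrable_comp hf.1, L.integrable_comp hf.2⟩
    have hgL : IntervalIntegrable (fun x => L (g' x)) volume a b :=
      ⟨L.integrable_comp hg.1, L.integrable_comp hg.2⟩
    have h := integral_parts_real (c := L (trace f a)) (d := L (trace g a)) hfL hgL
    rw [← tr H b hb, ← tr H' b hb] at h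
    rw [← h]
    apply intervalIntegral.integral_congr
    intro x hx
    rw [uIcc_of_le hab.le] at hx
    simp only
    rw [tr H x hx, tr H' x hx]
  have int : ∀ L : ℂ →L[ℝ] ℝ, IntervalIntegrable
      (fun x => L (f' x) * L (trace g x) + L (trace f x) * L (g' x)) volume a b := by
    intro L
    have hfL : IntervalIntegrable (fun x => L (f' x)) volume a b :=
      ⟨L.integrable_comp hf.1, L.integrable_comp hf.2⟩
    have hgL : IntervalIntegrable (fun x => L (g' x)) volume a b :=
      ⟨L.integrable_comp hg.1, L.integrable_comp hg.2⟩
    have c1 : ContinuousOn (fun x => L (trace g x)) (uIcc a b) := by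
      rw [uIcc_of_le hab.le]
      exact L.continuous.comp_continuousOn (H'.continuousOn_trace hab)
    have c2 : ContinuousOn (fun x => L (trace f x)) (uIcc a b) := by
      rw [uIcc_of_le hab.le]
      exact L.continuous.comp_continuousOn (H.continuousOn_trace hab)
    exact (hfL.mul_continuousOn c1).add (hgL.continuousOn_mul c2)
  have hi : ∀ {h k : L2I a b}, Integrable (fun x => inner ℂ (h x) (k x))
      (volume.restrict (Ioo a b)) := fun {h k} => L2.integrable_inner h k
  have e : (inner ℂ f' g).re + (inner ℂ f g').re
      = ∫ x in a..b, ((Complex.reCLM (f' x) * Complex.reCLM (trace g x)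
        + Complex.reCLM (trace f x) * Complex.reCLM (g' x))
        + (Complex.imCLM (f' x) * Complex.imCLM (trace g x)
        + Complex.imCLM (trace f x) * Complex.imCLM (g' x))) := by
    rw [L2.inner_def, L2.inner_def, ← Complex.add_re, ← integral_add hi hi, ← Complex.reCLM_apply,
      ← ContinuousLinearMap.integral_comp_comm _ (hi.fun_add hi),
      intervalIntegral.integral_of_le hab.le, integral_Ioc_eq_integral_Ioo]
    apply integral_congr_ae
    filter_upwards [H.ae_eq_trace hab, H'.ae_eq_trace hab] with x h1 h2
    rw [h1, h2]
    simp
    ring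
  rw [e, intervalIntegral.integral_add (int _) (int _), key, key]
  simp only [Complex.reCLM_apply, Complex.imCLM_apply, inner_eq]
  ring

/-! ### The multiplier identity for weakly differentiable functions -/

/-- A function `u` in `H⁴(a, b)` together with `w = i u'' - i u''''` in `H²(a, b)`. -/
structure SmoothPair {a b : ℝ} (u : Fin 5 → L2I a b) (w : Fin 3 → L2I a b) : Prop where
  du : ∀ k : Fin 4, IsWeakDeriv (u k.castSucc) (u k.succ)
  dw : ∀ k : Fin 2, IsWeakDeriv (w k.castSucc) (w k.succ)
  eq : w 0 = Complex.I • (u 2 - u 4)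

/-- The boundary expression of the multiplier identity at the point `c`. -/
def bdryAt {a b : ℝ} (q₀ q₁ q₂ : ℝ) (u : Fin 5 → L2I a b) (w : Fin 3 → L2I a b) (c : ℝ) : ℝ :=
  bdryForm q₀ q₁ q₂ (trace (u 0) c) (trace (u 1) c) (trace (u 2) c) (trace (u 3) c)
    (trace (w 0) c)

namespace SmoothPair

variable {a b : ℝ} {u u' : Fin 5 → L2I a b} {w w' : Fin 3 → L2I a b}

theorem sub (P : SmoothPair u w) (P' : SmoothPair u' w') : SmoothPair (u - u') (w - w') where
  du k := (P.du k).sub (P'.du k)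
  dw k := (P.dw k).sub (P'.dw k)
  eq := by
    simp only [Pi.sub_apply, P.eq, P'.eq, ← smul_sub]
    congr 1
    abel

theorem map_restrict {c d : ℝ} (hac : a ≤ c) (hdb : d ≤ b) {R : L2I a b →L[ℂ] L2I c d}
    (hR : ∀ f : L2I a b, R f =ᵐ[volume.restrict (Ioo c d)] f) (P : SmoothPair u w) :
    SmoothPair (fun k => R (u k)) (fun k => R (w k)) where
  du k := (P.du k).restrict hac hdb (hR _) (hR _)
  dw k := (P.dw k).restrict hac hdb (hR _) (hR _)
  eq := by simp only [P.eq, map_smul, map_sub]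

theorem du₀ (P : SmoothPair u w) : IsWeakDeriv (u 0) (u 1) := P.du 0
theorem du₁ (P : SmoothPair u w) : IsWeakDeriv (u 1) (u 2) := P.du 1
theorem du₂ (P : SmoothPair u w) : IsWeakDeriv (u 2) (u 3) := P.du 2
theorem du₃ (P : SmoothPair u w) : IsWeakDeriv (u 3) (u 4) := P.du 3
theorem dw₀ (P : SmoothPair u w) : IsWeakDeriv (w 0) (w 1) := P.dw 0
theorem dw₁ (P : SmoothPair u w) : IsWeakDeriv (w 1) (w 2) := P.dw 1

theorem four_eq (P : SmoothPair u w) : u 4 = u 2 + Complex.I • w 0 := by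
  rw [P.eq, smul_smul, Complex.I_mul_I]
  simp

/-- The equation gives a fifth derivative: `u 4` is `u 2` plus a multiple of `w 0`, and both are
weakly differentiable. Hence `u 4` has a continuous representative and the classical multiplier
identity applies. -/
theorem dfour (P : SmoothPair u w) : IsWeakDeriv (u 4) (u 3 + Complex.I • w 1) := by
  rw [P.four_eq]
  exact P.du₂.add (P.dw₀.smul _)

/-- All functions involved are replaced by their continuous representatives, for which the equation,
known almost everywhere, holds at every interior point. -/
theorem multiplier (hab : a < b) (P : SmoothPair u w) {q₀ q₁ q₂ q₃ : ℝ → ℝ}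
    (hq₀ : ∀ x, HasDerivAt q₀ (q₁ x) x) (hq₁ : ∀ x, HasDerivAt q₁ (q₂ x) x)
    (hq₂ : ∀ x, HasDerivAt q₂ (q₃ x) x) (hq₃ : Continuous q₃)
    {Φ : L2I a b →L[ℝ] L2I a b →L[ℝ] ℝ} (hΦ : ∀ f g : L2I a b, ∀ F G : ℝ → ℂ,
      f =ᵐ[volume.restrict (Ioo a b)] F → g =ᵐ[volume.restrict (Ioo a b)] G →
      Φ f g = ∫ x in Ioo a b, q₀ x * inner ℝ (Complex.I * F x) (G x)) :
    Φ (w 0) (u 1) + Φ (u 0) (w 1)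
      = bdryAt (q₀ b) (q₁ b) (q₂ b) u w b - bdryAt (q₀ a) (q₁ a) (q₂ a) u w a
        + ∫ x in a..b, (q₁ x * (2 * ‖trace (u 1) x‖ ^ 2 + 4 * ‖trace (u 2) x‖ ^ 2)
            + q₂ x * (inner ℝ (trace (u 0) x) (trace (u 1) x)
              + 4 * inner ℝ (trace (u 1) x) (trace (u 2) x))
            + q₃ x * inner ℝ (trace (u 0) x) (trace (u 2) x)) := by
  have cq₀ : Continuous q₀ := continuous_iff_continuousAt.2 fun x => (hq₀ x).continuousAt
  have c0 := P.du₀.continuousOn_trace hab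
  have c1 := P.du₁.continuousOn_trace hab
  have c2 := P.du₂.continuousOn_trace hab
  have c3 := P.du₃.continuousOn_trace hab
  have d0 := P.dw₀.continuousOn_trace hab
  have d1 := P.dw₁.continuousOn_trace hab
  have c4 := P.dfour.continuousOn_trace hab
  have hae : ∀ᵐ x ∂(volume.restrict (Ioo a b)),
      trace (w 0) x = Complex.I * (trace (u 2) x - trace (u 4) x) := by
    have h := P.eq
    filter_upwards [P.dw₀.ae_eq_trace hab, P.du₂.ae_eq_trace hab, P.dfour.ae_eq_trace hab,
      Lp.coeFn_smul Complex.I (u 2 - u 4), Lp.coeFn_sub (u 2) (u 4)] with x h1 h2 h3 h4 h5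
    have h1' : (w 0 : ℝ → ℂ) x = trace (w 0) x := h1
    have h2' : (u 2 : ℝ → ℂ) x = trace (u 2) x := h2
    rw [← h1', ← h2', ← h3, h, h4, Pi.smul_apply, h5, Pi.sub_apply, smul_eq_mul]
  have heq : EqOn (trace (w 0)) (fun x => Complex.I * (trace (u 2) x - trace (u 4) x)) (Ioo a b) :=
    Measure.eqOn_open_of_ae_eq hae isOpen_Ioo (d0.mono Ioo_subset_Icc_self)
      ((continuousOn_const.mul (c2.sub c4)).mono Ioo_subset_Icc_self)
  have h := multiplier_identity hab.le hq₀ hq₁ hq₂ hq₃ c0 c1 c2 c3 d0 d1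
    (fun x hx => P.du₀.hasDerivAt_trace hab P.du₁ hx)
    (fun x hx => P.du₁.hasDerivAt_trace hab P.du₂ hx)
    (fun x hx => P.du₂.hasDerivAt_trace hab P.du₃ hx)
    (fun x hx => P.du₃.hasDerivAt_trace hab P.dfour hx)
    (fun x hx => P.dw₀.hasDerivAt_trace hab P.dw₁ hx) heq
  refine Eq.trans ?_ h
  rw [hΦ _ _ _ _ (P.dw₀.ae_eq_trace hab) (P.du₁.ae_eq_trace hab),
    hΦ _ _ _ _ (P.du₀.ae_eq_trace hab) (P.dw₁.ae_eq_trace hab),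
    ← integral_Ioc_eq_integral_Ioo, ← integral_Ioc_eq_integral_Ioo,
    ← intervalIntegral.integral_of_le hab.le, ← intervalIntegral.integral_of_le hab.le,
    ← intervalIntegral.integral_add]
  · simp only [mul_add]
  · apply ContinuousOn.intervalIntegrable
    rw [uIcc_of_le hab.le]
    exact cq₀.continuousOn.mul ((continuousOn_const.mul d0).inner c1)
  · apply ContinuousOn.intervalIntegrable
    rw [uIcc_of_le hab.le]
    exact cq₀.continuousOn.mul ((continuousOn_const.mul c0).inner d1)

/-- The multiplier identity with an affine weight. -/
theorem multiplier_affine (hab : a < b) (P : SmoothPair u w) {c : ℝ}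
    {Φ : L2I a b →L[ℝ] L2I a b →L[ℝ] ℝ} (hΦ : ∀ f g : L2I a b, ∀ F G : ℝ → ℂ,
      f =ᵐ[volume.restrict (Ioo a b)] F → g =ᵐ[volume.restrict (Ioo a b)] G →
      Φ f g = ∫ x in Ioo a b, (x + c) * inner ℝ (Complex.I * F x) (G x)) :
    Φ (w 0) (u 1) + Φ (u 0) (w 1)
      = bdryAt (b + c) 1 0 u w b - bdryAt (a + c) 1 0 u w a
        + (2 * ‖u 1‖ ^ 2 + 4 * ‖u 2‖ ^ 2) := by
  rw [P.multiplier hab (q₀ := fun x => x + c) (q₁ := fun _ => 1) (q₂ := fun _ => 0)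
    (q₃ := fun _ => 0) (fun x => (hasDerivAt_id x).add_const c) (fun x => hasDerivAt_const x 1)
    (fun x => hasDerivAt_const x 0) continuous_const hΦ,
    L2I.norm_sq_eq hab.le (u 1) (P.du₁.ae_eq_trace hab),
    L2I.norm_sq_eq hab.le (u 2) (P.du₂.ae_eq_trace hab)]
  congr 1
  rw [← intervalIntegral.integral_const_mul, ← intervalIntegral.integral_const_mul,
    ← intervalIntegral.integral_add]
  · apply intervalIntegral.integral_congr
    intro x _
    simp
  · apply ContinuousOn.intervalIntegrable
    rw [uIcc_of_le hab.le]
    exact continuousOn_const.mul ((P.du₁.continuousOn_trace hab).norm.pow 2)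
  · apply ContinuousOn.intervalIntegrable
    rw [uIcc_of_le hab.le]
    exact continuousOn_const.mul ((P.du₂.continuousOn_trace hab).norm.pow 2)

/-- An upper bound in the multiplier identity. -/
theorem multiplier_le (hab : a < b) (P : SmoothPair u w) {q₀ q₁ q₂ q₃ : ℝ → ℝ}
    (hq₀ : ∀ x, HasDerivAt q₀ (q₁ x) x) (hq₁ : ∀ x, HasDerivAt q₁ (q₂ x) x)
    (hq₂ : ∀ x, HasDerivAt q₂ (q₃ x) x) (hq₃ : Continuous q₃)
    {Φ : L2I a b →L[ℝ] L2I a b →L[ℝ] ℝ} (hΦ : ∀ f g : L2I a b, ∀ F G : ℝ → ℂ,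
      f =ᵐ[volume.restrict (Ioo a b)] F → g =ᵐ[volume.restrict (Ioo a b)] G →
      Φ f g = ∫ x in Ioo a b, q₀ x * inner ℝ (Complex.I * F x) (G x))
    {M N δ : ℝ} (hδ : 0 < δ) (h1 : ∀ x ∈ Icc a b, q₁ x ≤ N) (hN : 0 ≤ N)
    (h2 : ∀ x ∈ Icc a b, |q₂ x| ≤ M) (h3 : ∀ x ∈ Icc a b, |q₃ x| ≤ M) :
    Φ (w 0) (u 1) + Φ (u 0) (w 1)
      ≤ bdryAt (q₀ b) (q₁ b) (q₂ b) u w b - bdryAt (q₀ a) (q₁ a) (q₂ a) u w a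
        + ((4 * N + δ) * ‖u 2‖ ^ 2
          + (4 * N + M + 8 * M ^ 2 / δ) * (‖u 0‖ ^ 2 + ‖u 1‖ ^ 2)) := by
  have c0 := P.du₀.continuousOn_trace hab
  have c1 := P.du₁.continuousOn_trace hab
  have c2 := P.du₂.continuousOn_trace hab
  have cq₁ : Continuous q₁ := continuous_iff_continuousAt.2 fun x => (hq₁ x).continuousAt
  have cq₂ : Continuous q₂ := continuous_iff_continuousAt.2 fun x => (hq₂ x).continuousAt
  have hM : 0 ≤ M := (abs_nonneg _).trans (h2 a (left_mem_Icc.2 hab.le))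
  rw [P.multiplier hab hq₀ hq₁ hq₂ hq₃ hΦ]
  gcongr
  rw [L2I.norm_sq_eq hab.le (u 0) (P.du₀.ae_eq_trace hab),
    L2I.norm_sq_eq hab.le (u 1) (P.du₁.ae_eq_trace hab),
    L2I.norm_sq_eq hab.le (u 2) (P.du₂.ae_eq_trace hab)]
  have i0 : IntervalIntegrable (fun x => ‖trace (u 0) x‖ ^ 2) volume a b := by
    apply ContinuousOn.intervalIntegrable; rw [uIcc_of_le hab.le]; exact c0.norm.pow 2
  have i1 : IntervalIntegrable (fun x => ‖trace (u 1) x‖ ^ 2) volume a b := by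
    apply ContinuousOn.intervalIntegrable; rw [uIcc_of_le hab.le]; exact c1.norm.pow 2
  have i2 : IntervalIntegrable (fun x => ‖trace (u 2) x‖ ^ 2) volume a b := by
    apply ContinuousOn.intervalIntegrable; rw [uIcc_of_le hab.le]; exact c2.norm.pow 2
  have i01 := (i0.add i1).const_mul (4 * N + M + 8 * M ^ 2 / δ)
  have hR := intervalIntegral.integral_add (i2.const_mul (4 * N + δ)) i01
  simp only [intervalIntegral.integral_const_mul] at hR
  have hR' : (∫ x in a..b, (4 * N + δ) * ‖trace (u 2) x‖ ^ 2
      + (4 * N + M + 8 * M ^ 2 / δ) * (‖trace (u 0) x‖ ^ 2 + ‖trace (u 1) x‖ ^ 2))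
      = (4 * N + δ) * (∫ x in a..b, ‖trace (u 2) x‖ ^ 2) + (4 * N + M + 8 * M ^ 2 / δ) *
        ((∫ x in a..b, ‖trace (u 0) x‖ ^ 2) + ∫ x in a..b, ‖trace (u 1) x‖ ^ 2) := by
    rw [← intervalIntegral.integral_add i0 i1, ← hR]
  refine le_trans ?_ hR'.le
  apply intervalIntegral.integral_mono_on hab.le
  · apply ContinuousOn.intervalIntegrable
    rw [uIcc_of_le hab.le]
    exact ((cq₁.continuousOn.mul ((continuousOn_const.mul (c1.norm.pow 2)).add
      (continuousOn_const.mul (c2.norm.pow 2)))).add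
      (cq₂.continuousOn.mul ((c0.inner c1).add (continuousOn_const.mul (c1.inner c2))))).add
      (hq₃.continuousOn.mul (c0.inner c2))
  · exact (i2.const_mul _).add i01
  · intro x hx
    set A := ‖trace (u 0) x‖
    set B := ‖trace (u 1) x‖
    set C := ‖trace (u 2) x‖
    have hA : 0 ≤ A := norm_nonneg _
    have hB : 0 ≤ B := norm_nonneg _
    have hC : 0 ≤ C := norm_nonneg _
    have b01 : |inner ℝ (trace (u 0) x) (trace (u 1) x)| ≤ A * B := abs_real_inner_le_norm _ _
    have b12 : |inner ℝ (trace (u 1) x) (trace (u 2) x)| ≤ B * C := abs_real_inner_le_norm _ _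
    have b02 : |inner ℝ (trace (u 0) x) (trace (u 2) x)| ≤ A * C := abs_real_inner_le_norm _ _
    have t1 : q₁ x * (2 * B ^ 2 + 4 * C ^ 2) ≤ N * (2 * B ^ 2 + 4 * C ^ 2) :=
      mul_le_mul_of_nonneg_right (h1 x hx) (by positivity)
    have t2 : q₂ x * (inner ℝ (trace (u 0) x) (trace (u 1) x)
        + 4 * inner ℝ (trace (u 1) x) (trace (u 2) x)) ≤ M * (A * B + 4 * (B * C)) := by
      refine (le_abs_self _).trans ?_
      rw [abs_mul]
      refine mul_le_mul (h2 x hx) ?_ (abs_nonneg _) hM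
      refine (abs_add_le _ _).trans ?_
      rw [abs_mul, abs_of_pos (by norm_num : (0 : ℝ) < 4)]
      linarith
    have t3 : q₃ x * inner ℝ (trace (u 0) x) (trace (u 2) x) ≤ M * (A * C) := by
      refine (le_abs_self _).trans ?_
      rw [abs_mul]
      exact mul_le_mul (h3 x hx) b02 (abs_nonneg _) hM
    -- Young's inequality: every product containing the second derivative is absorbed into `δ * C ^
    -- 2`, at the price of a large constant on the lower derivatives.
    have t4 : M * (4 * B + A) * C ≤ δ * C ^ 2 + 8 * M ^ 2 / δ * (A ^ 2 + B ^ 2) := by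
      have s1 : M * (4 * B + A) * C ≤ δ * C ^ 2 + (M * (4 * B + A)) ^ 2 / (4 * δ) := by
        rw [← sub_nonneg]
        have : δ * C ^ 2 + (M * (4 * B + A)) ^ 2 / (4 * δ) - M * (4 * B + A) * C
            = (2 * δ * C - M * (4 * B + A)) ^ 2 / (4 * δ) := by field_simp; ring
        rw [this]; positivity
      have s2 : (M * (4 * B + A)) ^ 2 / (4 * δ) ≤ 8 * M ^ 2 / δ * (A ^ 2 + B ^ 2) := by
        rw [← sub_nonneg]
        have : 8 * M ^ 2 / δ * (A ^ 2 + B ^ 2) - (M * (4 * B + A)) ^ 2 / (4 * δ)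
            = M ^ 2 * (32 * (A ^ 2 + B ^ 2) - (4 * B + A) ^ 2) / (4 * δ) := by field_simp; ring
        rw [this]
        apply div_nonneg _ (by positivity)
        apply mul_nonneg (sq_nonneg _)
        nlinarith [sq_nonneg (4 * B - A), sq_nonneg A, sq_nonneg B]
      linarith
    have t5 : M * (A * B) ≤ M * (A ^ 2 + B ^ 2) := by
      apply mul_le_mul_of_nonneg_left _ hM
      nlinarith [sq_nonneg (A - B), sq_nonneg A, sq_nonneg B]
    have t6 : 0 ≤ N * A ^ 2 := by positivity
    have t7 : 0 ≤ N * B ^ 2 := by positivity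
    linarith

end SmoothPair

/-! ### Conservation laws -/

theorem IsWeakDeriv.trace_smul {a b : ℝ} (hab : a < b) {f g : L2I a b} (H : IsWeakDeriv f g)
    (r : ℂ) {c : ℝ} (hc : c ∈ Icc a b) : trace (r • f) c = r * trace f c := by
  apply trace_eq hab hc (r • f) (fun x => r * trace f x)
  · exact continuousOn_const.mul (H.continuousOn_trace hab)
  · filter_upwards [H.ae_eq_trace hab, Lp.coeFn_smul r f] with x h1 h2
    rw [h2, Pi.smul_apply, h1, smul_eq_mul]

theorem re_inner_I_smul_self {E : Type*} [NormedAddCommGroup E] [InnerProductSpace ℂ E] (x : E) :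
    (inner ℂ (Complex.I • x) x).re = 0 := by
  rw [inner_smul_left, inner_self_eq_norm_sq_to_K]
  simp [← Complex.ofReal_pow]

theorem smoothPair_of_opA {U : Jet l 4} {W : Jet l 2} (hU : U ∈ sobolev l 4)
    (hW : W ∈ sobolev l 2) (h : W 0 = opA U) (j : Fin (n + 1)) :
    SmoothPair (fun k => U k j) (fun k => W k j) where
  du k := hU k j
  dw k := hW k j
  eq := by
    rw [h, opA, ← smul_sub]
    rfl

theorem L2G.inner_eq_sum (x y : L2G l) : (inner ℂ x y).re = ∑ j, (inner ℂ (x j) (y j)).re := by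
  rw [PiLp.inner_apply, Complex.re_sum]

theorem Jet.inner_eq_sum {m : ℕ} (x y : Jet l m) :
    (inner ℂ x y).re = ∑ k, (inner ℂ (x k) (y k)).re := by
  rw [PiLp.inner_apply, Complex.re_sum]

theorem L2G.norm_sq_eq_sum (x : L2G l) : ‖x‖ ^ 2 = ∑ j, ‖x j‖ ^ 2 := PiLp.norm_sq_eq_of_L2 _ _

theorem Jet.norm_sq_eq_sum {m : ℕ} (x : Jet l m) : ‖x‖ ^ 2 = ∑ k, ‖x k‖ ^ 2 :=
  PiLp.norm_sq_eq_of_L2 _ _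

/-- The vertex is the right end of edge `0` and the left end of all other edges, which produces the
opposite signs. -/
theorem sum_edges_bdry {G : Fin (n + 1) → ℝ → ℝ} (hG : ∀ j, G j (outer l j) = 0) :
    ∑ j, (G j (right l j) - G j (left l j)) = G 0 0 - ∑ j : Fin n, G j.succ 0 := by
  rw [Fin.sum_univ_succ, right_zero, left_zero, ← outer_zero (l := l), hG 0, sub_zero,
    sub_eq_add_neg, ← Finset.sum_neg_distrib]
  congr 1
  apply Finset.sum_congr rfl
  intro j _
  rw [right_succ, left_succ, ← outer_succ (l := l) j, hG, zero_sub]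

/-- The transmission conditions are of two dual kinds: continuity with factors `α j`, and balance
with factors `1 / α j`. In a product of one of each kind the factors cancel. Orders `0` and `2` are
of the first kind, orders `1` and `3` of the second. -/
theorem inner_vertex (hα : ∀ j, 0 < α j) {x₀ y₀ : ℂ} {x y : Fin n → ℂ}
    (hx : ∀ j, x₀ = α j * x j) (hy : y₀ = ∑ j, y j / α j) :
    (inner ℝ x₀ y₀ : ℝ) = ∑ j, inner ℝ (x j) (y j) := by
  rw [hy, inner_sum]
  apply Finset.sum_congr rfl
  intro j _
  have h := (hα j).ne'
  rw [hx j, ← Complex.real_smul, show y j / (α j : ℂ) = (α j)⁻¹ • y j by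
    rw [Complex.real_smul, div_eq_inv_mul, Complex.ofReal_inv], real_inner_smul_left,
    real_inner_smul_right, ← mul_assoc, mul_inv_cancel₀ h, one_mul]

theorem inner_vertex' (hα : ∀ j, 0 < α j) {x₀ y₀ : ℂ} {x y : Fin n → ℂ}
    (hx : ∀ j, x₀ = α j * x j) (hy : y₀ = ∑ j, y j / α j) :
    (inner ℝ y₀ x₀ : ℝ) = ∑ j, inner ℝ (y j) (x j) := by
  rw [real_inner_comm, inner_vertex hα hx hy]
  exact Finset.sum_congr rfl fun j _ => real_inner_comm _ _

/-- `A` is skew: the integrations by parts leave at the vertex only products of an even and an odd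
order derivative, which balance by `inner_vertex`. This is conservation of the `L²` norm. -/
theorem re_inner_opA (hl : ∀ j, 0 < l j) (hα : ∀ j, 0 < α j) {U : Jet l 4} (hU : U ∈ domA l α) :
    (inner ℂ (opA U) (U 0)).re = 0 := by
  obtain ⟨hS, ho, h0, h1, h2, h3⟩ := hU
  let G : Fin (n + 1) → ℝ → ℝ := fun j c => (inner ℝ (Complex.I * bd U 1 j c) (bd U 0 j c)
        - inner ℝ (Complex.I * bd U 3 j c) (bd U 0 j c)
        + inner ℝ (Complex.I * bd U 2 j c) (bd U 1 j c) : ℝ)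
  have edge : ∀ j, (inner ℂ (opA U j) (U 0 j)).re =
      G j (right l j) - G j (left l j) := by
    intro j
    have hab := left_lt_right hl j
    have ha := left_mem_Icc.2 hab.le
    have hb := right_mem_Icc.2 hab.le
    have d0 : IsWeakDeriv (U 0 j) (U 1 j) := hS 0 j
    have d1 : IsWeakDeriv (U 1 j) (U 2 j) := hS 1 j
    have d2 : IsWeakDeriv (U 2 j) (U 3 j) := hS 2 j
    have d3 : IsWeakDeriv (U 3 j) (U 4 j) := hS 3 j
    have p1 := (d1.smul Complex.I).inner_parts hab d0
    have p2 := (d3.smul Complex.I).inner_parts hab d0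
    have p3 := (d2.smul Complex.I).inner_parts hab d1
    rw [re_inner_I_smul_self, d1.trace_smul hab _ ha, d1.trace_smul hab _ hb] at p1
    rw [d3.trace_smul hab _ ha, d3.trace_smul hab _ hb] at p2
    rw [re_inner_I_smul_self, d2.trace_smul hab _ ha, d2.trace_smul hab _ hb] at p3
    have e : opA U j = Complex.I • U 2 j - Complex.I • U 4 j := rfl
    rw [e, inner_sub_left, Complex.sub_re]
    simp only [G, bd]
    linarith
  rw [L2G.inner_eq_sum, Finset.sum_congr rfl fun j _ => edge j, sum_edges_bdry (G := G)]
  · have v1 := inner_vertex' hα (x := fun j => bd U 0 j.succ 0)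
      (y := fun j => Complex.I * bd U 1 j.succ 0) (y₀ := Complex.I * bd U 1 0 0) h0
      (by rw [h1, Finset.mul_sum]; simp only [mul_div_assoc])
    have v2 := inner_vertex' hα (x := fun j => bd U 0 j.succ 0)
      (y := fun j => Complex.I * bd U 3 j.succ 0) (y₀ := Complex.I * bd U 3 0 0) h0
      (by rw [h3, Finset.mul_sum]; simp only [mul_div_assoc])
    have v3 := inner_vertex hα (x := fun j => Complex.I * bd U 2 j.succ 0)
      (y := fun j => bd U 1 j.succ 0) (x₀ := Complex.I * bd U 2 0 0)
      (fun j => by rw [h2 j]; ring) h1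
    simp only [G, Finset.sum_add_distrib, Finset.sum_sub_distrib]
    rw [v1, v2, v3]
    ring
  · intro j
    simp [G, ho j]

/-- Moving all derivatives onto `U` turns the first and second order parts into `-⟨W, U'' - U''''⟩`,
whose real part vanishes because `W = i (U'' - U'''')`. The boundary terms need the balance
condition for the first derivative of `W`, so `W` is taken in `energySpace` and not merely in `H20`.
This is conservation of the `H²` norm. -/
theorem re_inner_energy (hl : ∀ j, 0 < l j) (hα : ∀ j, 0 < α j) {U : Jet l 4} (hU : U ∈ domA l α)
    {W : Jet l 2} (hW : W ∈ energySpace l α) (h : W 0 = opA U) :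
    (inner ℂ W (truncL l U)).re = 0 := by
  have hz := re_inner_opA hl hα hU
  obtain ⟨hS, ho, h0, h1, h2, h3⟩ := hU
  obtain ⟨⟨wS, wo, w0⟩, w1⟩ := hW
  rw [Jet.inner_eq_sum, Fin.sum_univ_three, truncL_zero, truncL_one, truncL_two, h, hz, zero_add,
    L2G.inner_eq_sum, L2G.inner_eq_sum, ← Finset.sum_add_distrib]
  let G : Fin (n + 1) → ℝ → ℝ := fun j c => (inner ℝ (bd W 0 j c) (bd U 1 j c) + inner ℝ (bd W 1 j c) (bd U 2 j c)
        - inner ℝ (bd W 0 j c) (bd U 3 j c) : ℝ)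
  have edge : ∀ j, (inner ℂ (W 1 j) (U 1 j)).re + (inner ℂ (W 2 j) (U 2 j)).re =
      G j (right l j) - G j (left l j) := by
    intro j
    have hab := left_lt_right hl j
    have P := smoothPair_of_opA hS wS h j
    have p1 := P.dw₀.inner_parts hab P.du₁
    have p2 := P.dw₁.inner_parts hab P.du₂
    have p3 := P.dw₀.inner_parts hab P.du₃
    have p4 : (inner ℂ (W 0 j) (U 2 j - U 4 j)).re = 0 := by
      have := P.eq
      simp only at this
      rw [this, re_inner_I_smul_self]
    rw [inner_sub_right, Complex.sub_re] at p4
    simp only [G, bd]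
    linarith
  rw [Finset.sum_congr rfl fun j _ => edge j, sum_edges_bdry (G := G)]
  · have v1 := inner_vertex hα w0 h1
    have v2 := inner_vertex' hα h2 w1
    have v3 := inner_vertex hα w0 h3
    simp only [G, Finset.sum_add_distrib, Finset.sum_sub_distrib]
    rw [v1, v3, v2]
    ring
  · intro j
    simp [G, wo j]

/-- Integrating by parts once leaves no boundary terms, and the Cauchy–Schwarz inequality applies.
It turns the first order error terms of the multiplier estimates into `L²` terms. -/
theorem norm_one_sq_le (hl : ∀ j, 0 < l j) (hα : ∀ j, 0 < α j) {U : Jet l 4} (hU : U ∈ domA l α) :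
    ‖U 1‖ ^ 2 ≤ ‖U 0‖ * ‖U 2‖ := by
  obtain ⟨hS, ho, h0, h1, h2, h3⟩ := hU
  let G : Fin (n + 1) → ℝ → ℝ := fun j c => (inner ℝ (bd U 0 j c) (bd U 1 j c) : ℝ)
  have edge : ∀ j, (inner ℂ (U 1 j) (U 1 j)).re + (inner ℂ (U 0 j) (U 2 j)).re =
      G j (right l j) - G j (left l j) := fun j =>
    (show IsWeakDeriv (U 0 j) (U 1 j) from hS 0 j).inner_parts (left_lt_right hl j)
      (show IsWeakDeriv (U 1 j) (U 2 j) from hS 1 j)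
  have hsum : (inner ℂ (U 1) (U 1)).re + (inner ℂ (U 0) (U 2)).re = 0 := by
    rw [L2G.inner_eq_sum, L2G.inner_eq_sum, ← Finset.sum_add_distrib,
      Finset.sum_congr rfl fun j _ => edge j, sum_edges_bdry (G := G)]
    · simp only [G]
      rw [inner_vertex hα h0 h1, sub_self]
    · intro j
      simp [G, ho j]
  have e : (inner ℂ (U 1) (U 1)).re = ‖U 1‖ ^ 2 := by
    rw [inner_self_eq_norm_sq_to_K]; norm_cast
  rw [e] at hsum
  have h5 : |(inner ℂ (U 0) (U 2)).re| ≤ ‖U 0‖ * ‖U 2‖ :=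
    (Complex.abs_re_le_norm _).trans (norm_inner_le_norm _ _)
  linarith [neg_le_of_abs_le h5]

/-! ### The observability inequality with a lower order term -/

/-- Lagrange's identity. It rewrites the defect between a sum of squares and the square of a sum as
a sum over pairs of edges. -/
theorem sum_inner_sub_sub (x y : Fin n → ℂ) :
    ∑ j, ∑ k, (inner ℝ (x j - x k) (y j - y k) : ℝ)
      = 2 * n * ∑ j, inner ℝ (x j) (y j) - 2 * inner ℝ (∑ j, x j) (∑ j, y j) := by
  simp only [inner_sub_left, inner_sub_right, Finset.sum_sub_distrib, Finset.sum_const,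
    Finset.card_univ, Fintype.card_fin, sum_inner, inner_sum, nsmul_eq_mul]
  rw [Finset.sum_comm (f := fun j k => (inner ℝ (x k) (y j) : ℝ)), ← Finset.mul_sum]
  ring

/-- The boundary terms of the multiplier identity at the vertex. -/
theorem bdryForm_vertex {s : ℝ} (hs : 0 < s) (hsn : s ^ 2 = n) (L : ℝ) {A₀ A₁ A₂ A₃ B : ℂ}
    {a₀ a₁ a₂ a₃ b : Fin n → ℂ} (h₀ : ∀ j, A₀ = s * a₀ j) (h₁ : A₁ = ∑ j, a₁ j / s)
    (h₂ : ∀ j, A₂ = s * a₂ j) (h₃ : A₃ = ∑ j, a₃ j / s) (hB : ∀ j, B = s * b j) :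
    bdryForm L 1 0 A₀ A₁ A₂ A₃ B - ∑ j, bdryForm L 1 0 (a₀ j) (a₁ j) (a₂ j) (a₃ j) (b j)
      = L / (2 * n) * ∑ j, ∑ k, (‖a₁ j - a₁ k‖ ^ 2
          - 2 * inner ℝ (a₃ j - a₃ k) (a₁ j - a₁ k)) := by
  have hα : ∀ _ : Fin n, 0 < s := fun _ => hs
  have hn : (n : ℝ) ≠ 0 := by rw [← hsn]; positivity
  have v21 := inner_vertex hα h₂ h₁
  have v01 := inner_vertex hα h₀ h₁
  have v03 := inner_vertex hα h₀ h₃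
  have hsC : (s : ℂ) ≠ 0 := by exact_mod_cast hs.ne'
  have e1 : A₁ = s⁻¹ • ∑ j, a₁ j := by
    rw [h₁, ← Finset.sum_div, Complex.real_smul, div_eq_inv_mul, Complex.ofReal_inv]
  have e3 : A₃ = s⁻¹ • ∑ j, a₃ j := by
    rw [h₃, ← Finset.sum_div, Complex.real_smul, div_eq_inv_mul, Complex.ofReal_inv]
  have f2 : ∀ j, a₂ j = s⁻¹ • A₂ := fun j => by
    rw [h₂ j, Complex.real_smul, Complex.ofReal_inv, inv_mul_cancel_left₀ hsC]
  have f0 : ∀ j, a₀ j = s⁻¹ • A₀ := fun j => by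
    rw [h₀ j, Complex.real_smul, Complex.ofReal_inv, inv_mul_cancel_left₀ hsC]
  have fB : ∀ j, b j = s⁻¹ • B := fun j => by
    rw [hB j, Complex.real_smul, Complex.ofReal_inv, inv_mul_cancel_left₀ hsC]
  have hss : s⁻¹ * s⁻¹ = (n : ℝ)⁻¹ := by rw [← hsn]; ring
  -- Because `s ^ 2 = n`, `n` equal copies scaled by `1 / s` carry the same total square. The
  -- quantities that are continuous at the vertex therefore cancel.
  have n2 : ∑ j, ‖a₂ j‖ ^ 2 = ‖A₂‖ ^ 2 := by
    simp only [f2, norm_smul, mul_pow, Finset.sum_const, Finset.card_univ, Fintype.card_fin,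
      nsmul_eq_mul, Real.norm_eq_abs, sq_abs]
    rw [sq s⁻¹, hss, mul_inv_cancel_left₀ hn]
  have nB : ∑ j, (inner ℝ (Complex.I * a₀ j) (b j) : ℝ) = inner ℝ (Complex.I * A₀) B := by
    simp only [f0, fB, mul_smul_comm, real_inner_smul_left, real_inner_smul_right,
      Finset.sum_const, Finset.card_univ, Fintype.card_fin, nsmul_eq_mul]
    rw [← mul_assoc s⁻¹, hss, mul_inv_cancel_left₀ hn]
  have n1 : ‖A₁‖ ^ 2 = (n : ℝ)⁻¹ * inner ℝ (∑ j, a₁ j) (∑ j, a₁ j) := by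
    rw [e1, ← real_inner_self_eq_norm_sq, real_inner_smul_left, real_inner_smul_right, ← mul_assoc,
      hss]
  have n31 : (inner ℝ A₃ A₁ : ℝ) = (n : ℝ)⁻¹ * inner ℝ (∑ j, a₃ j) (∑ j, a₁ j) := by
    rw [e1, e3, real_inner_smul_left, real_inner_smul_right, ← mul_assoc, hss]
  have s1 := sum_inner_sub_sub a₁ a₁
  have s3 := sum_inner_sub_sub a₃ a₁
  simp only [real_inner_self_eq_norm_sq] at s1
  simp only [Finset.sum_sub_distrib, ← Finset.mul_sum]
  rw [s1, s3, real_inner_self_eq_norm_sq (∑ j, a₁ j)] at *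
  simp only [bdryForm, Finset.sum_add_distrib, Finset.sum_sub_distrib, ← Finset.mul_sum,
    Finset.sum_neg_distrib, one_mul, zero_mul, sub_zero]
  have v12 := inner_vertex' hα h₂ h₁
  rw [v21, v01, v03, v12, n2, nB, n1, n31]
  have hnn : (n : ℝ) * (n : ℝ)⁻¹ = 1 := mul_inv_cancel₀ hn
  field_simp
  ring

/-- The component on edge `j` as a real-linear map. -/
def edgeL (l : Fin (n + 1) → ℝ) (j : Fin (n + 1)) : L2G l →L[ℝ] L2I (left l j) (right l j) :=
  (PiLp.proj 2 (fun j => L2I (left l j) (right l j)) j : L2G l →L[ℂ] _).restrictScalars ℝ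

@[simp] theorem edgeL_apply (j : Fin (n + 1)) (x : L2G l) : edgeL l j x = x j := rfl

/-- The bilinear form whose diagonal on a solution has the derivative appearing in the
multiplier identities. -/
abbrev Form (l : Fin (n + 1) → ℝ) : Type := L2G l →L[ℝ] L2G l →L[ℝ] ℝ

theorem outer_succ_eq_right (j : Fin n) : outer l j.succ = right l j.succ := by
  rw [outer_succ, right_succ]

/-- Hidden regularity: the static estimate. -/
theorem exists_hidden_form (hl : ∀ j, 0 < l j) (j : Fin n) :
    ∃ (Ψ : Form l) (C : ℝ), 0 ≤ C ∧ ∀ U ∈ domA l α, ∀ W ∈ energySpace l α, W 0 = opA U →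
      ‖bd U 2 j.succ (outer l j.succ)‖ ^ 2
        ≤ C * ‖truncL l U‖ ^ 2 - (Ψ (W 0) (U 1) + Ψ (U 0) (W 1)) := by
  have hab := left_lt_right hl j.succ
  have hr : right l j.succ = l j.succ := right_succ j
  have hpos := hl j.succ
  set r := l j.succ with hrdef
  -- The weight `x ^ 3` vanishes at the vertex with its first two derivatives, so no vertex terms
  -- appear. At the outer end, where `u = u' = 0`, the boundary term is `-r ^ 3 |u''| ^ 2`.
  obtain ⟨Φ, hΦ⟩ := L2I.exists_form (a := left l j.succ) (b := right l j.succ)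
    (q := fun x => x ^ 3) (by fun_prop)
  have hr3 : 0 < r ^ 3 := by positivity
  set K : ℝ := 4 * (3 * r ^ 2) + 1 + (6 * r + 6) + 8 * (6 * r + 6) ^ 2 / 1 with hK
  have hK0 : 0 ≤ K := by positivity
  refine ⟨(r ^ 3)⁻¹ • Φ.bilinearComp (edgeL l j.succ) (edgeL l j.succ), (r ^ 3)⁻¹ * K,
    by positivity, fun U hU W hW h => ?_⟩
  have P := smoothPair_of_opA hU.1 hW.1.1 h j.succ
  have ho := hU.2.1 j.succ
  rw [outer_succ_eq_right] at ho ⊢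
  have key := P.multiplier_le hab (q₀ := fun x => x ^ 3) (q₁ := fun x => 3 * x ^ 2)
    (q₂ := fun x => 6 * x) (q₃ := fun _ => 6) (N := 3 * r ^ 2) (M := 6 * r + 6) (δ := 1)
    (fun x => by simpa using hasDerivAt_pow 3 x)
    (fun x => by
      exact ((hasDerivAt_pow 2 x).const_mul (3 : ℝ)).congr_deriv (by push_cast; ring))
    (fun x => by simpa using (hasDerivAt_id x).const_mul 6)
    continuous_const hΦ one_pos
    (fun x hx => by
      rw [left_succ, hr] at hx
      have := pow_le_pow_left₀ hx.1 hx.2 2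
      linarith)
    (by positivity)
    (fun x hx => by
      rw [left_succ, hr] at hx
      rw [abs_of_nonneg (by linarith [hx.1])]
      linarith [hx.2])
    (fun x hx => by rw [abs_of_pos (by norm_num)]; linarith)
  have b1 : bdryAt ((right l j.succ) ^ 3) (3 * (right l j.succ) ^ 2) (6 * right l j.succ)
      (fun k => U k j.succ) (fun k => W k j.succ) (right l j.succ)
      = - (r ^ 3 * ‖bd U 2 j.succ (right l j.succ)‖ ^ 2) := by
    change bdryForm _ _ _ (bd U 0 j.succ (right l j.succ)) (bd U 1 j.succ (right l j.succ))
      (bd U 2 j.succ (right l j.succ)) (bd U 3 j.succ (right l j.succ))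
      (bd W 0 j.succ (right l j.succ)) = _
    rw [ho.1, ho.2, bdryForm]
    simp [hr]
  have b2 : bdryAt ((left l j.succ) ^ 3) (3 * (left l j.succ) ^ 2) (6 * left l j.succ)
      (fun k => U k j.succ) (fun k => W k j.succ) (left l j.succ) = 0 := by
    change bdryForm _ _ _ (bd U 0 j.succ (left l j.succ)) (bd U 1 j.succ (left l j.succ))
      (bd U 2 j.succ (left l j.succ)) (bd U 3 j.succ (left l j.succ))
      (bd W 0 j.succ (left l j.succ)) = _
    rw [left_succ, bdryForm]
    simp
  rw [b1, b2] at key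
  have n0 : ‖U 0 j.succ‖ ^ 2 ≤ ‖U 0‖ ^ 2 := by gcongr; exact PiLp.norm_apply_le (U 0) j.succ
  have n1 : ‖U 1 j.succ‖ ^ 2 ≤ ‖U 1‖ ^ 2 := by gcongr; exact PiLp.norm_apply_le (U 1) j.succ
  have n2 : ‖U 2 j.succ‖ ^ 2 ≤ ‖U 2‖ ^ 2 := by gcongr; exact PiLp.norm_apply_le (U 2) j.succ
  have hV : ‖truncL l U‖ ^ 2 = ‖U 0‖ ^ 2 + ‖U 1‖ ^ 2 + ‖U 2‖ ^ 2 := by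
    rw [Jet.norm_sq_eq_sum, Fin.sum_univ_three]; rfl
  simp only [_root_.smul_apply, ContinuousLinearMap.bilinearComp_apply, edgeL_apply, smul_eq_mul]
  rw [← mul_add, mul_assoc, ← mul_sub, inv_mul_eq_div, le_div_iff₀ hr3, hV]
  have c1 : (4 * (3 * r ^ 2) + 1) * ‖U 2 j.succ‖ ^ 2 ≤ K * ‖U 2‖ ^ 2 := by
    apply mul_le_mul _ n2 (by positivity) hK0
    rw [hK]
    have : 0 ≤ (6 * r + 6) + 8 * (6 * r + 6) ^ 2 / 1 := by positivity
    linarith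
  have c2 : (4 * (3 * r ^ 2) + (6 * r + 6) + 8 * (6 * r + 6) ^ 2 / 1) *
      (‖U 0 j.succ‖ ^ 2 + ‖U 1 j.succ‖ ^ 2) ≤ K * (‖U 0‖ ^ 2 + ‖U 1‖ ^ 2) := by
    apply mul_le_mul _ (add_le_add n0 n1) (by positivity) hK0
    rw [hK]
    linarith
  linarith

theorem sum_edges_bdry_outer {G : Fin (n + 1) → ℝ → ℝ} :
    ∑ j, (G j (right l j) - G j (left l j)) = (G 0 0 - ∑ j : Fin n, G j.succ 0)
      + (∑ j : Fin n, G j.succ (outer l j.succ) - G 0 (outer l 0)) := by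
  rw [Fin.sum_univ_succ, right_zero, left_zero, ← outer_zero (l := l), Finset.sum_sub_distrib]
  simp only [right_succ, left_succ, outer_succ]
  ring

theorem exists_pos_le (hl : ∀ j, 0 < l j) : ∃ m : ℝ, 0 < m ∧ ∀ j, m ≤ l j := by
  obtain ⟨i, -, hi⟩ := Finset.exists_min_image Finset.univ l Finset.univ_nonempty
  exact ⟨l i, hl i, fun j => hi j (Finset.mem_univ j)⟩

/-- The pair estimate: the multiplier identity for the difference of two edges, with a decreasing
weight that is `1` at the vertex and vanishes to third order at `m`. -/
theorem pair_estimate {m : ℝ} (hm : 0 < m) {u : Fin 5 → L2I 0 m} {w : Fin 3 → L2I 0 m}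
    (P : SmoothPair u w) (h0 : trace (u 0) 0 = 0) (h2 : trace (u 2) 0 = 0)
    {Φ : L2I 0 m →L[ℝ] L2I 0 m →L[ℝ] ℝ} (hΦ : ∀ f g : L2I 0 m, ∀ F G : ℝ → ℂ,
      f =ᵐ[volume.restrict (Ioo 0 m)] F → g =ᵐ[volume.restrict (Ioo 0 m)] G →
      Φ f g = ∫ x in Ioo 0 m, (1 - x / m) ^ 3 * inner ℝ (Complex.I * F x) (G x))
    {δ : ℝ} (hδ : 0 < δ) :
    Φ (w 0) (u 1) + Φ (u 0) (w 1) ≤ (‖trace (u 1) 0‖ ^ 2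
        - 2 * inner ℝ (trace (u 3) 0) (trace (u 1) 0)) + (δ * ‖u 2‖ ^ 2
          + ((6 / m ^ 2 + 6 / m ^ 3) + 8 * (6 / m ^ 2 + 6 / m ^ 3) ^ 2 / δ)
            * (‖u 0‖ ^ 2 + ‖u 1‖ ^ 2)) := by
  have d : ∀ x : ℝ, HasDerivAt (fun x => 1 - x / m) (-(1 / m)) x := fun x =>
    ((hasDerivAt_id x).div_const m).const_sub 1
  -- The weight is decreasing, so `N = 0` is admissible and the second order interior term costs
  -- only `δ`. The weight and its first two derivatives vanish at `m`. At `0`, with `u = u'' = 0`,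
  -- what remains is the expression in the first and third derivatives.
  have key := P.multiplier_le hm (q₀ := fun x => (1 - x / m) ^ 3)
    (q₁ := fun x => -(3 / m) * (1 - x / m) ^ 2) (q₂ := fun x => 6 / m ^ 2 * (1 - x / m))
    (q₃ := fun _ => -(6 / m ^ 3)) (N := 0) (M := 6 / m ^ 2 + 6 / m ^ 3) (δ := δ)
    (fun x => ((d x).fun_pow 3).congr_deriv (by push_cast; ring))
    (fun x => (((d x).fun_pow 2).const_mul (-(3 / m))).congr_deriv (by push_cast; ring))
    (fun x => ((d x).const_mul (6 / m ^ 2)).congr_deriv (by ring))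
    continuous_const hΦ hδ
    (fun x _ => by
      have : 0 ≤ 3 / m * (1 - x / m) ^ 2 := by positivity
      linarith)
    le_rfl
    (fun x hx => by
      have h1 : 0 ≤ x / m := div_nonneg hx.1 hm.le
      have h2 : x / m ≤ 1 := (div_le_one hm).2 hx.2
      rw [abs_mul, abs_of_nonneg (by linarith : 0 ≤ 1 - x / m), abs_of_pos (by positivity)]
      have h3 : 6 / m ^ 2 * (1 - x / m) ≤ 6 / m ^ 2 * 1 :=
        mul_le_mul_of_nonneg_left (by linarith) (by positivity)
      have h4 : 0 ≤ 6 / m ^ 3 := by positivity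
      linarith)
    (fun x _ => by
      rw [abs_neg, abs_of_pos (by positivity)]
      have : 0 ≤ 6 / m ^ 2 := by positivity
      linarith)
  refine key.trans (le_of_eq ?_)
  have hmm : m / m = 1 := div_self hm.ne'
  simp only [bdryAt, bdryForm, h0, h2, hmm, zero_div]
  simp
  ring

set_option maxHeartbeats 1600000 in
/-- The static estimate behind the observability inequality. -/
theorem exists_observability_form (hl : ∀ j, 0 < l j) {s : ℝ} (hs : 0 < s) (hsn : s ^ 2 = n)
    (hα : ∀ j, α j = s) :
    ∃ (Ψ : Form l) (C : ℝ), 0 ≤ C ∧ ∀ U ∈ domA l α, ∀ W ∈ energySpace l α, W 0 = opA U →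
      ‖truncL l U‖ ^ 2 ≤ (Ψ (W 0) (U 1) + Ψ (U 0) (W 1))
        + C * (∑ j : Fin n, ‖bd U 2 j.succ (outer l j.succ)‖ ^ 2 + ‖U 0‖ ^ 2) := by
  have hα0 : ∀ j, 0 < α j := fun j => by rw [hα j]; exact hs
  have hn : (0 : ℝ) < n := by rw [← hsn]; positivity
  obtain ⟨m, hm, hml⟩ := exists_pos_le hl
  set L := l 0 with hL
  have hL0 : 0 < L := hl 0
  -- With the weight `x + L` the coefficient of `|u''| ^ 2` at the outer end `-L` of edge `0` is
  -- zero; this is why that end need not be observed.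
  choose Φ hΦ using fun j : Fin (n + 1) => L2I.exists_form (a := left l j) (b := right l j)
    (q := fun x => x + L) (by fun_prop)
  obtain ⟨Φm, hΦm⟩ := L2I.exists_form (a := 0) (b := m) (q := fun x => (1 - x / m) ^ 3)
    (by fun_prop)
  have hlj : ∀ j : Fin n, left l j.succ ≤ 0 := fun j => (left_succ j).le
  have hrj : ∀ j : Fin n, m ≤ right l j.succ := fun j => by rw [right_succ]; exact hml _
  choose R hR hRn using fun j : Fin n => L2I.exists_restrict (hlj j) (hrj j)
  -- The difference of edges `j` and `k`, both restricted to a common interval `(0, m)`.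
  let D : Fin n → Fin n → (L2G l →L[ℝ] L2I 0 m) := fun j k =>
    ((R j).restrictScalars ℝ).comp (edgeL l j.succ)
      - ((R k).restrictScalars ℝ).comp (edgeL l k.succ)
  have hD : ∀ j k x, D j k x = R j (x j.succ) - R k (x k.succ) := fun j k x => rfl
  have hDn : ∀ j k x, ‖D j k x‖ ^ 2 ≤ 4 * ‖x‖ ^ 2 := by
    intro j k x
    have h1 : ‖D j k x‖ ≤ 2 * ‖x‖ := by
      rw [hD]
      refine (norm_sub_le _ _).trans ?_
      linarith [hRn j (x j.succ), hRn k (x k.succ), PiLp.norm_apply_le x j.succ,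
        PiLp.norm_apply_le x k.succ]
    calc ‖D j k x‖ ^ 2 ≤ (2 * ‖x‖) ^ 2 := by gcongr
      _ = 4 * ‖x‖ ^ 2 := by ring
  -- The errors of the `n ^ 2` pairs, each at most `4 δ ‖U 2‖ ^ 2` at second order and weighted by
  -- `L / (2 n)`, add up to exactly `‖U 2‖ ^ 2`, to be absorbed by the interior term `4 ‖U 2‖ ^ 2`.
  set δ : ℝ := 1 / (2 * n * L) with hδ
  have hδ0 : 0 < δ := by positivity
  set K : ℝ := (6 / m ^ 2 + 6 / m ^ 3) + 8 * (6 / m ^ 2 + 6 / m ^ 3) ^ 2 / δ with hK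
  have hK0 : 0 ≤ K := by positivity
  set K' : ℝ := 2 * n * L * K with hK'
  have hK'0 : 0 ≤ K' := by positivity
  have hlsum : ∀ j, l j ≤ ∑ i, l i := fun j =>
    Finset.single_le_sum (fun i _ => (hl i).le) (Finset.mem_univ j)
  have hlsum0 : 0 ≤ ∑ i, l i := Finset.sum_nonneg fun i _ => (hl i).le
  refine ⟨∑ j, (Φ j).bilinearComp (edgeL l j) (edgeL l j)
    - (L / (2 * n)) • ∑ j, ∑ k, Φm.bilinearComp (D j k) (D j k),
    2 * (∑ i, l i) + (1 + K' + K' ^ 2 / 4), by positivity, fun U hU W hW h => ?_⟩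
  have hU1 := norm_one_sq_le hl hα0 hU
  obtain ⟨hS, ho, v0, v1, v2, v3⟩ := hU
  obtain ⟨⟨wS, wo, w0⟩, -⟩ := hW
  have P := smoothPair_of_opA hS wS h
  let G : Fin (n + 1) → ℝ → ℝ := fun j c => bdryForm (c + L) 1 0 (bd U 0 j c) (bd U 1 j c)
    (bd U 2 j c) (bd U 3 j c) (bd W 0 j c)
  have edge : ∀ j, Φ j (W 0 j) (U 1 j) + Φ j (U 0 j) (W 1 j)
      = G j (right l j) - G j (left l j) + (2 * ‖U 1 j‖ ^ 2 + 4 * ‖U 2 j‖ ^ 2) := fun j =>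
    (P j).multiplier_affine (left_lt_right hl j) (hΦ j)
  have edges : ∑ j, (Φ j (W 0 j) (U 1 j) + Φ j (U 0 j) (W 1 j))
      = (G 0 0 - ∑ j : Fin n, G j.succ 0)
      + (∑ j : Fin n, G j.succ (outer l j.succ) - G 0 (outer l 0))
      + (2 * ‖U 1‖ ^ 2 + 4 * ‖U 2‖ ^ 2) := by
    rw [Finset.sum_congr rfl fun j _ => edge j, Finset.sum_add_distrib, sum_edges_bdry_outer,
      L2G.norm_sq_eq_sum, L2G.norm_sq_eq_sum, Finset.mul_sum, Finset.mul_sum,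
      ← Finset.sum_add_distrib]
  have vertex : G 0 0 - ∑ j : Fin n, G j.succ 0 = L / (2 * n) * ∑ j : Fin n, ∑ k : Fin n,
      (‖bd U 1 j.succ 0 - bd U 1 k.succ 0‖ ^ 2
        - 2 * inner ℝ (bd U 3 j.succ 0 - bd U 3 k.succ 0) (bd U 1 j.succ 0 - bd U 1 k.succ 0)) := by
    simp only [G, zero_add]
    simp only [hα] at v0 v1 v2 v3 w0
    exact bdryForm_vertex hs hsn L v0 v1 v2 v3 w0
  have out0 : G 0 (outer l 0) = 0 := by
    simp only [G]
    rw [(ho 0).1, (ho 0).2, outer_zero, bdryForm]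
    simp [hL]
  have outj : ∀ j : Fin n, G j.succ (outer l j.succ)
      = -((l j.succ + L) * ‖bd U 2 j.succ (outer l j.succ)‖ ^ 2) := by
    intro j
    simp only [G]
    rw [(ho j.succ).1, (ho j.succ).2, bdryForm]
    simp [outer_succ]
  have outsum : -(2 * (∑ i, l i) * ∑ j : Fin n, ‖bd U 2 j.succ (outer l j.succ)‖ ^ 2)
      ≤ ∑ j : Fin n, G j.succ (outer l j.succ) := by
    rw [Finset.mul_sum, ← Finset.sum_neg_distrib]
    apply Finset.sum_le_sum
    intro j _
    rw [outj, neg_le_neg_iff]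
    apply mul_le_mul_of_nonneg_right _ (sq_nonneg _)
    linarith [hlsum j.succ, hlsum 0]
  -- For equal weights two edges have the same value and the same second derivative at the vertex,
  -- so their difference satisfies the hypotheses of `pair_estimate`.
  have pair : ∀ j k : Fin n, Φm (D j k (W 0)) (D j k (U 1)) + Φm (D j k (U 0)) (D j k (W 1))
      ≤ (‖bd U 1 j.succ 0 - bd U 1 k.succ 0‖ ^ 2
        - 2 * inner ℝ (bd U 3 j.succ 0 - bd U 3 k.succ 0) (bd U 1 j.succ 0 - bd U 1 k.succ 0))
        + (4 * δ * ‖U 2‖ ^ 2 + 4 * K * (‖U 0‖ ^ 2 + ‖U 1‖ ^ 2)) := by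
    intro j k
    have Q := ((P j.succ).map_restrict (hlj j) (hrj j) (hR j)).sub
      ((P k.succ).map_restrict (hlj k) (hrj k) (hR k))
    have z : (0 : ℝ) ∈ Icc 0 m := left_mem_Icc.2 hm.le
    have tr : ∀ i : Fin 4, trace (R j (U i.castSucc j.succ) - R k (U i.castSucc k.succ)) 0
        = bd U i.castSucc j.succ 0 - bd U i.castSucc k.succ 0 := by
      intro i
      have Qj := ((P j.succ).map_restrict (hlj j) (hrj j) (hR j)).du i
      have Qk := ((P k.succ).map_restrict (hlj k) (hrj k) (hR k)).du i
      rw [Qj.trace_comb hm Qk z, ((P j.succ).du i).trace_restrict (left_lt_right hl _) hm (hlj j)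
        (hrj j) (hR j _) z, ((P k.succ).du i).trace_restrict (left_lt_right hl _) hm (hlj k)
        (hrj k) (hR k _) z]
      rfl
    have hsC : (s : ℂ) ≠ 0 := by exact_mod_cast hs.ne'
    have e0 : bd U 0 j.succ 0 = bd U 0 k.succ 0 := by
      have a := v0 j; rw [v0 k, hα, hα] at a
      exact (mul_left_cancel₀ hsC a).symm
    have e2 : bd U 2 j.succ 0 = bd U 2 k.succ 0 := by
      have a := v2 j; rw [v2 k, hα, hα] at a
      exact (mul_left_cancel₀ hsC a).symm
    have t0 : trace (R j (U 0 j.succ) - R k (U 0 k.succ)) 0 = 0 :=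
      (tr 0).trans (sub_eq_zero.2 e0)
    have t2 : trace (R j (U 2 j.succ) - R k (U 2 k.succ)) 0 = 0 :=
      (tr 2).trans (sub_eq_zero.2 e2)
    have t1 : trace (R j (U 1 j.succ) - R k (U 1 k.succ)) 0
      = bd U 1 j.succ 0 - bd U 1 k.succ 0 := tr 1
    have t3 : trace (R j (U 3 j.succ) - R k (U 3 k.succ)) 0
      = bd U 3 j.succ 0 - bd U 3 k.succ 0 := tr 3
    have est := pair_estimate hm Q t0 t2 hΦm hδ0
    simp only [Pi.sub_apply] at est
    rw [t1, t3] at est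
    simp only [← hD] at est
    refine est.trans ?_
    have c2 := mul_le_mul_of_nonneg_left (hDn j k (U 2)) hδ0.le
    have c01 := mul_le_mul_of_nonneg_left (add_le_add (hDn j k (U 0)) (hDn j k (U 1))) hK0
    rw [← hK]
    linarith
  have pairs : L / (2 * n) * ∑ j : Fin n, ∑ k : Fin n,
      (Φm (D j k (W 0)) (D j k (U 1)) + Φm (D j k (U 0)) (D j k (W 1)))
      ≤ (G 0 0 - ∑ j : Fin n, G j.succ 0) + (‖U 2‖ ^ 2 + K' * (‖U 0‖ ^ 2 + ‖U 1‖ ^ 2)) := by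
    rw [vertex]
    have c : ‖U 2‖ ^ 2 + K' * (‖U 0‖ ^ 2 + ‖U 1‖ ^ 2) = L / (2 * n) * ∑ _j : Fin n, ∑ _k : Fin n,
        (4 * δ * ‖U 2‖ ^ 2 + 4 * K * (‖U 0‖ ^ 2 + ‖U 1‖ ^ 2)) := by
      simp only [Finset.sum_const, Finset.card_univ, Fintype.card_fin, nsmul_eq_mul]
      rw [hK', hδ]
      field_simp
      ring
    rw [c, ← mul_add, ← Finset.sum_add_distrib]
    apply mul_le_mul_of_nonneg_left _ (by positivity)
    apply Finset.sum_le_sum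
    intro j _
    rw [← Finset.sum_add_distrib]
    exact Finset.sum_le_sum fun k _ => pair j k
  have hΨ : (∑ j, (Φ j).bilinearComp (edgeL l j) (edgeL l j)
      - (L / (2 * n)) • ∑ j, ∑ k, Φm.bilinearComp (D j k) (D j k) : Form l) (W 0) (U 1)
      + (∑ j, (Φ j).bilinearComp (edgeL l j) (edgeL l j)
      - (L / (2 * n)) • ∑ j, ∑ k, Φm.bilinearComp (D j k) (D j k) : Form l) (U 0) (W 1)
      = ∑ j, (Φ j (W 0 j) (U 1 j) + Φ j (U 0 j) (W 1 j)) - L / (2 * n) * ∑ j : Fin n, ∑ k : Fin n,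
      (Φm (D j k (W 0)) (D j k (U 1)) + Φm (D j k (U 0)) (D j k (W 1))) := by
    simp only [_root_.sub_apply, _root_.sum_apply, _root_.smul_apply,
      ContinuousLinearMap.bilinearComp_apply, edgeL_apply, smul_eq_mul, Finset.sum_add_distrib]
    ring
  rw [hΨ, edges, out0, sub_zero]
  have hV : ‖truncL l U‖ ^ 2 = ‖U 0‖ ^ 2 + ‖U 1‖ ^ 2 + ‖U 2‖ ^ 2 := by
    rw [Jet.norm_sq_eq_sum, Fin.sum_univ_three]; rfl
  rw [hV]
  set S := ∑ j : Fin n, ‖bd U 2 j.succ (outer l j.succ)‖ ^ 2 with hSdef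
  have hS0 : 0 ≤ S := Finset.sum_nonneg fun j _ => sq_nonneg _
  -- Interpolation costs another `‖U 2‖ ^ 2`; of the four copies available, two remain.
  have i1 : K' * ‖U 1‖ ^ 2 ≤ ‖U 2‖ ^ 2 + K' ^ 2 / 4 * ‖U 0‖ ^ 2 := by
    have := mul_le_mul_of_nonneg_left hU1 hK'0
    nlinarith [sq_nonneg (‖U 2‖ - K' / 2 * ‖U 0‖)]
  have i2 : 0 ≤ (∑ i, l i) * ‖U 0‖ ^ 2 := mul_nonneg hlsum0 (sq_nonneg _)
  have i3 : 0 ≤ (1 + K' + K' ^ 2 / 4) * S := by positivity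
  have i4 : 0 ≤ ‖U 1‖ ^ 2 := sq_nonneg _
  have i5 : 0 ≤ ‖U 2‖ ^ 2 := sq_nonneg _
  nlinarith [pairs, outsum, i1, i2, i3, i4, i5]

open Filter Topology

/-! ### Mild and regular solutions -/

/-- The `k`-th component of a jet. -/
def jetL (l : Fin (n + 1) → ℝ) (k : Fin 3) : Jet l 2 →L[ℂ] L2G l :=
  PiLp.proj 2 (fun _ : Fin 3 => L2G l) k

@[simp] theorem jetL_apply (k : Fin 3) (x : Jet l 2) : jetL l k x = x k := rfl

/-- Mild solutions of `v' = A v` on `[a, b]`, where `A` is restricted to `S`. -/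
structure IsMild (S : Set (Jet l 4)) (a b : ℝ) (v : ℝ → Jet l 2) : Prop where
  cont : Continuous v
  mem : ∀ s ∈ Icc a b, ∀ t ∈ Icc a b, (∫ r in s..t, v r, v t 0 - v s 0) ∈ graphOn S

/-- Solutions `V` that are continuously differentiable in time, with derivative `W`. -/
structure IsRegular (l : Fin (n + 1) → ℝ) (α : Fin n → ℝ) (c d : ℝ) (V W : ℝ → Jet l 2) :
    Prop where
  deriv : ∀ t, HasDerivAt V (W t) t
  cont : Continuous W
  mem : ∀ t ∈ Icc c d, (V t, W t 0) ∈ graphOn (domA l α)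
  energy : ∀ t ∈ Icc c d, W t ∈ energySpace l α

theorem domObs_subset : domObs l α ⊆ domA l α := fun _ h => h.1

theorem graphOn_mono {S S' : Set (Jet l 4)} (h : S ⊆ S') : graphOn S ⊆ graphOn S' :=
  image_mono h

theorem IsMild.mono {S S' : Set (Jet l 4)} {a b : ℝ} {v : ℝ → Jet l 2} (h : IsMild S a b v)
    (hS : S ⊆ S') : IsMild S' a b v :=
  ⟨h.cont, fun s hs t ht => graphOn_mono hS (h.mem s hs t ht)⟩

theorem IsMild.restrict {S : Set (Jet l 4)} {a b c d : ℝ} {v : ℝ → Jet l 2} (h : IsMild S a b v)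
    (hcd : Icc c d ⊆ Icc a b) : IsMild S c d v :=
  ⟨h.cont, fun s hs t ht => h.mem s (hcd hs) t (hcd ht)⟩

theorem IsMild.shift {S : Set (Jet l 4)} {a b : ℝ} {v : ℝ → Jet l 2} (h : IsMild S a b v)
    (r : ℝ) : IsMild S (a - r) (b - r) (fun t => v (t + r)) :=
  ⟨h.cont.comp (continuous_id.add continuous_const), fun s hs t ht => by
    have := h.mem (s + r) ⟨by linarith [hs.1], by linarith [hs.2]⟩ (t + r)
      ⟨by linarith [ht.1], by linarith [ht.2]⟩
    rwa [intervalIntegral.integral_comp_add_right (fun t => v t) r]⟩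

theorem IsMild.add {S : Set (Jet l 4)} (hS : IsClosedSubspace (graphOn S)) {a b : ℝ}
    {v w : ℝ → Jet l 2} (h : IsMild S a b v) (h' : IsMild S a b w) :
    IsMild S a b (fun t => v t + w t) :=
  ⟨h.cont.add h'.cont, fun s hs t ht => by
    have := hS.add_mem (h.mem s hs t ht) (h'.mem s hs t ht)
    rw [intervalIntegral.integral_add (h.cont.intervalIntegrable _ _)
      (h'.cont.intervalIntegrable _ _)]
    convert this using 1
    refine Prod.ext rfl ?_
    simp only [Prod.snd_add, PiLp.add_apply]
    abel⟩

theorem IsMild.smul {S : Set (Jet l 4)} (hS : IsClosedSubspace (graphOn S)) {a b : ℝ}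
    {v : ℝ → Jet l 2} (h : IsMild S a b v) (c : ℂ) : IsMild S a b (fun t => c • v t) :=
  ⟨h.cont.const_smul c, fun s hs t ht => by
    have := hS.smul_mem c (h.mem s hs t ht)
    rw [intervalIntegral.integral_smul]
    convert this using 1
    refine Prod.ext rfl ?_
    simp only [Prod.smul_snd, PiLp.smul_apply, smul_sub]⟩

theorem IsMild.sub {S : Set (Jet l 4)} (hS : IsClosedSubspace (graphOn S)) {a b : ℝ}
    {v w : ℝ → Jet l 2} (h : IsMild S a b v) (h' : IsMild S a b w) :
    IsMild S a b (fun t => v t - w t) := by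
  simpa [sub_eq_add_neg] using h.add hS (h'.smul hS (-1))

theorem fst_mem_energySpace {p : Jet l 2 × L2G l} (hp : p ∈ graphOn (domA l α)) :
    p.1 ∈ energySpace l α := by
  obtain ⟨U, hU, rfl⟩ := hp
  exact truncL_mem_energySpace hU

theorem IsMild.hasDerivAt_average {v : ℝ → Jet l 2} (hv : Continuous v) (h t : ℝ) :
    HasDerivAt (fun t => (h : ℂ)⁻¹ • ∫ r in t..t + h, v r) ((h : ℂ)⁻¹ • (v (t + h) - v t)) t := by
  have e : ∀ t, ∫ r in t..t + h, v r = (∫ r in (0 : ℝ)..t + h, v r) - ∫ r in (0 : ℝ)..t, v r :=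
    fun t => (intervalIntegral.integral_interval_sub_left (hv.intervalIntegrable _ _)
      (hv.intervalIntegrable _ _)).symm
  simp only [e]
  have d : ∀ t, HasDerivAt (fun t => ∫ r in (0 : ℝ)..t, v r) (v t) t := fun t =>
    hv.integral_hasStrictDerivAt 0 t |>.hasDerivAt
  exact (((d (t + h)).comp_add_const t h).fun_sub (d t)).fun_const_smul ((h : ℂ)⁻¹)

/-- `v(t)` is a limit of difference quotients of its primitive, and these belong to the domain of
`A`. As `energySpace` is closed in `H²`, the balance condition for the first derivative holds
although `H20` does not contain it. -/
theorem IsMild.mem_energySpace (hl : ∀ j, 0 < l j) {a b : ℝ} (hab : a < b) {v : ℝ → Jet l 2}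
    (h : IsMild (domA l α) a b v) {t : ℝ} (ht : t ∈ Icc a b) : v t ∈ energySpace l α := by
  have hE := isClosedSubspace_energySpace (α := α) hl
  have d : HasDerivAt (fun t => ∫ r in a..t, v r) (v t) t :=
    h.cont.integral_hasStrictDerivAt a t |>.hasDerivAt
  have lim := (hasDerivAt_iff_tendsto_slope.1 d).mono_left
    (nhdsWithin_mono t (fun x (hx : x ∈ Icc a b \ {t}) => hx.2))
  -- Only quotients with both times in `[a, b]` are known to lie in the space; at the endpoints
  -- these are one-sided.
  have : (𝓝[Icc a b \ {t}] t).NeBot := by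
    rw [← mem_closure_iff_nhdsWithin_neBot]
    have hd : Icc a b ⊆ closure (Ioo a b \ {t}) := by
      have hD : Dense ({t}ᶜ : Set ℝ) := dense_compl_singleton t
      rw [← closure_Ioo hab.ne]
      apply closure_minimal _ isClosed_closure
      rw [sdiff_eq_compl_inter, inter_comm]
      exact hD.open_subset_closure_inter isOpen_Ioo
    exact closure_mono (sdiff_subset_sdiff_left Ioo_subset_Icc_self) (hd ht)
  refine hE.isClosed.mem_of_tendsto lim ?_
  filter_upwards [self_mem_nhdsWithin] with x hx
  rw [slope_def_module, intervalIntegral.integral_interval_sub_left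
    (h.cont.intervalIntegrable _ _) (h.cont.intervalIntegrable _ _)]
  have := hE.smul_mem (algebraMap ℝ ℂ (x - t)⁻¹) (fst_mem_energySpace (h.mem t ht x hx.1))
  rwa [algebraMap_smul] at this

/-- The mild formulation says precisely that a time average lies in the domain of `A`, with image
the difference quotient of `v`. The step `h` may be negative, which gives averages near the right
end of the interval. -/
theorem IsMild.regular_average (hl : ∀ j, 0 < l j) {a b c d h : ℝ} (hab : a < b)
    {v : ℝ → Jet l 2} (H : IsMild (domA l α) a b v)
    (hcd : ∀ t ∈ Icc c d, t ∈ Icc a b ∧ t + h ∈ Icc a b) :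
    IsRegular l α c d (fun t => (h : ℂ)⁻¹ • ∫ r in t..t + h, v r)
      (fun t => (h : ℂ)⁻¹ • (v (t + h) - v t)) where
  deriv := IsMild.hasDerivAt_average H.cont h
  cont := ((H.cont.comp (continuous_id.add continuous_const)).sub H.cont).const_smul ((h : ℂ)⁻¹)
  mem t ht := (isClosedSubspace_graphOn hl (isClosedSubspace_domA hl) fun _ h => h.1).smul_mem
    _ (H.mem t (hcd t ht).1 (t + h) (hcd t ht).2)
  energy t ht := (isClosedSubspace_energySpace hl).smul_mem _
    ((isClosedSubspace_energySpace hl).sub_mem (H.mem_energySpace hl hab (hcd t ht).2)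
      (H.mem_energySpace hl hab (hcd t ht).1))

theorem IsRegular.sub (hl : ∀ j, 0 < l j) {c d : ℝ} {V W V' W' : ℝ → Jet l 2}
    (h : IsRegular l α c d V W) (h' : IsRegular l α c d V' W') :
    IsRegular l α c d (fun t => V t - V' t) (fun t => W t - W' t) where
  deriv t := (h.deriv t).fun_sub (h'.deriv t)
  cont := h.cont.sub h'.cont
  mem t ht := (isClosedSubspace_graphOn hl (isClosedSubspace_domA hl) fun _ h => h.1).sub_mem
    (h.mem t ht) (h'.mem t ht)
  energy t ht := (isClosedSubspace_energySpace hl).sub_mem (h.energy t ht) (h'.energy t ht)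

/-! ### Conservation laws -/

theorem norm_eq_of_re_inner_deriv_eq_zero {E : Type*} [NormedAddCommGroup E]
    [InnerProductSpace ℂ E] [NormedSpace ℝ E] [IsScalarTower ℝ ℂ E] {V W : ℝ → E} {c d : ℝ}
    (hV : ∀ t, HasDerivAt V (W t) t) (h : ∀ t ∈ Icc c d, (inner ℂ (W t) (V t)).re = 0) {t : ℝ}
    (ht : t ∈ Icc c d) : ‖V t‖ = ‖V c‖ := by
  have key := constant_of_has_deriv_right_zero (f := fun t => inner ℂ (V t) (V t)) (a := c) (b := d)
    (fun t _ => ((hV t).inner ℂ (hV t)).continuousAt.continuousWithinAt)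
    (fun t ht => by
      have e := ((hV t).inner ℂ (hV t)).hasDerivWithinAt (s := Ici t)
      convert e using 1
      have e1 : inner ℂ (V t) (W t) = (starRingEnd ℂ) (inner ℂ (W t) (V t)) :=
        (inner_conj_symm _ _).symm
      rw [e1, add_comm, Complex.add_conj, h t ⟨ht.1, ht.2.le⟩]
      simp) t ht
  simp only [inner_self_eq_norm_sq_to_K] at key
  have : ‖V t‖ ^ 2 = ‖V c‖ ^ 2 := by exact_mod_cast key
  exact (sq_eq_sq₀ (norm_nonneg _) (norm_nonneg _)).1 this

theorem IsRegular.exists_mem {c d : ℝ} {V W : ℝ → Jet l 2} (h : IsRegular l α c d V W) {t : ℝ}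
    (ht : t ∈ Icc c d) : ∃ U ∈ domA l α, truncL l U = V t ∧ W t 0 = opA U := by
  obtain ⟨U, hU, e⟩ := h.mem t ht
  exact ⟨U, hU, congrArg Prod.fst e, (congrArg Prod.snd e).symm⟩

theorem IsRegular.norm_eq (hl : ∀ j, 0 < l j) (hα : ∀ j, 0 < α j) {c d : ℝ} {V W : ℝ → Jet l 2}
    (h : IsRegular l α c d V W) {t : ℝ} (ht : t ∈ Icc c d) : ‖V t‖ = ‖V c‖ :=
  norm_eq_of_re_inner_deriv_eq_zero h.deriv (fun t ht => by
    obtain ⟨U, hU, e, e'⟩ := h.exists_mem ht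
    rw [← e]
    exact re_inner_energy hl hα hU (h.energy t ht) e') ht

theorem IsRegular.norm_zero_eq (hl : ∀ j, 0 < l j) (hα : ∀ j, 0 < α j) {c d : ℝ}
    {V W : ℝ → Jet l 2} (h : IsRegular l α c d V W) {t : ℝ} (ht : t ∈ Icc c d) :
    ‖V t 0‖ = ‖V c 0‖ :=
  norm_eq_of_re_inner_deriv_eq_zero (V := fun t => V t 0) (W := fun t => W t 0)
    (fun t => ((jetL l 0).restrictScalars ℝ).hasFDerivAt.comp_hasDerivAt t (h.deriv t))
    (fun t ht => by
      obtain ⟨U, hU, e, e'⟩ := h.exists_mem ht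
      rw [e', ← e]
      exact re_inner_opA hl hα hU) ht

/-! ### Passage from time averages to mild solutions -/

theorem tendsto_average {E : Type*} [NormedAddCommGroup E] [NormedSpace ℂ E] [CompleteSpace E]
    [NormedSpace ℝ E] [IsScalarTower ℝ ℂ E] {v : ℝ → E} (hv : Continuous v) (t : ℝ) {h : ℕ → ℝ} (h0 : ∀ k, h k ≠ 0)
    (hlim : Tendsto h atTop (𝓝 0)) :
    Tendsto (fun k => (h k : ℂ)⁻¹ • ∫ r in t..t + h k, v r) atTop (𝓝 (v t)) := by
  have d : HasDerivAt (fun x => ∫ r in t..x, v r) (v t) t :=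
    hv.integral_hasStrictDerivAt t t |>.hasDerivAt
  have lim := hasDerivAt_iff_tendsto_slope_zero.1 d
  have h1 : Tendsto h atTop (𝓝[≠] 0) :=
    tendsto_nhdsWithin_iff.2 ⟨hlim, Eventually.of_forall h0⟩
  refine (lim.comp h1).congr fun k => ?_
  simp only [Function.comp_apply, intervalIntegral.integral_same, sub_zero]
  rw [← Complex.ofReal_inv]
  exact (algebraMap_smul ℂ (h k)⁻¹ _).symm

theorem IsMild.norm_eq (hl : ∀ j, 0 < l j) (hα : ∀ j, 0 < α j) {a b : ℝ} {v : ℝ → Jet l 2}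
    (H : IsMild (domA l α) a b v) {t : ℝ} (ht : t ∈ Icc a b) : ‖v t‖ = ‖v a‖ := by
  rcases eq_or_lt_of_le (ht.1.trans ht.2) with hab | hab
  · rw [le_antisymm (hab ▸ ht.2) ht.1]
  -- Forward averages on `[a, t]` need room to the right of `t`; the endpoint `b` follows by
  -- continuity.
  have key : ∀ t ∈ Ico a b, ‖v t‖ = ‖v a‖ := by
    intro t ht
    let h : ℕ → ℝ := fun k => (b - t) * (1 / ((k : ℝ) + 1))
    have hbt : 0 < b - t := by linarith [ht.2]
    have hpos : ∀ k, 0 < h k := fun k => by positivity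
    have hle : ∀ k, h k ≤ b - t := fun k => by
      have : 1 / ((k : ℝ) + 1) ≤ 1 := by
        rw [div_le_one (by positivity)]; linarith [Nat.cast_nonneg (α := ℝ) k]
      nlinarith
    have hlim : Tendsto h atTop (𝓝 0) := by
      have := (tendsto_one_div_add_atTop_nhds_zero_nat (𝕜 := ℝ)).const_mul (b - t)
      rwa [mul_zero] at this
    have l1 := (tendsto_average H.cont t (fun k => (hpos k).ne') hlim).norm
    have l2 := (tendsto_average H.cont a (fun k => (hpos k).ne') hlim).norm
    refine tendsto_nhds_unique l1 (l2.congr fun k => ?_)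
    have R := H.regular_average hl hab (c := a) (d := t) (h := h k) (fun x hx =>
      ⟨⟨hx.1, hx.2.trans ht.2.le⟩, by linarith [hpos k, hx.1], by linarith [hle k, hx.2]⟩)
    exact (R.norm_eq hl hα ⟨ht.1, le_rfl⟩).symm
  have hcl : IsClosed {t | ‖v t‖ = ‖v a‖} := isClosed_eq H.cont.norm continuous_const
  have := closure_minimal (s := Ico a b) (fun t ht => key t ht) hcl
  rw [closure_Ico hab.ne] at this
  exact this ht

/-! ### The second trace as a functional on the graph of the operator -/

/-- On the image of `S` the map `f` has a bounded inverse. Composing it with `Λ` gives a bounded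
functional there, and the Hahn–Banach theorem extends it. -/
theorem IsClosedSubspace.exists_factor {E F : Type*} [NormedAddCommGroup E] [NormedSpace ℂ E]
    [NormedAddCommGroup F] [NormedSpace ℂ F] {S : Set E} (h : IsClosedSubspace S) (f : E →L[ℂ] F)
    {C : ℝ} (hC : ∀ u ∈ S, ‖u‖ ≤ C * ‖f u‖) (Λ : E →L[ℂ] ℂ) :
    ∃ Θ : F →L[ℂ] ℂ, ∀ u ∈ S, Λ u = Θ (f u) := by
  obtain ⟨D, -, rfl⟩ := h
  let g : D →ₗ[ℂ] F := f.toLinearMap ∘ₗ D.subtype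
  have hg : Function.Injective g := by
    rw [injective_iff_map_eq_zero]
    intro u hu
    have h1 := hC u.1 u.2
    have h2 : f u.1 = 0 := hu
    rw [h2, norm_zero, mul_zero] at h1
    exact Subtype.ext (norm_le_zero_iff.1 h1)
  let e := LinearEquiv.ofInjective g hg
  let φ : LinearMap.range g →ₗ[ℂ] ℂ := Λ.toLinearMap ∘ₗ D.subtype ∘ₗ e.symm.toLinearMap
  have hφ : ∀ u : D, φ (e u) = Λ u.1 := fun u => by simp [φ]
  obtain ⟨Θ, hΘ, -⟩ := exists_extension_norm_eq (LinearMap.range g)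
    (φ.mkContinuous (‖Λ‖ * C) fun y => by
      obtain ⟨u, rfl⟩ := e.surjective y
      rw [hφ, mul_assoc]
      exact (Λ.le_opNorm u.1).trans (mul_le_mul_of_nonneg_left (hC u.1 u.2) (norm_nonneg _)))
  refine ⟨Θ, fun u hu => ?_⟩
  have := hΘ (e ⟨u, hu⟩)
  rw [LinearMap.mkContinuous_apply, hφ] at this
  exact this.symm

/-- In this form the trace can be evaluated on `(∫ v, v(t) - v(s))`, which lies in the graph of `A`
for a mild solution, without naming the underlying `H⁴` function. -/
theorem exists_secondTrace (hl : ∀ j, 0 < l j) (j : Fin n) :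
    ∃ Θ : Jet l 2 × L2G l →L[ℂ] ℂ, ∀ U ∈ sobolev l 4,
      bd U 2 j.succ (outer l j.succ) = Θ (truncL l U, opA U) := by
  obtain ⟨Λ, hΛ⟩ := exists_bd (m := 4) hl 2 j.succ (outer_mem hl j.succ)
  obtain ⟨C, -, hC⟩ := exists_norm_le_graph hl
  obtain ⟨Θ, hΘ⟩ := (isClosedSubspace_sobolev (l := l) 4).exists_factor
    ((truncL l).prod (opAL l)) hC Λ
  exact ⟨Θ, fun U hU => (hΛ U hU).trans (hΘ U hU)⟩

/-- The second derivative at the outer endpoint of the edge `j + 1`, as a functional on the graph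
of the operator. -/
def secondTrace (hl : ∀ j, 0 < l j) (j : Fin n) : Jet l 2 × L2G l →L[ℂ] ℂ :=
  (exists_secondTrace hl j).choose

theorem secondTrace_spec (hl : ∀ j, 0 < l j) (j : Fin n) {U : Jet l 4} (hU : U ∈ sobolev l 4) :
    bd U 2 j.succ (outer l j.succ) = secondTrace hl j (truncL l U, opA U) :=
  (exists_secondTrace hl j).choose_spec U hU

theorem mem_graphOn_domObs (hl : ∀ j, 0 < l j) {p : Jet l 2 × L2G l} :
    p ∈ graphOn (domObs l α) ↔ p ∈ graphOn (domA l α) ∧ ∀ j, secondTrace hl j p = 0 := by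
  constructor
  · rintro ⟨U, hU, rfl⟩
    exact ⟨⟨U, hU.1, rfl⟩, fun j => (secondTrace_spec hl j hU.1.1).symm.trans (hU.2 j)⟩
  · rintro ⟨⟨U, hU, rfl⟩, h⟩
    exact ⟨U, ⟨hU, fun j => (secondTrace_spec hl j hU.1).trans (h j)⟩, rfl⟩

/-! ### Observability and hidden regularity for regular solutions -/

theorem IsRegular.continuous {c d : ℝ} {V W : ℝ → Jet l 2} (h : IsRegular l α c d V W) :
    Continuous V := continuous_iff_continuousAt.2 fun t => (h.deriv t).continuousAt

theorem IsRegular.continuous_trace (hl : ∀ j, 0 < l j) (j : Fin n) {c d : ℝ} {V W : ℝ → Jet l 2}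
    (h : IsRegular l α c d V W) : Continuous fun t => secondTrace hl j (V t, W t 0) :=
  (secondTrace hl j).continuous.comp
    (h.continuous.prodMk ((jetL l 0).continuous.comp h.cont))

theorem IsRegular.hasDerivAt_component {c d : ℝ} {V W : ℝ → Jet l 2} (h : IsRegular l α c d V W)
    (k : Fin 3) (t : ℝ) : HasDerivAt (fun t => V t k) (W t k) t :=
  ((jetL l k).restrictScalars ℝ).hasFDerivAt.comp_hasDerivAt t (h.deriv t)

theorem continuous_component {V : ℝ → Jet l 2} (h : Continuous V) (k : Fin 3) :
    Continuous fun t => V t k := (jetL l k).continuous.comp h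

theorem IsRegular.integral_form {c d : ℝ} {V W : ℝ → Jet l 2} (h : IsRegular l α c d V W)
    (Ψ : Form l) :
    Continuous (fun t => Ψ (W t 0) (V t 1) + Ψ (V t 0) (W t 1)) ∧
    ∫ t in c..d, (Ψ (W t 0) (V t 1) + Ψ (V t 0) (W t 1)) = Ψ (V d 0) (V d 1) - Ψ (V c 0) (V c 1) := by
  have hV := fun k => continuous_component h.continuous k
  have hW := fun k => continuous_component h.cont k
  have hc : Continuous (fun t => Ψ (W t 0) (V t 1) + Ψ (V t 0) (W t 1)) :=
    ((Ψ.continuous.comp (hW 0)).clm_apply (hV 1)).add ((Ψ.continuous.comp (hV 0)).clm_apply (hW 1))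
  refine ⟨hc, intervalIntegral.integral_eq_sub_of_hasDerivAt (f := fun t => Ψ (V t 0) (V t 1))
    (fun t _ => ?_) (hc.intervalIntegrable _ _)⟩
  exact (Ψ.hasFDerivAt.comp_hasDerivAt t (h.hasDerivAt_component 0 t)).clm_apply
    (h.hasDerivAt_component 1 t)

theorem IsRegular.abs_form_le (hl : ∀ j, 0 < l j) (hα : ∀ j, 0 < α j) {c d : ℝ}
    {V W : ℝ → Jet l 2} (h : IsRegular l α c d V W) (Ψ : Form l) {t : ℝ} (ht : t ∈ Icc c d) :
    |Ψ (V t 0) (V t 1)| ≤ ‖Ψ‖ * (‖V c‖ * ‖V c 0‖) := by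
  rw [← h.norm_eq hl hα ht, ← h.norm_zero_eq hl hα ht]
  refine (Ψ.le_opNorm₂ _ _).trans ?_
  rw [mul_assoc, mul_comm ‖V t‖]
  gcongr
  exact PiLp.norm_apply_le (V t) 1

/-- Hidden regularity. -/
theorem exists_hidden (hl : ∀ j, 0 < l j) (hα : ∀ j, 0 < α j) (j : Fin n) :
    ∃ C : ℝ, 0 ≤ C ∧ ∀ (c d : ℝ) (V W : ℝ → Jet l 2), c ≤ d → IsRegular l α c d V W →
      ∫ t in c..d, ‖secondTrace hl j (V t, W t 0)‖ ^ 2 ≤ C * (1 + (d - c)) * ‖V c‖ ^ 2 := by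
  obtain ⟨Ψ, C, hC, H⟩ := exists_hidden_form (α := α) hl j
  refine ⟨C + 2 * ‖Ψ‖, by positivity, fun c d V W hcd h => ?_⟩
  obtain ⟨hc, hi⟩ := h.integral_form Ψ
  have hθ : Continuous fun t => ‖secondTrace hl j (V t, W t 0)‖ ^ 2 :=
    (h.continuous_trace hl j).norm.pow 2
  have hr : Continuous fun t => C * ‖V c‖ ^ 2 - (Ψ (W t 0) (V t 1) + Ψ (V t 0) (W t 1)) :=
    continuous_const.sub hc
  have step : ∫ t in c..d, ‖secondTrace hl j (V t, W t 0)‖ ^ 2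
      ≤ ∫ t in c..d, (C * ‖V c‖ ^ 2 - (Ψ (W t 0) (V t 1) + Ψ (V t 0) (W t 1))) := by
    apply intervalIntegral.integral_mono_on hcd (hθ.intervalIntegrable _ _)
      (hr.intervalIntegrable _ _)
    intro t ht
    obtain ⟨U, hU, e, e'⟩ := h.exists_mem ht
    have := H U hU (W t) (h.energy t ht) e'
    rw [secondTrace_spec hl j hU.1, e, ← e', h.norm_eq hl hα ht] at this
    rw [← e] at this ⊢
    exact this
  rw [intervalIntegral.integral_sub (continuous_const.intervalIntegrable _ _)
    (hc.intervalIntegrable _ _), hi, intervalIntegral.integral_const, smul_eq_mul] at step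
  have b1 := (abs_le.1 (h.abs_form_le hl hα Ψ (right_mem_Icc.2 hcd))).1
  have b2 := (abs_le.1 (h.abs_form_le hl hα Ψ (left_mem_Icc.2 hcd))).2
  have b3 : ‖V c 0‖ ≤ ‖V c‖ := PiLp.norm_apply_le (V c) 0
  have b4 : ‖Ψ‖ * (‖V c‖ * ‖V c 0‖) ≤ ‖Ψ‖ * ‖V c‖ ^ 2 := by
    rw [sq]; gcongr
  have b5 : 0 ≤ (d - c) * (2 * ‖Ψ‖ * ‖V c‖ ^ 2) := mul_nonneg (by linarith) (by positivity)
  have b6 : 0 ≤ C * ‖V c‖ ^ 2 := by positivity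
  linarith

/-- The observability inequality up to a lower order term. -/
theorem exists_observability (hl : ∀ j, 0 < l j) {s : ℝ} (hs : 0 < s) (hsn : s ^ 2 = n)
    (hα : ∀ j, α j = s) :
    ∃ C : ℝ, 0 ≤ C ∧ ∀ (c d : ℝ) (V W : ℝ → Jet l 2), c ≤ d → IsRegular l α c d V W →
      (d - c) * ‖V c‖ ^ 2 ≤ C * (‖V c‖ * ‖V c 0‖
        + (∑ j, ∫ t in c..d, ‖secondTrace hl j (V t, W t 0)‖ ^ 2) + (d - c) * ‖V c 0‖ ^ 2) := by
  have hα0 : ∀ j, 0 < α j := fun j => by rw [hα j]; exact hs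
  obtain ⟨Ψ, C, hC, H⟩ := exists_observability_form hl hs hsn hα
  refine ⟨C + 2 * ‖Ψ‖, by positivity, fun c d V W hcd h => ?_⟩
  obtain ⟨hc, hi⟩ := h.integral_form Ψ
  have hθ : ∀ j, Continuous fun t => ‖secondTrace hl j (V t, W t 0)‖ ^ 2 := fun j =>
    (h.continuous_trace hl j).norm.pow 2
  have hθs : Continuous fun t => ∑ j, ‖secondTrace hl j (V t, W t 0)‖ ^ 2 :=
    continuous_finsetSum _ fun j _ => hθ j
  have hr : Continuous fun t => C * (∑ j, ‖secondTrace hl j (V t, W t 0)‖ ^ 2 + ‖V c 0‖ ^ 2) :=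
    (hθs.add continuous_const).const_mul C
  have hr' : Continuous fun t => Ψ (W t 0) (V t 1) + Ψ (V t 0) (W t 1)
      + C * (∑ j, ‖secondTrace hl j (V t, W t 0)‖ ^ 2 + ‖V c 0‖ ^ 2) := hc.add hr
  have step : ∫ _t in c..d, ‖V c‖ ^ 2 ≤ ∫ t in c..d, ((Ψ (W t 0) (V t 1) + Ψ (V t 0) (W t 1))
        + C * (∑ j, ‖secondTrace hl j (V t, W t 0)‖ ^ 2 + ‖V c 0‖ ^ 2)) := by
    apply intervalIntegral.integral_mono_on hcd (continuous_const.intervalIntegrable _ _)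
      (hr'.intervalIntegrable _ _)
    intro t ht
    obtain ⟨U, hU, e, e'⟩ := h.exists_mem ht
    have := H U hU (W t) (h.energy t ht) e'
    simp only [secondTrace_spec hl _ hU.1, ← e'] at this
    rw [← h.norm_eq hl hα0 ht, ← h.norm_zero_eq hl hα0 ht]
    rw [← e]
    exact this
  rw [intervalIntegral.integral_add (hc.intervalIntegrable _ _)
    (hr.intervalIntegrable _ _), hi,
    intervalIntegral.integral_const, intervalIntegral.integral_const_mul,
    intervalIntegral.integral_add (hθs.intervalIntegrable _ _)
    (continuous_const.intervalIntegrable _ _), intervalIntegral.integral_const,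
    intervalIntegral.integral_finsetSum fun j _ => (hθ j).intervalIntegrable _ _,
    smul_eq_mul, smul_eq_mul] at step
  have b1 := (abs_le.1 (h.abs_form_le hl hα0 Ψ (right_mem_Icc.2 hcd))).2
  have b2 := (abs_le.1 (h.abs_form_le hl hα0 Ψ (left_mem_Icc.2 hcd))).1
  have b3 : 0 ≤ C * (‖V c‖ * ‖V c 0‖) := by positivity
  have b4 : 0 ≤ ‖Ψ‖ * ∑ j, ∫ t in c..d, ‖secondTrace hl j (V t, W t 0)‖ ^ 2 :=
    mul_nonneg (by positivity) (Finset.sum_nonneg fun j _ =>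
      intervalIntegral.integral_nonneg hcd fun t _ => sq_nonneg _)
  have b5 : 0 ≤ ‖Ψ‖ * ((d - c) * ‖V c 0‖ ^ 2) :=
    mul_nonneg (by positivity) (mul_nonneg (by linarith) (sq_nonneg _))
  linarith

/-! ### The second trace of a mild solution -/

theorem L2I.exists_of_continuous (c d : ℝ) {f : ℝ → ℂ} (hf : Continuous f) :
    ∃ γ : L2I c d, γ =ᵐ[volume.restrict (Ioo c d)] f := by
  obtain ⟨C, hC⟩ := (isCompact_Icc (a := c) (b := d)).exists_bound_of_continuousOn hf.continuousOn
  have hm : MemLp f 2 (volume.restrict (Ioo c d)) := by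
    apply MemLp.of_bound hf.aestronglyMeasurable C
    filter_upwards [ae_restrict_mem measurableSet_Ioo] with x hx
    exact hC x (Ioo_subset_Icc_self hx)
  exact ⟨hm.toLp f, hm.coeFn_toLp⟩

theorem L2I.intervalIntegral_congr {c d : ℝ} {f g : ℝ → ℂ}
    (h : f =ᵐ[volume.restrict (Ioo c d)] g) {x y : ℝ} (hx : x ∈ Icc c d) (hy : y ∈ Icc c d) :
    ∫ t in x..y, f t = ∫ t in x..y, g t := by
  have h1 : f =ᵐ[volume.restrict (Icc c d)] g := by
    rwa [restrict_Ioo_eq_restrict_Icc] at h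
  apply intervalIntegral.integral_congr_ae_restrict
  refine ae_restrict_of_ae_restrict_of_subset ?_ h1
  exact uIoc_subset_uIcc.trans (uIcc_subset_Icc hx hy)

theorem L2I.eq_of_integral_eq {c d : ℝ} (hcd : c ≤ d) {f g : L2I c d}
    (h : ∀ t ∈ Icc c d, ∫ s in c..t, f s = ∫ s in c..t, g s) : f = g := by
  have hc : c ∈ Icc c d := left_mem_Icc.2 hcd
  have hd : d ∈ Icc c d := right_mem_Icc.2 hcd
  have hf := L2I.intervalIntegrable f hc hd
  have hg := L2I.intervalIntegrable g hc hd
  apply Lp.ext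
  rw [Filter.EventuallyEq, ae_restrict_iff' measurableSet_Ioo]
  filter_upwards [hf.ae_hasDerivAt_integral, hg.ae_hasDerivAt_integral] with x h1 h2 hx
  have hx' : x ∈ uIcc c d := by rw [uIcc_of_le hcd]; exact Ioo_subset_Icc_self hx
  refine (h1 hx' c (by simp)).unique ((h2 hx' c (by simp)).congr_of_eventuallyEq ?_)
  filter_upwards [Ioo_mem_nhds hx.1 hx.2] with t ht
  exact h t (Ioo_subset_Icc_self ht)

/-- `γ` is the second trace of `v` on `(c, d)`. -/
def HasSecondTrace (hl : ∀ j, 0 < l j) (c d : ℝ) (v : ℝ → Jet l 2) (γ : Fin n → L2I c d) : Prop :=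
  ∀ j, ∀ t ∈ Icc c d, secondTrace hl j (∫ r in c..t, v r, v t 0 - v c 0) = ∫ s in c..t, γ j s

theorem HasSecondTrace.unique {hl : ∀ j, 0 < l j} {c d : ℝ} (hcd : c ≤ d) {v : ℝ → Jet l 2}
    {γ γ' : Fin n → L2I c d} (h : HasSecondTrace hl c d v γ) (h' : HasSecondTrace hl c d v γ') :
    γ = γ' :=
  funext fun j => L2I.eq_of_integral_eq hcd fun t ht => (h j t ht).symm.trans (h' j t ht)

theorem continuous_secondTrace_primitive (hl : ∀ j, 0 < l j) (j : Fin n) {v : ℝ → Jet l 2}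
    (hv : Continuous v) (c : ℝ) :
    Continuous fun t => secondTrace hl j (∫ r in c..t, v r, v t 0 - v c 0) :=
  (secondTrace hl j).continuous.comp
    ((intervalIntegral.continuous_primitive (fun _ _ => hv.intervalIntegrable _ _) c).prodMk
      ((continuous_component hv 0).sub continuous_const))

/-- The trace of a time average is a difference quotient of the primitive of the trace, so that
limits as `h` tends to `0` can be identified. -/
theorem secondTrace_average (hl : ∀ j, 0 < l j) (j : Fin n) {v : ℝ → Jet l 2}
    (hv : Continuous v) (c t h : ℝ) :
    secondTrace hl j ((h : ℂ)⁻¹ • ∫ r in t..t + h, v r, ((h : ℂ)⁻¹ • (v (t + h) - v t)) 0)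
      = (h : ℂ)⁻¹ * (secondTrace hl j (∫ r in c..t + h, v r, v (t + h) 0 - v c 0)
        - secondTrace hl j (∫ r in c..t, v r, v t 0 - v c 0)) := by
  rw [← map_sub, ← smul_eq_mul, ← map_smul, Prod.mk_sub_mk,
    intervalIntegral.integral_interval_sub_left (hv.intervalIntegrable _ _)
      (hv.intervalIntegrable _ _), Prod.smul_mk, sub_sub_sub_cancel_right]
  rfl

/-- The estimate for regular solutions passes to the limit along time averages with steps `h k`. The
steps are left free in sign so that the statement serves both ends of the time interval. -/
theorem exists_mild_observability (hl : ∀ j, 0 < l j) {s : ℝ} (hs : 0 < s) (hsn : s ^ 2 = n)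
    (hα : ∀ j, α j = s) :
    ∃ C : ℝ, 0 ≤ C ∧ ∀ (a b c d : ℝ) (v : ℝ → Jet l 2) (h : ℕ → ℝ), a < b → c < d →
      IsMild (domA l α) a b v → (∀ k, h k ≠ 0) → Tendsto h atTop (𝓝 0) →
      (∀ k, ∀ t ∈ Icc c d, t ∈ Icc a b ∧ t + h k ∈ Icc a b) →
      ∃ γ : Fin n → L2I c d, HasSecondTrace hl c d v γ ∧
        (d - c) * ‖v c‖ ^ 2 ≤ C * (‖v c‖ * ‖v c 0‖ + ∑ j, ‖γ j‖ ^ 2 + (d - c) * ‖v c 0‖ ^ 2) := by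
  have hα0 : ∀ j, 0 < α j := fun j => by rw [hα j]; exact hs
  obtain ⟨C, hC, HC⟩ := exists_observability hl hs hsn hα
  choose K hK HK using fun j => exists_hidden hl hα0 j
  refine ⟨C, hC, fun a b c d v h hab hcd H h0 hlim hh => ?_⟩
  have hcm : c ∈ Icc c d := left_mem_Icc.2 hcd.le
  let V : ℕ → ℝ → Jet l 2 := fun k t => (h k : ℂ)⁻¹ • ∫ r in t..t + h k, v r
  let W : ℕ → ℝ → Jet l 2 := fun k t => (h k : ℂ)⁻¹ • (v (t + h k) - v t)
  have R : ∀ k, IsRegular l α c d (V k) (W k) := fun k => H.regular_average hl hab (hh k)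
  have hV : Tendsto (fun k => V k c) atTop (𝓝 (v c)) := tendsto_average H.cont c h0 hlim
  have hθ : ∀ j k, Continuous fun t => secondTrace hl j (V k t, W k t 0) := fun j k =>
    (R k).continuous_trace hl j
  choose g hg using fun j k => L2I.exists_of_continuous c d (hθ j k)
  -- Hidden regularity, applied to the difference of two averages, bounds the distance of their
  -- traces by the distance of their values at time `c`.
  have hdist : ∀ j k m, ‖g j k - g j m‖ ^ 2 ≤ K j * (1 + (d - c)) * ‖V k c - V m c‖ ^ 2 := by
    intro j k m
    have e : (g j k - g j m : L2I c d) =ᵐ[volume.restrict (Ioo c d)]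
        fun t => secondTrace hl j (V k t - V m t, (W k t - W m t) 0) := by
      filter_upwards [Lp.coeFn_sub (g j k) (g j m), hg j k, hg j m] with t h1 h2 h3
      rw [h1, Pi.sub_apply, h2, h3, ← map_sub]
      rfl
    rw [L2I.norm_sq_eq hcd.le _ e]
    exact HK j c d _ _ hcd.le ((R k).sub hl (R m))
  have hcauchy : ∀ j, CauchySeq (g j) := by
    intro j
    have hVc := hV.cauchySeq
    rw [Metric.cauchySeq_iff] at hVc ⊢
    intro ε hε
    set M := K j * (1 + (d - c)) with hM
    have hM0 : 0 ≤ M := mul_nonneg (hK j) (by linarith)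
    obtain ⟨N, hN⟩ := hVc (ε / (√M + 1)) (by positivity)
    refine ⟨N, fun k hk m hm => ?_⟩
    have h1 := hN k hk m hm
    rw [dist_eq_norm] at h1 ⊢
    have h2 : ‖g j k - g j m‖ ≤ √M * ‖V k c - V m c‖ := by
      apply le_of_sq_le_sq _ (by positivity)
      rw [mul_pow, Real.sq_sqrt hM0]
      exact hdist j k m
    rw [lt_div_iff₀ (by positivity)] at h1
    nlinarith [norm_nonneg (V k c - V m c)]
  choose γ hγ using fun j => cauchySeq_tendsto_of_complete (hcauchy j)
  refine ⟨γ, fun j t ht => ?_, ?_⟩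
  · obtain ⟨Λ, hΛ, -⟩ := L2I.exists_integral (a := c) (b := d) le_rfl ht.1 ht.2
    have l1 := (Λ.continuous.tendsto _).comp (hγ j)
    rw [hΛ] at l1
    refine tendsto_nhds_unique ?_ l1
    -- The integral over `[c, t]` of a difference quotient of `Γ` is the mean of `Γ` near `t` minus
    -- its mean near `c`. It tends to `Γ t - Γ c = Γ t`, while the integrals of the traces tend to
    -- that of their `L²` limit.
    set Γ : ℝ → ℂ := fun t => secondTrace hl j (∫ r in c..t, v r, v t 0 - v c 0) with hΓ
    have cΓ : Continuous Γ := continuous_secondTrace_primitive hl j H.cont c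
    have Γc : Γ c = 0 := by
      simp only [hΓ, intervalIntegral.integral_same, sub_self]
      exact map_zero _
    have l2 := (tendsto_average cΓ t h0 hlim).sub (tendsto_average cΓ c h0 hlim)
    rw [Γc, sub_zero] at l2
    refine l2.congr fun k => ?_
    rw [Function.comp_apply, hΛ, L2I.intervalIntegral_congr (hg j k) hcm ht]
    have e : ∀ t, secondTrace hl j (V k t, W k t 0) = (h k : ℂ)⁻¹ * (Γ (t + h k) - Γ t) :=
      fun t => secondTrace_average hl j H.cont c t (h k)
    simp only [e]
    have i : ∀ x y, IntervalIntegrable Γ volume x y := fun x y => cΓ.intervalIntegrable x y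
    have i' : IntervalIntegrable (fun t => Γ (t + h k)) volume c t :=
      (cΓ.comp (continuous_id.add continuous_const)).intervalIntegrable _ _
    rw [intervalIntegral.integral_const_mul, intervalIntegral.integral_sub i' (i _ _),
      intervalIntegral.integral_comp_add_right Γ (h k), smul_eq_mul, smul_eq_mul, ← mul_sub]
    have i1 := intervalIntegral.integral_add_adjacent_intervals (i c t) (i t (t + h k))
    have i2 := intervalIntegral.integral_add_adjacent_intervals (i c (c + h k))
      (i (c + h k) (t + h k))
    congr 1
    linear_combination i1 - i2
  · have lc := hV.norm
    have lc0 := (((jetL l 0).continuous.tendsto _).comp hV).norm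
    have lγ := tendsto_finsetSum Finset.univ fun j (_ : j ∈ Finset.univ) => ((hγ j).norm.pow 2)
    refine le_of_tendsto_of_tendsto' ((lc.pow 2).const_mul (d - c))
      ((((lc.mul lc0).add lγ).add ((lc0.pow 2).const_mul (d - c))).const_mul C) fun k => ?_
    have := HC c d _ _ hcd.le (R k)
    simp only [← L2I.norm_sq_eq hcd.le _ (hg _ k)] at this
    exact this

/-! ### From adjoint solutions to mild solutions -/

/-- Increments from `s` to `t` are differences of increments from `T`, and the graph of `A` is a
linear subspace. Extending `v` by constants outside `[0, T]` makes it continuous on the whole line.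
-/
theorem IsAdjointSolution.isMild (hl : ∀ j, 0 < l j) {T : ℝ} (hT : 0 ≤ T) {vT : Jet l 2}
    {v : ℝ → Jet l 2} (h : IsAdjointSolution l α T vT v) :
    IsMild (domA l α) 0 T (fun t => v (projIcc 0 T hT t)) := by
  have hc : Continuous fun t => v (projIcc 0 T hT t) :=
    h.cont.comp_continuous (continuous_subtype_val.comp continuous_projIcc)
      fun t => (projIcc 0 T hT t).2
  have hp : ∀ t ∈ Icc 0 T, v (projIcc 0 T hT t) = v t := fun t ht => by rw [projIcc_of_mem hT ht]
  have hTm : T ∈ Icc 0 T := right_mem_Icc.2 hT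
  have hG := isClosedSubspace_graphOn hl (isClosedSubspace_domA (α := α) hl) fun _ h => h.1
  have key : ∀ t ∈ Icc 0 T, (∫ r in T..t, v (projIcc 0 T hT r), v t 0 - v T 0)
      ∈ graphOn (domA l α) := by
    intro t ht
    obtain ⟨U, hU, e0, e1⟩ := h.mild t ht
    refine ⟨U, hU, Prod.ext ?_ ?_⟩
    -- The hypothesis identifies only the lowest component of the integral; the weak derivatives
    -- then agree because the integral of jets is again a jet.
    · refine sobolev_ext hl (truncL_mem_sobolev hU.1) ?_ ?_
      · exact (isClosedSubspace_sobolev 2).integral_mem hc fun s _ =>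
          (h.mem _ (projIcc 0 T hT s).2).1
      · change U 0 = jetL l 0 (∫ r in T..t, v (projIcc 0 T hT r))
        rw [e0, ← (jetL l 0).intervalIntegral_comp_comm (hc.intervalIntegrable _ _)]
        apply intervalIntegral.integral_congr
        intro s hs
        have := uIcc_subset_Icc hTm ht hs
        simp only [hp s this, jetL_apply]
    · change opA U = v t 0 - v T 0
      rw [e1, add_sub_cancel_left]
  refine ⟨hc, fun s hs t ht => ?_⟩
  have := hG.sub_mem (key t ht) (key s hs)
  rw [Prod.mk_sub_mk, intervalIntegral.integral_interval_sub_left (hc.intervalIntegrable _ _)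
    (hc.intervalIntegrable _ _), sub_sub_sub_cancel_right] at this
  simp only [hp s hs, hp t ht]
  exact this

theorem secondTrace_add (hl : ∀ j, 0 < l j) (j : Fin n) {v : ℝ → Jet l 2} (hv : Continuous v)
    (r s t : ℝ) : secondTrace hl j (∫ x in r..s, v x, v s 0 - v r 0)
      + secondTrace hl j (∫ x in s..t, v x, v t 0 - v s 0)
      = secondTrace hl j (∫ x in r..t, v x, v t 0 - v r 0) := by
  rw [← map_add, Prod.mk_add_mk, intervalIntegral.integral_add_adjacent_intervals
    (hv.intervalIntegrable _ _) (hv.intervalIntegrable _ _), sub_add_sub_cancel']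

theorem exists_shrinking_sequence {δ : ℝ} (hδ : 0 < δ) :
    ∃ h : ℕ → ℝ, (∀ k, 0 < h k) ∧ (∀ k, h k ≤ δ) ∧ Tendsto h atTop (𝓝 0) := by
  refine ⟨fun k => δ * (1 / ((k : ℝ) + 1)), fun k => by positivity, fun k => ?_, ?_⟩
  · have : 1 / ((k : ℝ) + 1) ≤ 1 := by
      rw [div_le_one (by positivity)]; linarith [Nat.cast_nonneg (α := ℝ) k]
    nlinarith
  · have := (tendsto_one_div_add_atTop_nhds_zero_nat (𝕜 := ℝ)).const_mul δ
    rwa [mul_zero] at this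

/-- Existence of the second traces of a mild solution. -/
theorem IsMild.exists_trace (hl : ∀ j, 0 < l j) {s : ℝ} (hs : 0 < s) (hsn : s ^ 2 = n)
    (hα : ∀ j, α j = s) {T : ℝ} (hT : 0 < T) {v : ℝ → Jet l 2} (H : IsMild (domA l α) 0 T v) :
    ∃ (γ : Fin n → L2I 0 (T / 2)) (g : Fin n → ℝ → ℂ), HasSecondTrace hl 0 (T / 2) v γ ∧
      ∀ j, MemLp (g j) 2 (volume.restrict (Ioo 0 T)) ∧
        (∀ t ∈ Icc 0 T, secondTrace hl j (∫ r in T..t, v r, v t 0 - v T 0) = ∫ r in T..t, g j r) ∧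
        ‖γ j‖ ^ 2 ≤ ∫ t in (0 : ℝ)..T, ‖g j t‖ ^ 2 := by
  obtain ⟨C, -, HC⟩ := exists_mild_observability hl hs hsn hα
  obtain ⟨h, h0, h1, h2⟩ := exists_shrinking_sequence (half_pos hT)
  have hT2 : 0 < T / 2 := half_pos hT
  have hT3 : T / 2 < T := half_lt_self hT
  -- Forward averages stay inside `[0, T]` on the first half of the interval, backward averages on
  -- the second half. The two traces are glued at `T / 2`.
  obtain ⟨γ, hγ, -⟩ := HC 0 T 0 (T / 2) v h hT hT2 H (fun k => (h0 k).ne') h2 fun k t ht =>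
    ⟨⟨ht.1, by linarith [ht.2]⟩, by linarith [h0 k, ht.1], by linarith [h1 k, ht.2]⟩
  obtain ⟨γ', hγ', -⟩ := HC 0 T (T / 2) T v (fun k => -h k) hT hT3 H
    (fun k => neg_ne_zero.2 (h0 k).ne') (by simpa using h2.neg) fun k t ht =>
    ⟨⟨by linarith [ht.1], ht.2⟩, by linarith [h1 k, ht.1], by linarith [h0 k, ht.2]⟩
  let g : Fin n → ℝ → ℂ := fun j => (Iic (T / 2)).piecewise (γ j) (γ' j)
  have gl : ∀ j, g j =ᵐ[volume.restrict (Ioo 0 (T / 2))] γ j := fun j => by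
    filter_upwards [ae_restrict_mem measurableSet_Ioo] with x hx
    exact piecewise_eq_of_mem _ _ _ hx.2.le
  have gr : ∀ j, g j =ᵐ[volume.restrict (Ioo (T / 2) T)] γ' j := fun j => by
    filter_upwards [ae_restrict_mem measurableSet_Ioo] with x hx
    exact piecewise_eq_of_notMem _ _ _ (not_le.2 hx.1)
  have hm : ∀ j, MemLp (g j) 2 (volume.restrict (Ioo 0 T)) := by
    intro j
    apply MemLp.piecewise measurableSet_Iic
    · rw [Measure.restrict_restrict measurableSet_Iic]
      have e : Iic (T / 2) ∩ Ioo 0 T = Ioc 0 (T / 2) := by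
        ext x; simp only [mem_inter_iff, mem_Iic, mem_Ioo, mem_Ioc]
        constructor
        · rintro ⟨a, b, c⟩; exact ⟨b, a⟩
        · rintro ⟨a, b⟩; exact ⟨b, a, by linarith⟩
      rw [e, ← restrict_Ioo_eq_restrict_Ioc]
      exact Lp.memLp (γ j)
    · rw [Measure.restrict_restrict measurableSet_Iic.compl]
      have e : (Iic (T / 2))ᶜ ∩ Ioo 0 T = Ioo (T / 2) T := by
        ext x; simp only [mem_inter_iff, mem_compl_iff, mem_Iic, mem_Ioo, not_le]
        constructor
        · rintro ⟨a, b, c⟩; exact ⟨a, c⟩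
        · rintro ⟨a, b⟩; exact ⟨a, by linarith, b⟩
      rw [e]
      exact Lp.memLp (γ' j)
  have hi : ∀ j, ∀ x ∈ Icc 0 T, ∀ y ∈ Icc 0 T, IntervalIntegrable (g j) volume x y := by
    intro j x hx y hy
    have h : IntegrableOn (g j) (Icc 0 T) volume := by
      rw [integrableOn_Icc_iff_integrableOn_Ioo]
      exact (hm j).integrable one_le_two
    exact (h.mono_set (uIcc_subset_Icc hx hy)).intervalIntegrable
  have z : (0 : ℝ) ∈ Icc 0 T := left_mem_Icc.2 hT.le
  have zT : T ∈ Icc 0 T := right_mem_Icc.2 hT.le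
  have z2 : T / 2 ∈ Icc 0 T := ⟨hT2.le, hT3.le⟩
  have left : ∀ j, ∀ t ∈ Icc 0 (T / 2),
      secondTrace hl j (∫ r in (0 : ℝ)..t, v r, v t 0 - v 0 0) = ∫ r in (0 : ℝ)..t, g j r := by
    intro j t ht
    rw [hγ j t ht, L2I.intervalIntegral_congr (gl j) (left_mem_Icc.2 hT2.le) ht]
  have all : ∀ j, ∀ t ∈ Icc 0 T,
      secondTrace hl j (∫ r in (0 : ℝ)..t, v r, v t 0 - v 0 0) = ∫ r in (0 : ℝ)..t, g j r := by
    intro j t ht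
    rcases le_total t (T / 2) with h | h
    · exact left j t ⟨ht.1, h⟩
    · rw [← secondTrace_add hl j H.cont 0 (T / 2) t, left j _ (right_mem_Icc.2 hT2.le),
        hγ' j t ⟨h, ht.2⟩, ← L2I.intervalIntegral_congr (gr j) (left_mem_Icc.2 hT3.le) ⟨h, ht.2⟩,
        intervalIntegral.integral_add_adjacent_intervals (hi j _ z _ z2) (hi j _ z2 _ ht)]
  refine ⟨γ, g, hγ, fun j => ⟨hm j, fun t ht => ?_, ?_⟩⟩
  · have e1 := secondTrace_add hl j H.cont 0 T t
    rw [all j T zT, all j t ht,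
      ← intervalIntegral.integral_add_adjacent_intervals (hi j _ z _ zT) (hi j _ zT _ ht)] at e1
    exact add_left_cancel e1
  · rw [L2I.norm_sq_eq hT2.le _ (gl j).symm]
    apply intervalIntegral.integral_mono_interval le_rfl hT2.le hT3.le
    · exact Eventually.of_forall fun x => sq_nonneg _
    · have h : IntegrableOn (fun x => ‖g j x‖ ^ 2) (Icc 0 T) volume := by
        rw [integrableOn_Icc_iff_integrableOn_Ioo]
        exact (hm j).norm.integrable_sq
      rw [← uIcc_of_le hT.le] at h
      exact h.intervalIntegrable

/-! ### Estimates up to finitely many functionals -/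

/-- The compactness of `H²` in `L²` in quantitative form: the functionals are values at finitely
many points of each edge. -/
theorem exists_sampling (hl : ∀ j, 0 < l j) {δ : ℝ} (hδ : 0 < δ) :
    ∃ (ι : Type) (_ : Fintype ι) (Λ : ι → (Jet l 2 →L[ℂ] ℂ)) (C : ℝ), 0 ≤ C ∧
      ∀ u ∈ sobolev l 2, ‖u 0‖ ^ 2 ≤ δ * ‖u‖ ^ 2 + C * ∑ i, ‖Λ i u‖ ^ 2 := by
  choose K Λ C hC H using fun j => IsWeakDeriv.exists_sampling (left_lt_right hl j) hδ
  refine ⟨Σ j, Fin (K j), inferInstance,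
    fun i => (Λ i.1 i.2).comp ((compL l 2 0 i.1).prod (compL l 2 1 i.1)), ∑ j, C j,
    Finset.sum_nonneg fun j _ => hC j, fun u hu => ?_⟩
  rw [L2G.norm_sq_eq_sum, Fintype.sum_sigma]
  have h1 : ‖u 1‖ ^ 2 ≤ ‖u‖ ^ 2 := by gcongr; exact PiLp.norm_apply_le u 1
  rw [L2G.norm_sq_eq_sum] at h1
  calc ∑ j, ‖u 0 j‖ ^ 2
      ≤ ∑ j, (δ * ‖u 1 j‖ ^ 2 + (∑ j, C j) * ∑ i, ‖Λ j i (u 0 j, u 1 j)‖ ^ 2) := by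
        apply Finset.sum_le_sum
        intro j _
        refine (H j (u 0 j) (u 1 j) (hu 0 j)).trans ?_
        have : C j ≤ ∑ j, C j := Finset.single_le_sum (fun j _ => hC j) (Finset.mem_univ j)
        gcongr
    _ = δ * ∑ j, ‖u 1 j‖ ^ 2 + (∑ j, C j) * ∑ j, ∑ i, ‖Λ j i (u 0 j, u 1 j)‖ ^ 2 := by
        rw [Finset.sum_add_distrib, Finset.mul_sum, Finset.mul_sum]
    _ ≤ _ := by
        have := mul_le_mul_of_nonneg_left h1 hδ.le
        exact add_le_add this le_rfl

/-- The lower order terms of the observability estimate are absorbed: Young's inequality uses half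
of `d * ‖v 0‖ ^ 2`, and sampling with a small parameter another quarter. -/
theorem exists_finite_observability (hl : ∀ j, 0 < l j) {s : ℝ} (hs : 0 < s) (hsn : s ^ 2 = n)
    (hα : ∀ j, α j = s) {b d : ℝ} (hd : 0 < d) (hdb : d < b) :
    ∃ (ι : Type) (_ : Fintype ι) (Λ : ι → (Jet l 2 →L[ℂ] ℂ)) (C : ℝ), 0 ≤ C ∧
      ∀ v, IsMild (domA l α) 0 b v → ∀ γ : Fin n → L2I 0 d, HasSecondTrace hl 0 d v γ →
        ‖v 0‖ ^ 2 ≤ C * (∑ j, ‖γ j‖ ^ 2 + ∑ i, ‖Λ i (v 0)‖ ^ 2) := by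
  obtain ⟨C₀, hC₀, HC⟩ := exists_mild_observability hl hs hsn hα
  obtain ⟨h, h0, h1, h2⟩ := exists_shrinking_sequence (sub_pos.2 hdb)
  set M := C₀ ^ 2 / (2 * d) + C₀ * d with hM
  have hM0 : 0 ≤ M := by positivity
  -- After Young's inequality the `L²` norm carries the factor `M`, so sampling with `d / (4 * (M +
  -- 1))` costs at most `d / 4` of the full norm.
  obtain ⟨ι, hι, Λ, C₁, hC₁, HΛ⟩ := exists_sampling hl (δ := d / (4 * (M + 1))) (by positivity)
  refine ⟨ι, hι, Λ, 4 / d * (C₀ + M * C₁), by positivity, fun v H γ hγ => ?_⟩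
  obtain ⟨γ', hγ', est⟩ := HC 0 b 0 d v h (hd.trans hdb) hd H (fun k => (h0 k).ne') h2 fun k t ht =>
    ⟨⟨ht.1, by linarith [ht.2]⟩, by linarith [h0 k, ht.1], by linarith [h1 k, ht.2]⟩
  rw [← hγ.unique hd.le hγ'] at est
  have hv := (H.mem_energySpace hl (hd.trans hdb) (left_mem_Icc.2 (hd.trans hdb).le)).1.1
  have sam := HΛ _ hv
  set G := ∑ j, ‖γ j‖ ^ 2
  set P := ∑ i, ‖Λ i (v 0)‖ ^ 2
  have hG0 : 0 ≤ G := Finset.sum_nonneg fun _ _ => sq_nonneg _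
  have hP0 : 0 ≤ P := Finset.sum_nonneg fun _ _ => sq_nonneg _
  have young : C₀ * (‖v 0‖ * ‖v 0 0‖) ≤ d / 2 * ‖v 0‖ ^ 2 + C₀ ^ 2 / (2 * d) * ‖v 0 0‖ ^ 2 := by
    have e : d / 2 * ‖v 0‖ ^ 2 + C₀ ^ 2 / (2 * d) * ‖v 0 0‖ ^ 2 - C₀ * (‖v 0‖ * ‖v 0 0‖)
        = d / 2 * (‖v 0‖ - C₀ / d * ‖v 0 0‖) ^ 2 := by field_simp; ring
    have : 0 ≤ d / 2 * (‖v 0‖ - C₀ / d * ‖v 0 0‖) ^ 2 := by positivity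
    linarith
  have m1 := mul_le_mul_of_nonneg_left sam hM0
  have m2 : M * (d / (4 * (M + 1)) * ‖v 0‖ ^ 2) ≤ d / 4 * ‖v 0‖ ^ 2 := by
    rw [← mul_assoc]
    apply mul_le_mul_of_nonneg_right _ (sq_nonneg _)
    rw [mul_div_assoc', div_le_div_iff₀ (by positivity) (by norm_num)]
    nlinarith
  have m3 : d / 4 * ‖v 0‖ ^ 2 ≤ C₀ * G + M * C₁ * P := by
    rw [hM] at m1 m2 ⊢
    nlinarith
  have m4 : C₀ * G + M * C₁ * P ≤ (C₀ + M * C₁) * (G + P) := by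
    have a1 : 0 ≤ C₀ * P := by positivity
    have a2 : 0 ≤ M * C₁ * G := by positivity
    linarith
  calc ‖v 0‖ ^ 2 = 4 / d * (d / 4 * ‖v 0‖ ^ 2) := by field_simp
    _ ≤ 4 / d * ((C₀ + M * C₁) * (G + P)) := mul_le_mul_of_nonneg_left (m3.trans m4) (by positivity)
    _ = _ := by ring

/-- A bound up to finitely many functionals is a bound if there is no kernel. -/
theorem exists_bound_of_finite_rank {E F ι : Type*} [Fintype ι] [NormedAddCommGroup E]
    [NormedSpace ℂ E] [CompleteSpace E] [NormedAddCommGroup F] [NormedSpace ℂ F] {S : Set E}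
    (hS : IsClosedSubspace S) (B : E →L[ℂ] F) (Λ : E →L[ℂ] (ι → ℂ)) {C : ℝ}
    (h : ∀ x ∈ S, ‖x‖ ≤ C * (‖B x‖ + ‖Λ x‖)) (hB : ∀ x ∈ S, B x = 0 → x = 0) :
    ∃ K : ℝ, 0 < K ∧ ∀ x ∈ S, ‖x‖ ≤ K * ‖B x‖ := by
  by_contra! hcon
  choose x hxS hx using fun k : ℕ => hcon ((k : ℝ) + 1) (by positivity)
  have hx0 : ∀ k, 0 < ‖x k‖ := fun k => lt_of_le_of_lt (by positivity) (hx k)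
  let y : ℕ → E := fun k => ((‖x k‖ : ℂ)⁻¹) • x k
  have hy1 : ∀ k, ‖y k‖ = 1 := fun k => by
    simp only [y, norm_smul, norm_inv, Complex.norm_real, norm_norm]
    exact inv_mul_cancel₀ (hx0 k).ne'
  have hyS : ∀ k, y k ∈ S := fun k => hS.smul_mem _ (hxS k)
  have hyB : Tendsto (fun k => B (y k)) atTop (𝓝 0) := by
    refine squeeze_zero_norm (fun k => ?_) (tendsto_one_div_add_atTop_nhds_zero_nat (𝕜 := ℝ))
    simp only [y, map_smul, norm_smul, norm_inv, Complex.norm_real, norm_norm]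
    rw [inv_mul_le_iff₀ (hx0 k), mul_one_div, le_div_iff₀ (by positivity), mul_comm]
    exact (hx k).le
  -- The functionals take values in a finite dimensional space, so they converge along a
  -- subsequence. With `B` tending to zero, the a priori bound makes that subsequence Cauchy, and
  -- its limit is a unit vector in the kernel of `B`.
  obtain ⟨z, -, φ, hφ, hz⟩ := tendsto_subseq_of_bounded
    (Metric.isBounded_closedBall (x := (0 : ι → ℂ)) (r := ‖Λ‖)) (x := fun k => Λ (y k)) (fun k => by
      rw [mem_closedBall_zero_iff]
      simpa [hy1 k] using Λ.le_opNorm (y k))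
  have hBφ : Tendsto (fun k => B (y (φ k))) atTop (𝓝 0) := hyB.comp hφ.tendsto_atTop
  have hcauchy : CauchySeq fun k => y (φ k) := by
    have c1 := hBφ.cauchySeq
    have c2 : CauchySeq fun k => Λ (y (φ k)) := hz.cauchySeq
    rw [Metric.cauchySeq_iff] at c1 c2 ⊢
    intro ε hε
    have hη : 0 < ε / (2 * (|C| + 1)) := by positivity
    obtain ⟨N₁, h₁⟩ := c1 _ hη
    obtain ⟨N₂, h₂⟩ := c2 _ hη
    refine ⟨max N₁ N₂, fun i hi j hj => ?_⟩
    have a1 := h₁ i (le_of_max_le_left hi) j (le_of_max_le_left hj)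
    have a2 := h₂ i (le_of_max_le_right hi) j (le_of_max_le_right hj)
    rw [dist_eq_norm, ← map_sub] at a1 a2
    rw [dist_eq_norm]
    have a3 := h _ (hS.sub_mem (hyS (φ i)) (hyS (φ j)))
    have a4 : ‖B (y (φ i) - y (φ j))‖ + ‖Λ (y (φ i) - y (φ j))‖ < ε / (|C| + 1) := by
      have : ε / (|C| + 1) = ε / (2 * (|C| + 1)) + ε / (2 * (|C| + 1)) := by field_simp; ring
      linarith
    rw [lt_div_iff₀ (by positivity)] at a4
    have a5 : 0 ≤ ‖B (y (φ i) - y (φ j))‖ + ‖Λ (y (φ i) - y (φ j))‖ := by positivity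
    nlinarith [le_abs_self C, abs_nonneg C]
  obtain ⟨w, hw⟩ := cauchySeq_tendsto_of_complete hcauchy
  have hwS : w ∈ S := hS.isClosed.mem_of_tendsto hw (Eventually.of_forall fun k => hyS _)
  have hwB : B w = 0 := tendsto_nhds_unique ((B.continuous.tendsto w).comp hw) hBφ
  have hw1 : ‖w‖ = 1 := tendsto_nhds_unique hw.norm (by simp [hy1])
  rw [hB w hwS hwB, norm_zero] at hw1
  exact zero_ne_one hw1

/-! ### Invisible solutions and eigenfunctions -/

theorem isClosedSubspace_graphOn_domObs (hl : ∀ j, 0 < l j) :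
    IsClosedSubspace (graphOn (domObs l α)) :=
  isClosedSubspace_graphOn hl (isClosedSubspace_domObs hl) fun _ h => h.1.1

/-- Uniqueness forward in time follows from conservation of the norm of the difference. -/
theorem IsMild.eq_of_eq (hl : ∀ j, 0 < l j) (hα : ∀ j, 0 < α j) {a b : ℝ} {v w : ℝ → Jet l 2}
    (H : IsMild (domObs l α) a b v) (H' : IsMild (domObs l α) a b w) (h : v a = w a) {t : ℝ}
    (ht : t ∈ Icc a b) : v t = w t := by
  have := ((H.sub (isClosedSubspace_graphOn_domObs hl) H').mono domObs_subset).norm_eq hl hα ht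
  rw [h, sub_self, norm_zero, norm_eq_zero, sub_eq_zero] at this
  exact this

/-- The initial values of the mild solutions on `[0, τ]` with vanishing second traces. -/
def invisible (hl : ∀ j, 0 < l j) (α : Fin n → ℝ) (τ : ℝ) : Submodule ℂ (Jet l 2) where
  carrier := {x | ∃ v, IsMild (domObs l α) 0 τ v ∧ v 0 = x}
  zero_mem' := ⟨fun _ => 0, ⟨continuous_const, fun s _ t _ => by
    rw [intervalIntegral.integral_zero, sub_self]
    exact (isClosedSubspace_graphOn_domObs hl).zero_mem⟩, rfl⟩
  add_mem' := by
    rintro _ _ ⟨v, hv, rfl⟩ ⟨w, hw, rfl⟩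
    exact ⟨_, hv.add (isClosedSubspace_graphOn_domObs hl) hw, rfl⟩
  smul_mem' := by
    rintro c _ ⟨v, hv, rfl⟩
    exact ⟨_, hv.smul (isClosedSubspace_graphOn_domObs hl) c, rfl⟩

theorem mem_invisible {hl : ∀ j, 0 < l j} {τ : ℝ} {x : Jet l 2} :
    x ∈ invisible hl α τ ↔ ∃ v, IsMild (domObs l α) 0 τ v ∧ v 0 = x := Iff.rfl

theorem invisible_anti (hl : ∀ j, 0 < l j) {τ τ' : ℝ} (h : τ ≤ τ') :
    invisible hl α τ' ≤ invisible hl α τ := by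
  rintro _ ⟨v, hv, rfl⟩
  exact ⟨v, hv.restrict (Icc_subset_Icc_right h), rfl⟩

/-- When the traces vanish, the estimate shows that finitely many functionals determine the initial
value. -/
theorem finiteDimensional_invisible (hl : ∀ j, 0 < l j) {s : ℝ} (hs : 0 < s) (hsn : s ^ 2 = n)
    (hα : ∀ j, α j = s) {τ : ℝ} (hτ : 0 < τ) : FiniteDimensional ℂ (invisible hl α τ) := by
  obtain ⟨ι, _, Λ, C, -, H⟩ :=
    exists_finite_observability (α := α) hl hs hsn hα (half_pos hτ) (half_lt_self hτ)
  let f : invisible hl α τ →ₗ[ℂ] (ι → ℂ) :=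
    (ContinuousLinearMap.pi Λ).toLinearMap ∘ₗ (invisible hl α τ).subtype
  apply FiniteDimensional.of_injective f
  rw [injective_iff_map_eq_zero]
  rintro ⟨x, v, hv, rfl⟩ hx
  have h0 : ∀ i, Λ i (v 0) = 0 := fun i => congrFun hx i
  have := H v (hv.mono domObs_subset) 0 fun j t ht => by
    have hm := hv.mem 0 (left_mem_Icc.2 hτ.le) t ⟨ht.1, by linarith [ht.2]⟩
    rw [((mem_graphOn_domObs hl).1 hm).2 j]
    rw [Pi.zero_apply, L2I.intervalIntegral_congr (Lp.coeFn_zero _ _ _)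
      (left_mem_Icc.2 (half_pos hτ).le) ht]
    simp
  simp only [h0, Pi.zero_apply, norm_zero, ne_eq, OfNat.ofNat_ne_zero, not_false_eq_true, zero_pow,
    Finset.sum_const_zero, add_zero, mul_zero] at this
  have : ‖v 0‖ = 0 := by
    have h2 := sq_nonneg ‖v 0‖
    exact pow_eq_zero_iff (two_ne_zero) |>.1 (le_antisymm this h2)
  exact Subtype.ext (norm_eq_zero.1 this)

theorem hasDerivAt_cexp_mul (c : ℂ) (t : ℝ) :
    HasDerivAt (fun t : ℝ => Complex.exp (c * t)) (c * Complex.exp (c * t)) t := by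
  have h1 : HasDerivAt (fun t : ℝ => c * (t : ℂ)) c t := by
    simpa using (Complex.ofRealCLM.hasDerivAt (x := t)).const_mul c
  simpa [mul_comm] using h1.cexp

/-- Integrating a solution that is periodic up to a phase against an exponential yields an
eigenfunction. -/
theorem IsMild.integral_exp_mem {S : Set (Jet l 4)} (hS : IsClosedSubspace (graphOn S)) {τ h : ℝ}
    (hh : 0 ≤ h) (hτ : h ≤ τ) {v : ℝ → Jet l 2} (H : IsMild S 0 τ v) {μ c : ℂ}
    (hμ : v h = μ • v 0) (hc : Complex.exp (-c * h) * μ = 1) :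
    (∫ s in (0 : ℝ)..h, Complex.exp (-c * s) • v s,
      c • ∫ s in (0 : ℝ)..h, Complex.exp (-c * s) • v s 0) ∈ graphOn S := by
  let e : ℝ → ℂ := fun s => Complex.exp (-c * s)
  have he : Continuous e := by fun_prop
  have z : (0 : ℝ) ∈ Icc 0 τ := ⟨le_rfl, hh.trans hτ⟩
  let P : ℝ → Jet l 2 × L2G l := fun t => (∫ r in (0 : ℝ)..t, v r, v t 0 - v 0 0)
  have hP1 : Continuous fun t => ∫ r in (0 : ℝ)..t, v r :=
    intervalIntegral.continuous_primitive (fun _ _ => H.cont.intervalIntegrable _ _) 0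
  have hP2 : Continuous fun t => v t 0 - v 0 0 :=
    (continuous_component H.cont 0).sub continuous_const
  have hP : Continuous P := hP1.prodMk hP2
  have hPm : ∀ t ∈ Icc 0 h, P t ∈ graphOn S := fun t ht => H.mem 0 z t ⟨ht.1, ht.2.trans hτ⟩
  -- The integrand `e s • v s` need not lie in the domain of `A`, so it is integrated by parts: the
  -- pairs `P s` lie in the graph, hence so does `e(h) P(h) + c ∫ e P`. The identities `g1` and `g2`
  -- evaluate its two components; `g2` uses the periodicity `e(h) v(h) = v(0)`.
  have hI : ∫ s in (0 : ℝ)..h, e s • P s ∈ graphOn S := by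
    apply hS.integral_mem (he.smul hP)
    intro s hs
    rw [uIcc_of_le hh] at hs
    exact hS.smul_mem _ (hPm s hs)
  have key := hS.add_mem (hS.smul_mem (e h) (hPm h (right_mem_Icc.2 hh))) (hS.smul_mem c hI)
  have hint := (he.smul hP).intervalIntegrable (μ := volume) 0 h
  have f1 : (∫ s in (0 : ℝ)..h, e s • P s).1 = ∫ s in (0 : ℝ)..h, e s • ∫ r in (0 : ℝ)..s, v r :=
    ((ContinuousLinearMap.fst ℂ (Jet l 2) (L2G l)).intervalIntegral_comp_comm hint).symm
  have f2 : (∫ s in (0 : ℝ)..h, e s • P s).2 = ∫ s in (0 : ℝ)..h, e s • (v s 0 - v 0 0) :=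
    ((ContinuousLinearMap.snd ℂ (Jet l 2) (L2G l)).intervalIntegral_comp_comm hint).symm
  have de : ∀ t, HasDerivAt e (-c * e t) t := fun t => hasDerivAt_cexp_mul (-c) t
  have g1 : e h • (∫ r in (0 : ℝ)..h, v r) + c • (∫ s in (0 : ℝ)..h, e s • ∫ r in (0 : ℝ)..s, v r)
      = ∫ s in (0 : ℝ)..h, e s • v s := by
    have d : ∀ t ∈ uIcc 0 h, HasDerivAt (fun t => e t • ∫ r in (0 : ℝ)..t, v r)
        (e t • v t + (-c * e t) • ∫ r in (0 : ℝ)..t, v r) t := fun t _ =>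
      (de t).fun_smul (H.cont.integral_hasStrictDerivAt 0 t).hasDerivAt
    have i1 : Continuous fun t => e t • v t := he.smul H.cont
    have i2 : Continuous fun t => (-c * e t) • ∫ r in (0 : ℝ)..t, v r :=
      (continuous_const.mul he).smul hP1
    have i4 : Continuous fun t => c • e t • ∫ r in (0 : ℝ)..t, v r :=
      (he.smul hP1).const_smul c
    have ftc := intervalIntegral.integral_eq_sub_of_hasDerivAt d
      ((i1.add i2).intervalIntegrable _ _)
    rw [intervalIntegral.integral_add (i1.intervalIntegrable _ _) (i2.intervalIntegrable _ _),
      intervalIntegral.integral_same, smul_zero, sub_zero] at ftc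
    rw [← ftc, ← intervalIntegral.integral_smul, add_assoc, ← intervalIntegral.integral_add
      (i2.intervalIntegrable _ _) (i4.intervalIntegrable _ _)]
    rw [add_eq_left]
    refine (intervalIntegral.integral_congr (g := fun _ => 0) fun t _ => ?_).trans
      intervalIntegral.integral_zero
    simp only [smul_smul, ← add_smul, neg_mul, neg_add_cancel, zero_smul]
  have g2 : e h • (v h 0 - v 0 0) + c • (∫ s in (0 : ℝ)..h, e s • (v s 0 - v 0 0))
      = c • ∫ s in (0 : ℝ)..h, e s • v s 0 := by
    have i0 : Continuous fun t => e t • v t 0 := he.smul (continuous_component H.cont 0)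
    have ftc := intervalIntegral.integral_eq_sub_of_hasDerivAt (fun t (_ : t ∈ uIcc 0 h) => de t)
      ((continuous_const.mul he).intervalIntegrable _ _)
    rw [intervalIntegral.integral_const_mul] at ftc
    have e0 : e 0 = 1 := by simp [e]
    have i3 : Continuous fun t => e t • v 0 0 := he.smul continuous_const
    simp only [smul_sub]
    rw [intervalIntegral.integral_sub (i0.intervalIntegrable _ _) (i3.intervalIntegrable _ _),
      intervalIntegral.integral_smul_const, hμ, PiLp.smul_apply, smul_smul, smul_sub, smul_smul]
    have hc' : e h * μ = 1 := hc
    have : c * ∫ s in (0 : ℝ)..h, e s = 1 - e h := by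
      rw [e0] at ftc
      linear_combination -ftc
    rw [hc', this, sub_smul]
    abel
  convert key using 1
  refine Prod.ext ?_ ?_
  · rw [Prod.fst_add, Prod.smul_fst, Prod.smul_fst, f1]
    exact g1.symm
  · rw [Prod.snd_add, Prod.smul_snd, Prod.smul_snd, f2]
    exact g2.symm

/-- Parseval's identity gives `∫ ‖f‖ ^ 2 = 0`, and continuity then forces the value at the endpoint.
No periodicity of `f` is needed. -/
theorem eq_zero_of_fourierCoeffOn_eq_zero {h : ℝ} (hh : 0 < h) {f : ℝ → ℂ} (hf : Continuous f)
    (h0 : ∀ k : ℤ, fourierCoeffOn hh f k = 0) : f 0 = 0 := by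
  obtain ⟨C, hC⟩ := (isCompact_Icc (a := 0) (b := h)).exists_bound_of_continuousOn hf.continuousOn
  have hm : MemLp f 2 (volume.restrict (Ioc 0 h)) := by
    apply MemLp.of_bound hf.aestronglyMeasurable C
    filter_upwards [ae_restrict_mem measurableSet_Ioc] with x hx
    exact hC x (Ioc_subset_Icc_self hx)
  have key := tsum_sq_fourierCoeffOn hh hm
  simp only [h0, norm_zero, ne_eq, OfNat.ofNat_ne_zero, not_false_eq_true, zero_pow,
    tsum_zero, smul_eq_mul] at key
  by_contra hne
  have pos : 0 < ∫ x in (0 : ℝ)..h, ‖f x‖ ^ 2 :=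
    intervalIntegral.integral_pos hh (hf.norm.pow 2).continuousOn (fun _ _ => sq_nonneg _)
      ⟨0, left_mem_Icc.2 hh.le, by positivity⟩
  have : 0 < (h - 0)⁻¹ * ∫ x in (0 : ℝ)..h, ‖f x‖ ^ 2 := mul_pos (by simpa using hh) pos
  exact this.ne key

/-- The spaces decrease in time and their dimensions are bounded, so among infinitely many times in
`[τ/2, τ)` two have the same dimension, and then the same space. -/
theorem exists_invisible_shift (hl : ∀ j, 0 < l j) {s : ℝ} (hs : 0 < s) (hsn : s ^ 2 = n)
    (hα : ∀ j, α j = s) {τ : ℝ} (hτ : 0 < τ) (hN : invisible hl α τ ≠ ⊥) :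
    ∃ (T₁ T₂ : ℝ), 0 < T₁ ∧ T₁ < T₂ ∧ invisible hl α T₁ = invisible hl α T₂ ∧
      invisible hl α T₂ ≠ ⊥ := by
  let t : ℕ → ℝ := fun k => τ - τ / 2 * (1 / ((k : ℝ) + 1))
  have ht : StrictMono t := by
    intro i j hij
    have : (i : ℝ) < j := by exact_mod_cast hij
    have h1 : 1 / ((j : ℝ) + 1) < 1 / ((i : ℝ) + 1) :=
      one_div_lt_one_div_of_lt (by positivity) (by linarith)
    simp only [t]
    nlinarith
  have t0 : t 0 = τ / 2 := by simp [t]; ring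
  have hpos : ∀ k, 0 < t k := fun k => by
    have := ht.monotone (Nat.zero_le k)
    rw [t0] at this
    linarith
  have hlt : ∀ k, t k ≤ τ := fun k => by
    have : 0 ≤ τ / 2 * (1 / ((k : ℝ) + 1)) := by positivity
    simp only [t]; linarith
  have hfd := fun k => finiteDimensional_invisible (α := α) hl hs hsn hα (hpos k)
  have key : ∀ i j, i < j → Module.finrank ℂ (invisible hl α (t i))
      = Module.finrank ℂ (invisible hl α (t j)) → invisible hl α (t i) = invisible hl α (t j) := by
    intro i j hij h
    have := hfd i
    exact (Submodule.eq_of_le_of_finrank_eq (invisible_anti hl (ht hij).le) h.symm).symm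
  let f : ℕ → Fin (Module.finrank ℂ (invisible hl α (t 0)) + 1) := fun k =>
    ⟨Module.finrank ℂ (invisible hl α (t k)), by
      have := hfd 0
      exact Nat.lt_succ_of_le
        (Submodule.finrank_mono (invisible_anti hl (ht.monotone (Nat.zero_le k))))⟩
  obtain ⟨i, j, hij, hf⟩ := Finite.exists_ne_map_eq_of_infinite f
  have hf' : Module.finrank ℂ (invisible hl α (t i)) = Module.finrank ℂ (invisible hl α (t j)) :=
    congrArg Fin.val hf
  have ne : ∀ k, invisible hl α (t k) ≠ ⊥ := fun k h => hN (by
    rw [eq_bot_iff, ← h]; exact invisible_anti hl (hlt k))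
  rcases lt_or_gt_of_ne hij with h | h
  · exact ⟨t i, t j, hpos i, ht h, key i j h hf', ne j⟩
  · exact ⟨t j, t i, hpos j, ht h, key j i h hf'.symm, ne i⟩

/-- If there is an invisible solution, there is one that is periodic up to a phase. -/
theorem exists_periodic_invisible (hl : ∀ j, 0 < l j) {s : ℝ} (hs : 0 < s) (hsn : s ^ 2 = n)
    (hα : ∀ j, α j = s) {τ : ℝ} (hτ : 0 < τ) (hN : invisible hl α τ ≠ ⊥) :
    ∃ (T h : ℝ) (v : ℝ → Jet l 2) (μ : ℂ), 0 < h ∧ h < T ∧ IsMild (domObs l α) 0 T v ∧ v 0 ≠ 0 ∧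
      v h = μ • v 0 ∧ ‖μ‖ = 1 := by
  have hα0 : ∀ j, 0 < α j := fun j => by rw [hα j]; exact hs
  obtain ⟨T₁, T₂, h1, h12, heq, hne⟩ := exists_invisible_shift hl hs hsn hα hτ hN
  have hfd := finiteDimensional_invisible (α := α) hl hs hsn hα (h1.trans h12)
  set h := T₂ - T₁ with hh
  have hpos : 0 < h := sub_pos.2 h12
  have hT : h < T₂ := by linarith
  have hm : h ∈ Icc 0 T₂ := ⟨hpos.le, hT.le⟩
  choose v hv hv0 using fun x : invisible hl α T₂ => mem_invisible.1 x.2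
  have hG := isClosedSubspace_graphOn_domObs (α := α) hl
  -- Shifted by `h = T₂ - T₁`, a solution on `[0, T₂]` is still a solution on `[0, T₁]`, and the two
  -- spaces coincide.
  have hmem : ∀ x, v x h ∈ invisible hl α T₂ := by
    intro x
    rw [← heq]
    have := ((hv x).shift h).restrict (c := 0) (d := T₁)
      (Icc_subset_Icc (by linarith) (by linarith))
    exact ⟨_, this, by simp⟩
  -- Solutions are determined by their initial values, so the shift does not depend on the chosen
  -- solutions and is linear.
  let S : Module.End ℂ (invisible hl α T₂) :=
    { toFun := fun x => ⟨v x h, hmem x⟩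
      map_add' := fun x y => Subtype.ext ((hv (x + y)).eq_of_eq hl hα0 ((hv x).add hG (hv y))
        (by simp [hv0]) hm)
      map_smul' := fun c x => Subtype.ext ((hv (c • x)).eq_of_eq hl hα0 ((hv x).smul hG c)
        (by simp [hv0]) hm) }
  have : Nontrivial (invisible hl α T₂) := Submodule.nontrivial_iff_ne_bot.2 hne
  obtain ⟨μ, hμ⟩ := Module.End.exists_eigenvalue S
  obtain ⟨x, hx⟩ := hμ.exists_hasEigenvector
  have hxS : v x h = μ • (x : Jet l 2) := congrArg Subtype.val hx.apply_eq_smul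
  have hx0 : (x : Jet l 2) ≠ 0 := fun h0 => hx.2 (Subtype.ext h0)
  refine ⟨T₂, h, v x, μ, hpos, hT, hv x, by rw [hv0]; exact hx0, by rw [hv0]; exact hxS, ?_⟩
  -- Conservation of the norm puts the eigenvalue on the unit circle.
  have e := ((hv x).mono domObs_subset).norm_eq hl hα0 hm
  rw [hxS, hv0, norm_smul] at e
  exact mul_right_cancel₀ (norm_ne_zero_iff.2 hx0) (e.trans (one_mul _).symm)

/-- There are no invisible solutions, if there are no invisible eigenfunctions. -/
theorem IsMild.eq_zero_of_invisible (hl : ∀ j, 0 < l j) {s : ℝ} (hs : 0 < s) (hsn : s ^ 2 = n)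
    (hα : ∀ j, α j = s)
    (hE : ∀ U ∈ domObs l α, ∀ θ : ℝ, opA U = (Complex.I * θ) • U 0 → U = 0) {τ : ℝ} (hτ : 0 < τ)
    {v : ℝ → Jet l 2} (H : IsMild (domObs l α) 0 τ v) : v 0 = 0 := by
  by_contra hne
  obtain ⟨T, h, v, μ, hh, hT, H, hv0, hμ, hμ1⟩ := exists_periodic_invisible hl hs hsn hα hτ
    (fun h => hne (by
      have : v 0 ∈ invisible hl α τ := ⟨v, H, rfl⟩
      rw [h] at this
      exact this))
  have hG := isClosedSubspace_graphOn_domObs (α := α) hl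
  have hμe : Complex.exp (μ.arg * Complex.I) = μ := by
    have := Complex.norm_mul_exp_arg_mul_I μ
    rwa [hμ1, Complex.ofReal_one, one_mul] at this
  have hhC : (h : ℂ) ≠ 0 := by exact_mod_cast hh.ne'
  -- The frequencies `(arg μ + 2 π k) / h` are those for which the exponential undoes the phase `μ`
  -- over one period. Each such integral is an eigenfunction with vanishing second traces, hence
  -- zero.
  have vanish : ∀ k : ℤ, ∫ r in (0 : ℝ)..h,
      Complex.exp (-(Complex.I * ((μ.arg + 2 * Real.pi * k) / h : ℝ)) * r) • v r 0 = 0 := by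
    intro k
    set θ : ℝ := (μ.arg + 2 * Real.pi * k) / h with hθ
    have hexp : Complex.exp (-(Complex.I * θ) * h) * μ = 1 := by
      have : -(Complex.I * (θ : ℂ)) * h = -(μ.arg * Complex.I) + (-k : ℤ) * (2 * Real.pi * Complex.I) := by
        rw [hθ]; push_cast; field_simp; ring
      rw [this, Complex.exp_add, Complex.exp_int_mul_two_pi_mul_I, mul_one, Complex.exp_neg, hμe]
      exact inv_mul_cancel₀ (by rw [← norm_ne_zero_iff, hμ1]; exact one_ne_zero)
    obtain ⟨U, hU, e⟩ := H.integral_exp_mem hG hh.le hT.le hμ hexp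
    have e1 : truncL l U = _ := congrArg Prod.fst e
    have e2 : opA U = _ := congrArg Prod.snd e
    have hc : Continuous fun r : ℝ => Complex.exp (-(Complex.I * θ) * r) • v r :=
      Continuous.smul (f := fun r : ℝ => Complex.exp (-(Complex.I * θ) * r)) (by fun_prop) H.cont
    have e3 : U 0 = ∫ r in (0 : ℝ)..h, Complex.exp (-(Complex.I * θ) * r) • v r 0 := by
      change jetL l 0 (truncL l U) = _
      rw [e1, ← (jetL l 0).intervalIntegral_comp_comm (hc.intervalIntegrable _ _)]
      rfl
    rw [← e3] at e2
    rw [← e3, hE U hU θ e2]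
    rfl
  -- Multiplied by the phase of frequency `arg μ / h`, the inner product with `v 0 0` has as Fourier
  -- coefficients, up to the factor `1 / h`, the inner products with the vanishing integrals. At
  -- time `0` it equals the squared `L²` norm of the initial value.
  let F : ℝ → ℂ := fun r => Complex.exp (-(Complex.I * (μ.arg / h : ℝ)) * r) * inner ℂ (v 0 0) (v r 0)
  have hF : Continuous F := by
    have := continuous_component H.cont 0
    have h2 : Continuous fun r => inner ℂ (v 0 0) (v r 0) := continuous_const.inner this
    exact Continuous.mul (by fun_prop) h2
  have F0 : F 0 = 0 := by
    apply eq_zero_of_fourierCoeffOn_eq_zero hh hF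
    intro k
    rw [fourierCoeffOn_eq_integral]
    have hc : Continuous fun r : ℝ =>
        Complex.exp (-(Complex.I * ((μ.arg + 2 * Real.pi * k) / h : ℝ)) * r) • v r 0 :=
      Continuous.smul (f := fun r : ℝ =>
        Complex.exp (-(Complex.I * ((μ.arg + 2 * Real.pi * k) / h : ℝ)) * r))
        (by fun_prop) (continuous_component H.cont 0)
    have e := (innerSL ℂ (v 0 0)).intervalIntegral_comp_comm (hc.intervalIntegrable (μ := volume) 0 h)
    rw [vanish k, map_zero] at e
    rw [smul_eq_zero]
    right
    rw [← e]
    apply intervalIntegral.integral_congr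
    intro r _
    simp only [F, fourier_coe_apply, map_smul, smul_eq_mul, innerSL_apply_apply, sub_zero]
    rw [← mul_assoc, ← Complex.exp_add]
    congr 2
    push_cast
    field_simp
    ring
  have : F 0 = inner ℂ (v 0 0) (v 0 0) := by simp [F]
  rw [this, inner_self_eq_zero] at F0
  apply hv0
  have hsob := isClosedSubspace_sobolev (l := l) 2
  exact sobolev_ext hl ((H.mono domObs_subset).mem_energySpace hl (hh.trans hT)
    (left_mem_Icc.2 (hh.trans hT).le)).1.1 hsob.zero_mem F0

/-! ### The equation `u'''' = u'' + κ u` -/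

/-- The equation `u'''' = u'' + κ u` as a first order system. -/
def beamL (κ : ℝ) : (Fin 4 → ℂ) →L[ℂ] (Fin 4 → ℂ) :=
  ContinuousLinearMap.pi ![ContinuousLinearMap.proj 1, ContinuousLinearMap.proj 2,
    ContinuousLinearMap.proj 3, ContinuousLinearMap.proj 2 + (κ : ℂ) • ContinuousLinearMap.proj 0]

theorem beamL_apply (κ : ℝ) (y : Fin 4 → ℂ) :
    beamL κ y = ![y 1, y 2, y 3, y 2 + κ * y 0] := by
  ext k
  fin_cases k <;> simp [beamL]

/-- Solutions on `[a, b]` of the first order system. -/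
def IsBeam (κ a b : ℝ) (f : ℝ → Fin 4 → ℂ) : Prop :=
  ∀ x ∈ Icc a b, HasDerivWithinAt f (beamL κ (f x)) (Icc a b) x

namespace IsBeam

variable {κ a b : ℝ} {f g : ℝ → Fin 4 → ℂ}

theorem continuousOn (hf : IsBeam κ a b f) : ContinuousOn f (Icc a b) :=
  fun x hx => (hf x hx).continuousWithinAt

theorem eqOn_of_left (hf : IsBeam κ a b f) (hg : IsBeam κ a b g) (h : f a = g a) :
    EqOn f g (Icc a b) :=
  ODE_solution_unique_of_mem_Icc_right (v := fun _ => beamL κ) (s := fun _ => univ)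
    (fun _ _ => (beamL κ).lipschitz.lipschitzOnWith) hf.continuousOn
    (fun t ht => (hf t (Ico_subset_Icc_self ht)).mono_of_mem_nhdsWithin (Icc_mem_nhdsGE_of_mem ht))
    (fun _ _ => mem_univ _) hg.continuousOn
    (fun t ht => (hg t (Ico_subset_Icc_self ht)).mono_of_mem_nhdsWithin (Icc_mem_nhdsGE_of_mem ht))
    (fun _ _ => mem_univ _) h

theorem eqOn_of_right (hf : IsBeam κ a b f) (hg : IsBeam κ a b g) (h : f b = g b) :
    EqOn f g (Icc a b) :=
  ODE_solution_unique_of_mem_Icc_left (v := fun _ => beamL κ) (s := fun _ => univ)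
    (fun _ _ => (beamL κ).lipschitz.lipschitzOnWith) hf.continuousOn
    (fun t ht => (hf t (Ioc_subset_Icc_self ht)).mono_of_mem_nhdsWithin (Icc_mem_nhdsLE_of_mem ht))
    (fun _ _ => mem_univ _) hg.continuousOn
    (fun t ht => (hg t (Ioc_subset_Icc_self ht)).mono_of_mem_nhdsWithin (Icc_mem_nhdsLE_of_mem ht))
    (fun _ _ => mem_univ _) h

theorem zero : IsBeam κ a b fun _ => 0 := fun x _ => by
  rw [map_zero]
  exact hasDerivWithinAt_const _ _ _

theorem component (hf : IsBeam κ a b f) {x : ℝ} (hx : x ∈ Icc a b) :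
    HasDerivWithinAt (fun x => f x 0) (f x 1) (Icc a b) x ∧
    HasDerivWithinAt (fun x => f x 1) (f x 2) (Icc a b) x ∧
    HasDerivWithinAt (fun x => f x 2) (f x 3) (Icc a b) x ∧
    HasDerivWithinAt (fun x => f x 3) (f x 2 + κ * f x 0) (Icc a b) x := by
  have h := hasDerivWithinAt_pi.1 (hf x hx)
  rw [beamL_apply] at h
  exact ⟨h 0, h 1, h 2, h 3⟩

/-- The first integral. -/
theorem energy_eq (hf : IsBeam κ a b f) {x : ℝ} (hx : x ∈ Icc a b) :
    inner ℝ (f x 3) (f x 1) - ‖f x 2‖ ^ 2 / 2 - ‖f x 1‖ ^ 2 / 2 - κ / 2 * ‖f x 0‖ ^ 2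
      = inner ℝ (f a 3) (f a 1) - ‖f a 2‖ ^ 2 / 2 - ‖f a 1‖ ^ 2 / 2 - κ / 2 * ‖f a 0‖ ^ 2 := by
  have key : ∀ x ∈ Icc a b, HasDerivWithinAt (fun x => (inner ℝ (f x 3) (f x 1) : ℝ)
      - inner ℝ (f x 2) (f x 2) / 2 - inner ℝ (f x 1) (f x 1) / 2
      - κ / 2 * inner ℝ (f x 0) (f x 0)) 0 (Icc a b) x := by
    intro x hx
    obtain ⟨d0, d1, d2, d3⟩ := hf.component hx
    have := (((d3.inner ℝ d1).sub ((d2.inner ℝ d2).div_const 2)).sub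
      ((d1.inner ℝ d1).div_const 2)).sub ((d0.inner ℝ d0).const_mul (κ / 2))
    refine this.congr_deriv ?_
    have e : (κ : ℂ) * f x 0 = κ • f x 0 := by rw [Complex.real_smul]
    rw [e, inner_add_left, real_inner_smul_left, real_inner_comm (f x 2) (f x 3),
      real_inner_comm (f x 1) (f x 2), real_inner_comm (f x 0) (f x 1)]
    ring
  have h := constant_of_has_deriv_right_zero (fun x hx => (key x hx).continuousWithinAt)
    (fun x hx => (key x (Ico_subset_Icc_self hx)).mono_of_mem_nhdsWithin
      (Icc_mem_nhdsGE_of_mem hx)) x hx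
  simpa only [real_inner_self_eq_norm_sq] using h

end IsBeam

/-- The real solutions that vanish to second order at `0`. -/
structure IsProfile (κ : ℝ) (φ : ℝ → Fin 4 → ℝ) : Prop where
  d0 : ∀ x, HasDerivAt (fun x => φ x 0) (φ x 1) x
  d1 : ∀ x, HasDerivAt (fun x => φ x 1) (φ x 2) x
  d2 : ∀ x, HasDerivAt (fun x => φ x 2) (φ x 3) x
  d3 : ∀ x, HasDerivAt (fun x => φ x 3) (φ x 2 + κ * φ x 0) x
  z0 : φ 0 0 = 0
  z1 : φ 0 1 = 0
  z2 : φ 0 2 = 0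
  z3 : 0 < φ 0 3
  pos0 : ∀ x, 0 < x → 0 < φ x 0
  pos1 : ∀ x, 0 < x → 0 < φ x 1

/-- The characteristic equation `r⁴ = r² + κ` has roots `±p` and `±iq` with `p² - q² = 1` and `p² q²
= κ`. The profile is `sinh(px) / p - sin(qx) / q`; its derivative is positive for `x > 0` because
`cosh > 1 ≥ cos`. -/
theorem exists_profile {κ : ℝ} (hκ : 0 < κ) : ∃ φ, IsProfile κ φ := by
  obtain ⟨p, q, hp, hq, h1, h2⟩ : ∃ p q : ℝ, 0 < p ∧ 0 < q ∧ p ^ 2 - q ^ 2 = 1 ∧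
      p ^ 2 * q ^ 2 = κ := by
    have hD : 1 < √(1 + 4 * κ) := by
      rw [Real.lt_sqrt zero_le_one]; linarith
    have hD2 : √(1 + 4 * κ) ^ 2 = 1 + 4 * κ := Real.sq_sqrt (by linarith)
    refine ⟨√((1 + √(1 + 4 * κ)) / 2), √((√(1 + 4 * κ) - 1) / 2), Real.sqrt_pos.2 (by linarith),
      Real.sqrt_pos.2 (by linarith), ?_, ?_⟩
    · rw [Real.sq_sqrt (by linarith), Real.sq_sqrt (by linarith)]; ring
    · rw [Real.sq_sqrt (by linarith), Real.sq_sqrt (by linarith)]; linarith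
  let φ : ℝ → Fin 4 → ℝ := fun x => ![Real.sinh (p * x) / p - Real.sin (q * x) / q,
    Real.cosh (p * x) - Real.cos (q * x), p * Real.sinh (p * x) + q * Real.sin (q * x),
    p ^ 2 * Real.cosh (p * x) + q ^ 2 * Real.cos (q * x)]
  have lin : ∀ r x : ℝ, HasDerivAt (fun x => r * x) r x := fun r x => by
    simpa using (hasDerivAt_id x).const_mul r
  have dsh : ∀ x, HasDerivAt (fun x => Real.sinh (p * x)) (Real.cosh (p * x) * p) x := fun x =>
    (lin p x).sinh
  have dch : ∀ x, HasDerivAt (fun x => Real.cosh (p * x)) (Real.sinh (p * x) * p) x := fun x =>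
    (lin p x).cosh
  have ds : ∀ x, HasDerivAt (fun x => Real.sin (q * x)) (Real.cos (q * x) * q) x := fun x =>
    (lin q x).sin
  have dc : ∀ x, HasDerivAt (fun x => Real.cos (q * x)) (-Real.sin (q * x) * q) x := fun x =>
    (lin q x).cos
  have d0 : ∀ x, HasDerivAt (fun x => φ x 0) (φ x 1) x := fun x =>
    (((dsh x).div_const p).sub ((ds x).div_const q)).congr_deriv (by
      change _ = Real.cosh (p * x) - Real.cos (q * x); field_simp)
  have pos1 : ∀ x, 0 < x → 0 < φ x 1 := fun x hx => by
    have h1 := Real.one_lt_cosh.2 (mul_pos hp hx).ne'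
    have h2 := Real.cos_le_one (q * x)
    change 0 < Real.cosh (p * x) - Real.cos (q * x)
    linarith
  have z0 : φ 0 0 = 0 := by simp [φ]
  refine ⟨φ, d0, fun x => ?_, fun x => ?_, fun x => ?_, z0, by simp [φ], by simp [φ], ?_, ?_,
    pos1⟩
  · exact ((dch x).sub (dc x)).congr_deriv (by
      change _ = p * Real.sinh (p * x) + q * Real.sin (q * x); ring)
  · exact (((dsh x).const_mul p).add ((ds x).const_mul q)).congr_deriv (by
      change _ = p ^ 2 * Real.cosh (p * x) + q ^ 2 * Real.cos (q * x); ring)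
  · refine (((dch x).const_mul (p ^ 2)).add ((dc x).const_mul (q ^ 2))).congr_deriv ?_
    change _ = p * Real.sinh (p * x) + q * Real.sin (q * x)
      + κ * (Real.sinh (p * x) / p - Real.sin (q * x) / q)
    rw [← h2]
    generalize Real.sinh (p * x) = A
    generalize Real.sin (q * x) = B
    field_simp
    linear_combination (p * A + q * B) * h1
  · have : φ 0 3 = p ^ 2 + q ^ 2 := by simp [φ]
    rw [this]; positivity
  · intro x hx
    have mono : StrictMonoOn (fun x => φ x 0) (Ici 0) := by
      apply strictMonoOn_of_deriv_pos (convex_Ici 0)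
        (fun x _ => (d0 x).continuousAt.continuousWithinAt)
      intro x hx
      rw [interior_Ici] at hx
      rw [(d0 x).deriv]
      exact pos1 x hx
    have := mono (mem_Ici.2 le_rfl) (mem_Ici.2 hx.le) hx
    simp only [z0] at this
    exact this

namespace IsProfile

variable {κ : ℝ} {φ : ℝ → Fin 4 → ℝ}

theorem energy_eq (h : IsProfile κ φ) (x : ℝ) :
    φ x 3 * φ x 1 - φ x 2 ^ 2 / 2 - φ x 1 ^ 2 / 2 - κ / 2 * φ x 0 ^ 2 = 0 := by
  have d : ∀ x, HasDerivAt
      (fun x => φ x 3 * φ x 1 - φ x 2 ^ 2 / 2 - φ x 1 ^ 2 / 2 - κ / 2 * φ x 0 ^ 2) 0 x := by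
    intro x
    refine (((((h.d3 x).mul (h.d1 x)).sub (((h.d2 x).fun_pow 2).div_const 2)).sub
      (((h.d1 x).fun_pow 2).div_const 2)).sub (((h.d0 x).fun_pow 2).const_mul (κ / 2))).congr_deriv ?_
    push_cast
    ring
  have := is_const_of_deriv_eq_zero (fun x => (d x).differentiableAt) (fun x => (d x).deriv) x 0
  simpa [h.z0, h.z1, h.z2] using this

/-- The solution vanishing to second order at the left endpoint. -/
theorem isBeam_left (h : IsProfile κ φ) (c : ℂ) (a b : ℝ) :
    IsBeam κ a b fun x k => c * φ (x - a) k := by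
  intro x _
  refine HasDerivAt.hasDerivWithinAt (hasDerivAt_pi.2 fun k => ?_)
  have t : ∀ {g : ℝ → ℝ} {g' : ℝ}, HasDerivAt g g' (x - a) →
      HasDerivAt (fun x => c * (g (x - a) : ℂ)) (c * (g' : ℂ)) x := fun hg =>
    ((hg.comp_sub_const x a).ofReal_comp).const_mul c
  rw [beamL_apply]
  fin_cases k
  · exact t (h.d0 _)
  · exact t (h.d1 _)
  · exact t (h.d2 _)
  · refine (t (h.d3 _)).congr_deriv ?_
    change _ = c * (φ (x - a) 2 : ℂ) + κ * (c * (φ (x - a) 0 : ℂ))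
    push_cast
    ring

/-- The solution vanishing to second order at the right endpoint. -/
theorem isBeam_right (h : IsProfile κ φ) (c : ℂ) (a b : ℝ) :
    IsBeam κ a b fun x k => c * ((-1) ^ (k : ℕ) * φ (b - x) k) := by
  intro x _
  refine HasDerivAt.hasDerivWithinAt (hasDerivAt_pi.2 fun k => ?_)
  have t : ∀ {g : ℝ → ℝ} {g' : ℝ} (m : ℕ), HasDerivAt g g' (b - x) →
      HasDerivAt (fun x => c * ((-1) ^ m * (g (b - x) : ℂ))) (c * ((-1) ^ (m + 1) * (g' : ℂ))) x :=
    fun m hg => by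
      refine (((hg.comp_const_sub b x).ofReal_comp).const_mul ((-1 : ℂ) ^ m)).const_mul c
        |>.congr_deriv ?_
      push_cast
      ring
  rw [beamL_apply]
  fin_cases k
  · exact t 0 (h.d0 _)
  · exact t 1 (h.d1 _)
  · exact t 2 (h.d2 _)
  · refine (t 3 (h.d3 _)).congr_deriv ?_
    change _ = c * ((-1) ^ 2 * (φ (b - x) 2 : ℂ)) + κ * (c * ((-1) ^ 0 * (φ (b - x) 0 : ℂ)))
    push_cast
    ring

end IsProfile

/-! ### Solutions vanishing to second order at an endpoint, and traces of eigenfunctions -/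

/-- Three vanishing data leave a one-dimensional space of solutions, spanned by the profile; the
constant is read off from the third derivative. -/
theorem IsBeam.eq_left {κ a b : ℝ} {f : ℝ → Fin 4 → ℂ} (hf : IsBeam κ a b f) (hab : a ≤ b)
    {φ : ℝ → Fin 4 → ℝ} (h : IsProfile κ φ) (h0 : f a 0 = 0) (h1 : f a 1 = 0) (h2 : f a 2 = 0) :
    ∃ c : ℂ, ∀ k, f b k = c * φ (b - a) k := by
  refine ⟨f a 3 / φ 0 3, fun k => ?_⟩
  have e : f a = fun k => f a 3 / φ 0 3 * φ (a - a) k := by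
    have : (φ 0 3 : ℂ) ≠ 0 := by exact_mod_cast h.z3.ne'
    ext k
    rw [sub_self]
    fin_cases k
    · simp [h0, h.z0]
    · simp [h1, h.z1]
    · simp [h2, h.z2]
    · change f a 3 = f a 3 / φ 0 3 * φ 0 3
      field_simp
  exact congrFun (hf.eqOn_of_left (h.isBeam_left _ a b) e (right_mem_Icc.2 hab)) k

theorem IsBeam.eq_right {κ a b : ℝ} {f : ℝ → Fin 4 → ℂ} (hf : IsBeam κ a b f) (hab : a ≤ b)
    {φ : ℝ → Fin 4 → ℝ} (h : IsProfile κ φ) (h0 : f b 0 = 0) (h1 : f b 1 = 0) (h2 : f b 2 = 0) :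
    ∃ c : ℂ, (∀ k, f a k = c * ((-1) ^ (k : ℕ) * φ (b - a) k)) ∧
      (c = 0 → ∀ x ∈ Icc a b, f x = 0) := by
  have e : f b = fun k : Fin 4 => -(f b 3 / φ 0 3) * ((-1) ^ (k : ℕ) * φ (b - b) k) := by
    have : (φ 0 3 : ℂ) ≠ 0 := by exact_mod_cast h.z3.ne'
    ext k
    rw [sub_self]
    fin_cases k
    · simp [h0, h.z0]
    · simp [h1, h.z1]
    · simp [h2, h.z2]
    · change f b 3 = -(f b 3 / φ 0 3) * ((-1) ^ 3 * φ 0 3)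
      field_simp
  have key := hf.eqOn_of_right (h.isBeam_right _ a b) e
  refine ⟨-(f b 3 / φ 0 3), fun k => congrFun (key (left_mem_Icc.2 hab)) k, fun hc x hx => ?_⟩
  rw [key hx, hc]
  ext k
  simp

/-- Elliptic regularity in one dimension: each derivative is a primitive of a continuous function,
so the traces solve the system classically, with one-sided derivatives at the endpoints. -/
theorem isBeam_trace {a b κ : ℝ} (hab : a < b) {u : Fin 5 → L2I a b}
    (h : ∀ k : Fin 4, IsWeakDeriv (u k.castSucc) (u k.succ)) (h4 : u 4 = u 2 + (κ : ℂ) • u 0) :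
    IsBeam κ a b fun x k => trace (u k.castSucc) x := by
  have ha : a ∈ Icc a b := left_mem_Icc.2 hab.le
  have i0 : IsWeakDeriv (u 0) (u 1) := h 0
  have i1 : IsWeakDeriv (u 1) (u 2) := h 1
  have i2 : IsWeakDeriv (u 2) (u 3) := h 2
  have i3 : IsWeakDeriv (u 3) (u 4) := h 3
  have t : ∀ {f g : L2I a b} {G : ℝ → ℂ}, IsWeakDeriv f g → ContinuousOn G (Icc a b) →
      g =ᵐ[volume.restrict (Ioo a b)] G → ∀ x ∈ Icc a b,
      HasDerivWithinAt (trace f) (G x) (Icc a b) x := by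
    intro f g G H hG hgG x hx
    let E : ℝ → ℂ := fun x => G (projIcc a b hab.le x)
    have hE : Continuous E := hG.comp_continuous (continuous_subtype_val.comp continuous_projIcc)
      fun x => (projIcc a b hab.le x).2
    have e : ∀ x ∈ Icc a b, E x = G x := fun x hx => by simp only [E, projIcc_of_mem hab.le hx]
    have hgE : g =ᵐ[volume.restrict (Ioo a b)] E := by
      filter_upwards [hgG, ae_restrict_mem measurableSet_Ioo] with y hy hy'
      rw [hy, e y (Ioo_subset_Icc_self hy')]
    have d := ((hE.integral_hasStrictDerivAt a x).hasDerivAt.const_add (trace f a)).hasDerivWithinAt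
      (s := Icc a b)
    rw [e x hx] at d
    have eq : ∀ y ∈ Icc a b, trace f y = trace f a + ∫ t in a..y, E t := fun y hy => by
      rw [← L2I.intervalIntegral_congr hgE ha hy, ← H.trace_sub hab ha hy]
      ring
    exact d.congr eq (eq x hx)
  have e4 : u 4 =ᵐ[volume.restrict (Ioo a b)] fun x => trace (u 2) x + κ * trace (u 0) x := by
    rw [h4]
    filter_upwards [Lp.coeFn_add (u 2) ((κ : ℂ) • u 0), Lp.coeFn_smul (κ : ℂ) (u 0),
      i2.ae_eq_trace hab, i0.ae_eq_trace hab] with x h1 h2 h3 h5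
    rw [h1, Pi.add_apply, h2, Pi.smul_apply, h3, h5, smul_eq_mul]
  have c4 : ContinuousOn (fun x => trace (u 2) x + κ * trace (u 0) x) (Icc a b) :=
    (i2.continuousOn_trace hab).add (continuousOn_const.mul (i0.continuousOn_trace hab))
  intro x hx
  rw [hasDerivWithinAt_pi]
  intro k
  rw [beamL_apply]
  fin_cases k
  · exact t i0 (i1.continuousOn_trace hab) (i1.ae_eq_trace hab) x hx
  · exact t i1 (i2.continuousOn_trace hab) (i2.ae_eq_trace hab) x hx
  · exact t i2 (i3.continuousOn_trace hab) (i3.ae_eq_trace hab) x hx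
  · exact t i3 c4 e4 x hx

/-! ### Unique continuation for eigenfunctions -/

/-- Testing the second and fourth derivatives with `u`; as for the skewness of `A`, the vertex
conditions cancel all boundary terms. -/
theorem norm_two_sq_eq (hl : ∀ j, 0 < l j) (hα : ∀ j, 0 < α j) {U : Jet l 4} (hU : U ∈ domA l α) :
    (inner ℂ (U 0) (U 2)).re = -‖U 1‖ ^ 2 ∧ (inner ℂ (U 4) (U 0)).re = ‖U 2‖ ^ 2 := by
  obtain ⟨hS, ho, h0, h1, h2, h3⟩ := hU
  have i0 : ∀ j, IsWeakDeriv (U 0 j) (U 1 j) := hS 0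
  have i1 : ∀ j, IsWeakDeriv (U 1 j) (U 2 j) := hS 1
  have i2 : ∀ j, IsWeakDeriv (U 2 j) (U 3 j) := hS 2
  have i3 : ∀ j, IsWeakDeriv (U 3 j) (U 4 j) := hS 3
  have sq : ∀ k, (inner ℂ (U k) (U k)).re = ‖U k‖ ^ 2 := fun k => by
    rw [inner_self_eq_norm_sq_to_K]; norm_cast
  constructor
  · let G : Fin (n + 1) → ℝ → ℝ := fun j c => (inner ℝ (bd U 0 j c) (bd U 1 j c) : ℝ)
    have edge : ∀ j, (inner ℂ (U 1 j) (U 1 j)).re + (inner ℂ (U 0 j) (U 2 j)).re =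
        G j (right l j) - G j (left l j) := fun j =>
      (i0 j).inner_parts (left_lt_right hl j) (i1 j)
    have hsum : (inner ℂ (U 1) (U 1)).re + (inner ℂ (U 0) (U 2)).re = 0 := by
      rw [L2G.inner_eq_sum, L2G.inner_eq_sum, ← Finset.sum_add_distrib,
        Finset.sum_congr rfl fun j _ => edge j, sum_edges_bdry (G := G)]
      · simp only [G]
        rw [inner_vertex hα h0 h1, sub_self]
      · intro j
        simp [G, ho j]
    rw [sq] at hsum
    linarith
  · let G : Fin (n + 1) → ℝ → ℝ := fun j c =>
      (inner ℝ (bd U 3 j c) (bd U 0 j c) - inner ℝ (bd U 2 j c) (bd U 1 j c) : ℝ)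
    have edge : ∀ j, (inner ℂ (U 4 j) (U 0 j)).re - (inner ℂ (U 2 j) (U 2 j)).re =
        G j (right l j) - G j (left l j) := fun j => by
      have a := (i3 j).inner_parts (left_lt_right hl j) (i0 j)
      have b := (i2 j).inner_parts (left_lt_right hl j) (i1 j)
      simp only [G, bd]
      linarith
    have hsum : (inner ℂ (U 4) (U 0)).re - (inner ℂ (U 2) (U 2)).re = 0 := by
      rw [L2G.inner_eq_sum, L2G.inner_eq_sum, ← Finset.sum_sub_distrib,
        Finset.sum_congr rfl fun j _ => edge j, sum_edges_bdry (G := G)]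
      · simp only [G]
        rw [inner_vertex' hα h0 h3, inner_vertex hα h2 h1, Finset.sum_sub_distrib, sub_self]
      · intro j
        simp [G, ho j]
    rw [sq] at hsum
    linarith

theorem eq_zero_of_trace_eq_zero (hl : ∀ j, 0 < l j) {U : Jet l 4} (hU : U ∈ sobolev l 4)
    (h : ∀ j, ∀ x ∈ Icc (left l j) (right l j), trace (U 0 j) x = 0) : U = 0 := by
  refine sobolev_ext hl hU (isClosedSubspace_sobolev 4).zero_mem ?_
  ext1 j
  have i0 : IsWeakDeriv (U 0 j) (U 1 j) := hU 0 j
  apply Lp.ext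
  filter_upwards [i0.ae_eq_trace (left_lt_right hl j), ae_restrict_mem measurableSet_Ioo,
    Lp.coeFn_zero ℂ 2 (volume.restrict (Ioo (left l j) (right l j)))] with x h1 h2 h3
  rw [h1, h j x (Ioo_subset_Icc_self h2)]
  exact h3.symm

/-- The relations at the vertex between the solutions on the edges. -/
theorem vertex_relations {s κ : ℝ} (hs : 0 < s) (hsn : s ^ 2 = n) (hκ : 0 < κ)
    {φ : ℝ → Fin 4 → ℝ} (hφ : IsProfile κ φ) {r : Fin n → ℝ} (hr : ∀ j, 0 < r j) {c : Fin n → ℂ}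
    {A : Fin 4 → ℂ} (h0 : ∀ j, A 0 = s * (c j * φ (r j) 0)) (h1 : A 1 = ∑ j, -(c j * φ (r j) 1) / s)
    (h2 : ∀ j, A 2 = s * (c j * φ (r j) 2)) (h3 : A 3 = ∑ j, -(c j * φ (r j) 3) / s)
    (hA : A 0 ≠ 0) : (∃ P : ℝ, 0 < P ∧ A 1 = -P * A 0) ∧
      0 ≤ inner ℝ (A 3) (A 1) - ‖A 2‖ ^ 2 / 2 - ‖A 1‖ ^ 2 / 2 - κ / 2 * ‖A 0‖ ^ 2 := by
  have hn : (0 : ℝ) < n := by rw [← hsn]; positivity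
  have hn0 : 0 < n := by exact_mod_cast hn
  have hne : Nonempty (Fin n) := ⟨⟨0, hn0⟩⟩
  have hsC : (s : ℂ) ≠ 0 := by exact_mod_cast hs.ne'
  have hsnC : (s : ℂ) ^ 2 = n := by exact_mod_cast hsn
  have hnC : (n : ℂ) ≠ 0 := by exact_mod_cast hn.ne'
  have p0 : ∀ j, 0 < φ (r j) 0 := fun j => hφ.pos0 _ (hr j)
  have p1 : ∀ j, 0 < φ (r j) 1 := fun j => hφ.pos1 _ (hr j)
  have p0C : ∀ j, (φ (r j) 0 : ℂ) ≠ 0 := fun j => by exact_mod_cast (p0 j).ne'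
  set p : Fin n → ℝ := fun j => φ (r j) 1 / φ (r j) 0 with hp
  set t : Fin n → ℝ := fun j => φ (r j) 3 / φ (r j) 0 with ht
  have hpp : ∀ j, 0 < p j := fun j => div_pos (p1 j) (p0 j)
  have hc : ∀ j, c j = A 0 / (s * φ (r j) 0) := fun j => by
    rw [h0 j]; have := p0C j; field_simp
  have hA0 : 0 < ‖A 0‖ := norm_pos_iff.2 hA
  have e1 : A 1 = ((-((∑ j, p j) / n) : ℝ) : ℂ) * A 0 := by
    rw [h1]
    push_cast
    rw [Finset.sum_div, ← Finset.sum_neg_distrib, Finset.sum_mul]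
    refine Finset.sum_congr rfl fun j _ => ?_
    have := p0C j
    rw [hc j, hp, ← hsnC]
    push_cast
    field_simp
  have e3 : A 3 = ((-((∑ j, t j) / n) : ℝ) : ℂ) * A 0 := by
    rw [h3]
    push_cast
    rw [Finset.sum_div, ← Finset.sum_neg_distrib, Finset.sum_mul]
    refine Finset.sum_congr rfl fun j _ => ?_
    have := p0C j
    rw [hc j, ht, ← hsnC]
    push_cast
    field_simp
  set R : ℝ := ‖A 2‖ ^ 2 / ‖A 0‖ ^ 2 with hR
  have e2 : ∀ j, (φ (r j) 2 / φ (r j) 0) ^ 2 = R := fun j => by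
    have : A 2 = ((φ (r j) 2 / φ (r j) 0 : ℝ) : ℂ) * A 0 := by
      have := p0C j
      rw [h2 j, hc j]
      push_cast
      field_simp
    rw [hR, this, norm_mul, Complex.norm_real, mul_pow, Real.norm_eq_abs, sq_abs]
    field_simp
  have hA2 : ‖A 2‖ ^ 2 = R * ‖A 0‖ ^ 2 := by rw [hR]; field_simp
  have hR0 : 0 ≤ R := by positivity
  -- The first integral of the profile is zero. Divided by `φ φ'` it expresses the ratio of the
  -- third derivative to the function through the ratio `p j` and the common square `R`.
  have et : ∀ j, t j = p j / 2 + (R + κ) / 2 * (p j)⁻¹ := fun j => by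
    have en := hφ.energy_eq (r j)
    have a0 := (p0 j).ne'
    have a1 := (p1 j).ne'
    rw [← e2 j, ht, hp]
    field_simp
    linarith
  set Sp := ∑ j, p j with hSp
  set Q := ∑ j, (p j)⁻¹ with hQ
  have hSp0 : 0 < Sp := Finset.sum_pos (fun j _ => hpp j) Finset.univ_nonempty
  have hSt : ∑ j, t j = Sp / 2 + (R + κ) / 2 * Q := by
    rw [Finset.sum_congr rfl fun j _ => et j, Finset.sum_add_distrib, ← Finset.sum_div,
      ← Finset.mul_sum]
  -- Cauchy–Schwarz for `p j` and its inverse. The first integral on edge `0` at the vertex is `‖A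
  -- 0‖ ^ 2 (R + κ) / 2` times `Sp Q / n ^ 2 - 1`, hence nonnegative.
  have cs : (n : ℝ) ^ 2 ≤ Sp * Q := by
    have := Finset.sum_sq_le_sum_mul_sum_of_sq_le_mul (Finset.univ : Finset (Fin n))
      (r := fun _ => (1 : ℝ)) (f := p) (g := fun j => (p j)⁻¹) (fun j _ => (hpp j).le)
      (fun j _ => (inv_pos.2 (hpp j)).le)
      (fun j _ => by rw [mul_inv_cancel₀ (hpp j).ne', one_pow])
    simpa using this
  refine ⟨⟨Sp / n, by positivity, by rw [e1]; push_cast; ring⟩, ?_⟩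
  rw [hA2, e1, e3, hSt]
  simp only [← Complex.real_smul, real_inner_smul_left, real_inner_smul_right,
    real_inner_self_eq_norm_sq, norm_smul, mul_pow, Real.norm_eq_abs, sq_abs]
  have key : 0 ≤ ‖A 0‖ ^ 2 * ((R + κ) / 2 * ((Sp * Q) / n ^ 2 - 1)) := by
    have : 1 ≤ Sp * Q / n ^ 2 := by rw [le_div_iff₀ (by positivity)]; linarith
    have h5 : 0 ≤ Sp * Q / n ^ 2 - 1 := by linarith
    positivity
  refine key.trans (le_of_eq ?_)
  field_simp
  ring

theorem four_eq_of_eigen {U : Jet l 4} {θ : ℝ} (h : opA U = (Complex.I * θ) • U 0) :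
    U 4 = U 2 + ((-θ : ℝ) : ℂ) • U 0 := by
  rw [four_eq_of_opA, h, smul_smul, ← mul_assoc, Complex.I_mul_I]
  push_cast
  rw [neg_one_mul]

/-- Testing the equation with `u` gives `‖u''‖² + ‖u'‖² = κ ‖u‖² ≤ 0`, so `u` is constant on each
edge and vanishes at its outer end. -/
theorem eq_zero_of_eigen_of_nonpos (hl : ∀ j, 0 < l j) (hα : ∀ j, 0 < α j) {U : Jet l 4}
    (hU : U ∈ domA l α) {κ : ℝ} (h4 : U 4 = U 2 + (κ : ℂ) • U 0) (hκ : κ ≤ 0) : U = 0 := by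
  obtain ⟨e1, e2⟩ := norm_two_sq_eq hl hα hU
  rw [h4, inner_add_left, Complex.add_re, inner_smul_left, inner_self_eq_norm_sq_to_K,
    Complex.conj_ofReal] at e2
  have e3 : (inner ℂ (U 2) (U 0)).re = (inner ℂ (U 0) (U 2)).re := inner_re_symm (𝕜 := ℂ) _ _
  have e4 : ((κ : ℂ) * ((‖U 0‖ : ℝ) : ℂ) ^ 2).re = κ * ‖U 0‖ ^ 2 := by norm_cast
  have e5 : (inner ℂ (U 2) (U 0)).re + κ * ‖U 0‖ ^ 2 = ‖U 2‖ ^ 2 := by rw [← e4]; exact e2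
  have e6 : κ * ‖U 0‖ ^ 2 ≤ 0 := mul_nonpos_of_nonpos_of_nonneg hκ (sq_nonneg _)
  have hU1 : U 1 = 0 := by
    have : ‖U 1‖ ^ 2 = 0 := by nlinarith [sq_nonneg ‖U 1‖, sq_nonneg ‖U 2‖]
    exact norm_eq_zero.1 (pow_eq_zero_iff two_ne_zero |>.1 this)
  refine eq_zero_of_trace_eq_zero hl hU.1 fun j x hx => ?_
  have i0 : IsWeakDeriv (U 0 j) (U 1 j) := hU.1 0 j
  have := i0.trace_sub (left_lt_right hl j) (outer_mem hl j) hx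
  have ho : trace (U 0 j) (outer l j) = 0 := (hU.2.1 j).1
  rw [ho, hU1, sub_zero] at this
  rw [this, PiLp.zero_apply, L2I.intervalIntegral_congr (Lp.coeFn_zero _ _ _) (outer_mem hl j) hx]
  simp

/-- On the observed edges `u` is a multiple of the reflected profile. Suppose `u` is nonzero at the
vertex. On edge `0` the first integral is nonnegative at the vertex and equals `-|u''|² / 2` at the
outer end, so `u''` vanishes there as well and `u` is a multiple of the profile on this edge too.
Then `u'/u` is positive at the vertex seen from edge `0`, but negative by the transmission
conditions. Hence `u` vanishes at the vertex, and so do all the multiples. -/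
theorem eq_zero_of_eigen_of_pos (hl : ∀ j, 0 < l j) {s : ℝ} (hs : 0 < s) (hsn : s ^ 2 = n)
    (hα : ∀ j, α j = s) {U : Jet l 4} (hU : U ∈ domObs l α) {κ : ℝ}
    (h4 : U 4 = U 2 + (κ : ℂ) • U 0) (hκ : 0 < κ) : U = 0 := by
  obtain ⟨⟨hS, ho, v0, v1, v2, v3⟩, hobs⟩ := hU
  have hsC : (s : ℂ) ≠ 0 := by exact_mod_cast hs.ne'
  have hn : (0 : ℝ) < n := by rw [← hsn]; positivity
  have hn0 : 0 < n := by exact_mod_cast hn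
  obtain ⟨φ, hφ⟩ := exists_profile hκ
  simp only [hα] at v0 v1 v2 v3
  let f : ∀ _ : Fin (n + 1), ℝ → Fin 4 → ℂ := fun j x k => trace (U k.castSucc j) x
  have hf : ∀ j, IsBeam κ (left l j) (right l j) (f j) := fun j =>
    isBeam_trace (left_lt_right hl j) (u := fun k => U k j) (fun k => hS k j)
      (by rw [h4]; rfl)
  have w : ∀ j : Fin n, ∃ c : ℂ, (∀ k, f j.succ 0 k = c * ((-1) ^ (k : ℕ) * φ (l j.succ) k)) ∧
      (c = 0 → ∀ x ∈ Icc (left l j.succ) (right l j.succ), f j.succ x = 0) := by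
    intro j
    have o := ho j.succ
    have o2 := hobs j
    rw [outer_succ_eq_right] at o o2
    have := (hf j.succ).eq_right (left_lt_right hl _).le hφ o.1 o.2 o2
    rwa [left_succ, right_succ, sub_zero, ← left_succ (l := l) j, ← right_succ (l := l) j] at this
  choose c hc hc0 using w
  let A : Fin 4 → ℂ := f 0 0
  have a0 : ∀ j, A 0 = s * (c j * φ (l j.succ) 0) := fun j => by
    have : f j.succ 0 0 = _ := hc j 0
    rw [show A 0 = s * f j.succ 0 0 from v0 j, this]; simp
  have a2 : ∀ j, A 2 = s * (c j * φ (l j.succ) 2) := fun j => by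
    have : f j.succ 0 2 = _ := hc j 2
    rw [show A 2 = s * f j.succ 0 2 from v2 j, this]; simp
  have a1 : A 1 = ∑ j, -(c j * φ (l j.succ) 1) / s := by
    rw [show A 1 = ∑ j : Fin n, f j.succ 0 1 / s from v1]
    refine Finset.sum_congr rfl fun j _ => ?_
    rw [hc j 1]; simp
  have a3 : A 3 = ∑ j, -(c j * φ (l j.succ) 3) / s := by
    rw [show A 3 = ∑ j : Fin n, f j.succ 0 3 / s from v3]
    refine Finset.sum_congr rfl fun j _ => ?_
    rw [hc j 3, show ((3 : Fin 4) : ℕ) = 3 from rfl]; ring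
  have hf0 := hf 0
  have o := ho 0
  rw [left_zero, right_zero] at hf0
  rw [outer_zero] at o
  have ho0 : f 0 (-l 0) 0 = 0 := o.1
  have ho1 : f 0 (-l 0) 1 = 0 := o.2
  have hl0 : -l 0 ≤ 0 := by linarith [hl 0]
  have A0 : A 0 = 0 := by
    by_contra hA
    obtain ⟨⟨P, hP, hA1⟩, hE⟩ := vertex_relations hs hsn hκ hφ (fun j => hl j.succ) a0 a1 a2 a3 hA
    have hE2 := hf0.energy_eq (right_mem_Icc.2 hl0)
    have hE3 : 0 ≤ inner ℝ (f 0 (-l 0) 3) (f 0 (-l 0) 1) - ‖f 0 (-l 0) 2‖ ^ 2 / 2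
        - ‖f 0 (-l 0) 1‖ ^ 2 / 2 - κ / 2 * ‖f 0 (-l 0) 0‖ ^ 2 := hE2 ▸ hE
    rw [ho0, ho1, inner_zero_right, norm_zero] at hE3
    have hz : f 0 (-l 0) 2 = 0 := by
      have : ‖f 0 (-l 0) 2‖ ^ 2 = 0 := by nlinarith [sq_nonneg ‖f 0 (-l 0) 2‖]
      exact norm_eq_zero.1 (pow_eq_zero_iff two_ne_zero |>.1 this)
    obtain ⟨d, hd⟩ := hf0.eq_left hl0 hφ ho0 ho1 hz
    have d0 : A 0 = _ := hd 0
    have d1 : A 1 = _ := hd 1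
    rw [sub_neg_eq_add, zero_add] at d0 d1
    have q0 := hφ.pos0 _ (hl 0)
    have q1 := hφ.pos1 _ (hl 0)
    have : d * ((φ (l 0) 1 + P * φ (l 0) 0 : ℝ) : ℂ) = 0 := by
      rw [d0, d1] at hA1
      push_cast
      linear_combination hA1
    rcases mul_eq_zero.1 this with h | h
    · exact hA (by rw [d0, h, zero_mul])
    · have h5 : φ (l 0) 1 + P * φ (l 0) 0 = 0 := by exact_mod_cast h
      have : 0 < φ (l 0) 1 + P * φ (l 0) 0 := by positivity
      linarith
  have cz : ∀ j, c j = 0 := fun j => by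
    have h := a0 j
    rw [A0] at h
    have q0 : (φ (l j.succ) 0 : ℂ) ≠ 0 := by exact_mod_cast (hφ.pos0 _ (hl j.succ)).ne'
    rcases mul_eq_zero.1 h.symm with h | h
    · exact absurd h hsC
    · exact (mul_eq_zero.1 h).resolve_right q0
  have Az : f 0 0 = 0 := by
    ext k
    fin_cases k
    · exact A0
    · exact a1.trans (by simp [cz])
    · exact (a2 ⟨0, hn0⟩).trans (by simp [cz])
    · exact a3.trans (by simp [cz])
  -- On edge `0` all four data vanish at the vertex, so uniqueness for the initial value problem
  -- applies; on the other edges the multiple is zero.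
  refine eq_zero_of_trace_eq_zero hl hS fun j x hx => ?_
  rcases Fin.eq_zero_or_eq_succ j with rfl | ⟨i, rfl⟩
  · rw [left_zero, right_zero] at hx
    exact congrFun (hf0.eqOn_of_right IsBeam.zero Az hx) 0
  · exact congrFun (hc0 i (cz i) x hx) 0

theorem eq_zero_of_eigen (hl : ∀ j, 0 < l j) {s : ℝ} (hs : 0 < s) (hsn : s ^ 2 = n)
    (hα : ∀ j, α j = s) {U : Jet l 4} (hU : U ∈ domObs l α) {θ : ℝ}
    (h : opA U = (Complex.I * θ) • U 0) : U = 0 := by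
  rcases le_or_gt (-θ) 0 with hκ | hκ
  · exact eq_zero_of_eigen_of_nonpos hl (fun j => by rw [hα j]; exact hs) hU.1
      (four_eq_of_eigen h) hκ
  · exact eq_zero_of_eigen_of_pos hl hs hsn hα hU (four_eq_of_eigen h) hκ

/-! ### The observability inequality -/

theorem IsClosedSubspace.comap {E F : Type*} [NormedAddCommGroup E] [NormedSpace ℂ E]
    [NormedAddCommGroup F] [NormedSpace ℂ F] {S : Set F} (h : IsClosedSubspace S) (f : E →L[ℂ] F) :
    IsClosedSubspace {x | f x ∈ S} := by
  obtain ⟨D, hD, rfl⟩ := h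
  exact ⟨D.comap f.toLinearMap, hD.preimage f.continuous, rfl⟩

/-- The constant extension of a function on `[0, T]`. -/
def extend {E : Type*} [TopologicalSpace E] {T : ℝ} (hT : 0 ≤ T) (f : C(Icc (0 : ℝ) T, E)) :
    ℝ → E := fun t => f (projIcc 0 T hT t)

theorem continuous_extend {E : Type*} [TopologicalSpace E] {T : ℝ} (hT : 0 ≤ T)
    (f : C(Icc (0 : ℝ) T, E)) : Continuous (extend hT f) := f.continuous.comp continuous_projIcc

/-- The integral of the extension, as a continuous linear map. -/
def extendIntegral (l : Fin (n + 1) → ℝ) {T : ℝ} (hT : 0 ≤ T) (s t : ℝ) :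
    C(Icc (0 : ℝ) T, Jet l 2) →L[ℂ] Jet l 2 :=
  LinearMap.mkContinuous
    { toFun := fun f => ∫ r in s..t, extend hT f r
      map_add' := fun f g => intervalIntegral.integral_add
        ((continuous_extend hT f).intervalIntegrable _ _)
        ((continuous_extend hT g).intervalIntegrable _ _)
      map_smul' := fun c f => intervalIntegral.integral_smul c (extend hT f) }
    |t - s| fun f => by
      rw [mul_comm]
      exact intervalIntegral.norm_integral_le_of_norm_le_const fun r _ => f.norm_coe_le_norm _

/-- The element of the graph of the operator belonging to the times `s` and `t`. -/
def increment (l : Fin (n + 1) → ℝ) {T : ℝ} (hT : 0 ≤ T) (s t : ℝ) :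
    C(Icc (0 : ℝ) T, Jet l 2) →L[ℂ] Jet l 2 × L2G l :=
  (extendIntegral l hT s t).prod ((jetL l 0).comp
    (ContinuousMap.evalCLM ℂ (projIcc 0 T hT t) - ContinuousMap.evalCLM ℂ (projIcc 0 T hT s)))

/-- The pairs consisting of a mild solution and its second traces. -/
def tracedSolutions (hl : ∀ j, 0 < l j) (α : Fin n → ℝ) {T : ℝ} (hT : 0 ≤ T) (d : ℝ) :
    Set (C(Icc (0 : ℝ) T, Jet l 2) × (Fin n → L2I 0 d)) :=
  {p | IsMild (domA l α) 0 T (extend hT p.1) ∧ HasSecondTrace hl 0 d (extend hT p.1) p.2}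

/-- Being a mild solution and having given traces are families of continuous linear conditions on
the pair, once the graph of `A` is known to be closed. -/
theorem isClosedSubspace_tracedSolutions (hl : ∀ j, 0 < l j) {T : ℝ} (hT : 0 ≤ T) (d : ℝ) :
    IsClosedSubspace (tracedSolutions hl α hT d) := by
  have hG := isClosedSubspace_graphOn hl (isClosedSubspace_domA (α := α) hl) fun _ h => h.1
  let X := C(Icc (0 : ℝ) T, Jet l 2) × (Fin n → L2I 0 d)
  let F : X →L[ℂ] C(Icc (0 : ℝ) T, Jet l 2) := ContinuousLinearMap.fst ℂ _ _
  let P : Fin n → X →L[ℂ] L2I 0 d := fun j =>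
    (ContinuousLinearMap.proj j).comp (ContinuousLinearMap.snd ℂ _ _)
  choose Λ hΛ using fun t : Icc (0 : ℝ) d =>
    L2I.exists_integral (a := 0) (b := d) le_rfl t.2.1 t.2.2
  have h1 := IsClosedSubspace.forall_mem fun i : Icc 0 T × Icc 0 T =>
    hG.comap ((increment l hT i.1 i.2).comp F)
  have h2 := IsClosedSubspace.forall_mem fun i : Fin n × Icc (0 : ℝ) d =>
    IsClosedSubspace.ker (((secondTrace hl i.1).comp ((increment l hT 0 i.2).comp F))
      - (Λ i.2).comp (P i.1))
  convert h1.inter h2 using 1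
  ext p
  constructor
  · rintro ⟨hm, ht⟩
    refine ⟨fun i => hm.mem i.1 i.1.2 i.2 i.2.2, fun i => ?_⟩
    have e := ht i.1 i.2 i.2.2
    change secondTrace hl i.1 (increment l hT 0 i.2 p.1) - Λ i.2 (p.2 i.1) = 0
    rw [(hΛ i.2).1, ← e]
    exact sub_self _
  · rintro ⟨hm, ht⟩
    refine ⟨⟨continuous_extend hT _, fun s hs t ht => hm (⟨s, hs⟩, ⟨t, ht⟩)⟩, fun j t h => ?_⟩
    have e : secondTrace hl j (increment l hT 0 t p.1) - Λ ⟨t, h⟩ (p.2 j) = 0 := ht (j, ⟨t, h⟩)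
    rw [(hΛ ⟨t, h⟩).1] at e
    exact sub_eq_zero.1 e

theorem sum_norm_sq_le {ι : Type*} [Fintype ι] {β : ι → Type*} [∀ i, SeminormedAddCommGroup (β i)]
    (x : ∀ i, β i) : ∑ i, ‖x i‖ ^ 2 ≤ Fintype.card ι * ‖x‖ ^ 2 := by
  have := Finset.sum_le_card_nsmul Finset.univ (fun i => ‖x i‖ ^ 2) (‖x‖ ^ 2)
    fun i _ => by gcongr; exact norm_le_pi_norm x i
  simpa using this

theorem norm_sq_le_sum {ι : Type*} [Fintype ι] {β : ι → Type*} [∀ i, SeminormedAddCommGroup (β i)]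
    (x : ∀ i, β i) : ‖x‖ ^ 2 ≤ ∑ i, ‖x i‖ ^ 2 := by
  have h0 : 0 ≤ ∑ i, ‖x i‖ ^ 2 := Finset.sum_nonneg fun _ _ => sq_nonneg _
  rw [← Real.le_sqrt (norm_nonneg _) h0, pi_norm_le_iff_of_nonneg (Real.sqrt_nonneg _)]
  intro i
  rw [Real.le_sqrt (norm_nonneg _) h0]
  exact Finset.single_le_sum (f := fun i => ‖x i‖ ^ 2) (fun _ _ => sq_nonneg _) (Finset.mem_univ i)

/-- The compactness argument takes place in the Banach space of continuous functions of time paired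
with their traces. By conservation the sup norm of a solution is the norm of its initial value, so
observability up to finitely many functionals is the required a priori bound. -/
theorem exists_observability_constant (hl : ∀ j, 0 < l j) {s : ℝ} (hs : 0 < s) (hsn : s ^ 2 = n)
    (hα : ∀ j, α j = s) {T : ℝ} (hT : 0 < T) :
    ∃ K : ℝ, 0 < K ∧ ∀ p ∈ tracedSolutions hl α hT.le (T / 2),
      ‖extend hT.le p.1 0‖ ^ 2 ≤ K * ∑ j, ‖p.2 j‖ ^ 2 := by
  have hα0 : ∀ j, 0 < α j := fun j => by rw [hα j]; exact hs
  obtain ⟨ι, _, Λ, C, hC, H⟩ :=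
    exists_finite_observability (α := α) hl hs hsn hα (half_pos hT) (half_lt_self hT)
  have z : (0 : ℝ) ∈ Icc 0 T := left_mem_Icc.2 hT.le
  let X := C(Icc (0 : ℝ) T, Jet l 2) × (Fin n → L2I 0 (T / 2))
  let B : X →L[ℂ] (Fin n → L2I 0 (T / 2)) := ContinuousLinearMap.snd ℂ _ _
  let M : X →L[ℂ] (ι → ℂ) := (ContinuousLinearMap.pi Λ).comp
    ((ContinuousMap.evalCLM ℂ (projIcc 0 T hT.le 0)).comp (ContinuousLinearMap.fst ℂ _ _))
  have hnorm : ∀ p ∈ tracedSolutions hl α hT.le (T / 2), ‖p.1‖ = ‖extend hT.le p.1 0‖ := by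
    intro p hp
    apply le_antisymm
    · rw [ContinuousMap.norm_le _ (norm_nonneg _)]
      intro t
      have := hp.1.norm_eq hl hα0 t.2
      rw [← this, extend, projIcc_val]
    · exact p.1.norm_coe_le_norm _
  -- The cardinalities compare sums of squares with the sup norm on finite products. The extra `1`
  -- in `√N + 1` covers the trace component of the pair.
  set N : ℝ := C * (Fintype.card (Fin n) + Fintype.card ι) with hN
  have hN0 : 0 ≤ N := by positivity
  obtain ⟨K, hK, HK⟩ := exists_bound_of_finite_rank
    (isClosedSubspace_tracedSolutions (α := α) hl hT.le (T / 2)) B M (C := √N + 1) (by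
      intro p hp
      have h1 := H _ hp.1 p.2 hp.2
      have h2 := sum_norm_sq_le p.2
      have h3 : ∑ i, ‖Λ i (extend hT.le p.1 0)‖ ^ 2 ≤ Fintype.card ι * ‖M p‖ ^ 2 :=
        sum_norm_sq_le (M p)
      have h4 : ‖p.1‖ ≤ √N * (‖B p‖ + ‖M p‖) := by
        rw [hnorm p hp]
        apply le_of_sq_le_sq _ (by positivity)
        rw [mul_pow, Real.sq_sqrt hN0]
        refine h1.trans ?_
        rw [hN, mul_assoc]
        apply mul_le_mul_of_nonneg_left _ hC
        refine (add_le_add h2 h3).trans ?_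
        have b0 : 0 ≤ ‖B p‖ := norm_nonneg _
        have m0 : 0 ≤ ‖M p‖ := norm_nonneg _
        have a1 : ‖p.2‖ ^ 2 ≤ (‖B p‖ + ‖M p‖) ^ 2 :=
          pow_le_pow_left₀ (norm_nonneg _) (le_add_of_nonneg_right m0) 2
        have a2 : ‖M p‖ ^ 2 ≤ (‖B p‖ + ‖M p‖) ^ 2 :=
          pow_le_pow_left₀ m0 (le_add_of_nonneg_left b0) 2
        rw [add_mul]
        gcongr
      have h5 : ‖p.2‖ ≤ ‖B p‖ + ‖M p‖ := le_add_of_nonneg_right (norm_nonneg _)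
      have h6 : 0 ≤ ‖B p‖ + ‖M p‖ := (norm_nonneg _).trans h5
      rw [add_mul, one_mul]
      apply max_le
      · linarith
      · have : 0 ≤ √N * (‖B p‖ + ‖M p‖) := by positivity
        linarith) (by
      intro p hp hB
      have hp2 : p.2 = 0 := hB
      -- The traces are known to vanish for increments starting at time `0`; additivity extends this
      -- to all increments, which puts the solution among the invisible ones.
      have hd : IsMild (domObs l α) 0 (T / 2) (extend hT.le p.1) := by
        have sub : Icc 0 (T / 2) ⊆ Icc 0 T := Icc_subset_Icc_right (half_lt_self hT).le
        refine ⟨hp.1.cont, fun a ha b hb => (mem_graphOn_domObs hl).2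
          ⟨hp.1.mem a (sub ha) b (sub hb), fun j => ?_⟩⟩
        have zero : ∀ t ∈ Icc 0 (T / 2), secondTrace hl j (∫ r in (0 : ℝ)..t, extend hT.le p.1 r,
            extend hT.le p.1 t 0 - extend hT.le p.1 0 0) = 0 := by
          intro t ht
          rw [hp.2 j t ht, hp2, Pi.zero_apply, L2I.intervalIntegral_congr (Lp.coeFn_zero _ _ _)
            (left_mem_Icc.2 (half_pos hT).le) ht]
          simp
        have := secondTrace_add hl j hp.1.cont 0 a b
        rwa [zero a ha, zero b hb, zero_add] at this
      have h0 := hd.eq_zero_of_invisible hl hs hsn hα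
        (fun U hU θ h => eq_zero_of_eigen hl hs hsn hα hU h) (half_pos hT)
      have h1 := hnorm p hp
      rw [h0, norm_zero, norm_eq_zero] at h1
      exact Prod.ext h1 hp2)
  refine ⟨K ^ 2, by positivity, fun p hp => ?_⟩
  have h1 : ‖extend hT.le p.1 0‖ ≤ K * ‖p.2‖ := by
    rw [← hnorm p hp]
    exact (le_max_left _ _).trans (HK p hp)
  calc ‖extend hT.le p.1 0‖ ^ 2 ≤ (K * ‖p.2‖) ^ 2 := by gcongr
    _ = K ^ 2 * ‖p.2‖ ^ 2 := mul_pow _ _ _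
    _ ≤ _ := mul_le_mul_of_nonneg_left (norm_sq_le_sum p.2) (by positivity)

/-- The observability inequality for weights that are all equal. -/
theorem exists_observability_inequality (hl : ∀ j, 0 < l j) {s : ℝ} (hs : 0 < s)
    (hsn : s ^ 2 = n) (hα : ∀ j, α j = s) {T : ℝ} (hT : 0 < T) :
    ∃ C : ℝ, 0 < C ∧ ∀ vT : Jet l 2, ∀ v : ℝ → Jet l 2, IsAdjointSolution l α T vT v →
      ∃ g : Fin n → ℝ → ℂ, (∀ j, IsSecondTrace l α T v j.succ (g j)) ∧
        ‖v T‖ ^ 2 ≤ C * ∑ j, ∫ t in (0 : ℝ)..T, ‖g j t‖ ^ 2 := by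
  have hα0 : ∀ j, 0 < α j := fun j => by rw [hα j]; exact hs
  obtain ⟨K, hK, HK⟩ := exists_observability_constant (α := α) hl hs hsn hα hT
  refine ⟨K, hK, fun vT v hv => ?_⟩
  let f : C(Icc (0 : ℝ) T, Jet l 2) := ⟨fun t => v t, continuousOn_iff_continuous_domRestrict.1 hv.cont⟩
  have H : IsMild (domA l α) 0 T (extend hT.le f) := hv.isMild hl hT.le
  have hf : ∀ t ∈ Icc 0 T, extend hT.le f t = v t := fun t ht => by
    simp only [extend, projIcc_of_mem hT.le ht]; rfl
  have zT : T ∈ Icc 0 T := right_mem_Icc.2 hT.le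
  obtain ⟨γ, g, hγ, hg⟩ := H.exists_trace hl hs hsn hα hT
  refine ⟨g, fun j => ⟨(hg j).1, fun t ht => ?_⟩, ?_⟩
  · obtain ⟨U, hU, e⟩ := H.mem T zT t ht
    have e1 : truncL l U = ∫ r in T..t, extend hT.le f r := congrArg Prod.fst e
    have e' : (truncL l U, opA U) = _ := e
    refine ⟨U, hU, ?_, ?_⟩
    · change jetL l 0 (truncL l U) = _
      rw [e1, ← (jetL l 0).intervalIntegral_comp_comm (H.cont.intervalIntegrable _ _)]
      apply intervalIntegral.integral_congr
      intro r hr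
      simp only [hf r (uIcc_subset_Icc zT ht hr), jetL_apply]
    · rw [secondTrace_spec hl j hU.1, e', (hg j).2.1 t ht]
  · rw [← hf T zT, H.norm_eq hl hα0 zT]
    refine (HK (f, γ) ⟨H, hγ⟩).trans ?_
    gcongr with j
    exact (hg j).2.2

/-! ### Reduction to equal weights -/

theorem Tmin_nonneg (ε : ℝ) : 0 ≤ Tmin l ε := Real.sqrt_nonneg _

/-- The nonnegative numbers `1 / n - 1 / α j ^ 2` have sum zero, so each is zero. There is at least
one edge because an empty sum is not `1`. -/
theorem weights_eq (hα : ∀ j, 0 < α j) (hsum : ∑ j, 1 / α j ^ 2 = 1)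
    (hle : ∀ j, 1 / α j ^ 2 ≤ 1 / (n : ℝ)) : (0 : ℝ) < n ∧ ∀ j, α j = √n := by
  have hn : (0 : ℝ) < n := by
    rcases Nat.eq_zero_or_pos n with rfl | h
    · simp at hsum
    · exact_mod_cast h
  refine ⟨hn, fun j => ?_⟩
  have h0 : ∑ j : Fin n, (1 / (n : ℝ) - 1 / α j ^ 2) = 0 := by
    rw [Finset.sum_sub_distrib, hsum, Finset.sum_const, Finset.card_univ, Fintype.card_fin,
      nsmul_eq_mul, mul_one_div_cancel hn.ne', sub_self]
  have h1 := (Finset.sum_eq_zero_iff_of_nonneg fun j _ => sub_nonneg.2 (hle j)).1 h0 j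
    (Finset.mem_univ j)
  have hαj := hα j
  have h2 : α j ^ 2 = n := by
    have h3 : 1 / (n : ℝ) = 1 / α j ^ 2 := sub_eq_zero.1 h1
    field_simp at h3
    linarith
  rw [← h2, Real.sqrt_sq hαj.le]

end StarGraph

end

theorem proposition3p3 (n : ℕ) (l : Fin (n + 1) → ℝ) (hl : ∀ j, 0 < l j)
    (α : Fin n → ℝ) (hα : ∀ j, 0 < α j)
    (hα_sum : ∑ j, 1 / α j ^ 2 = 1) (hα_le : ∀ j, 1 / α j ^ 2 ≤ 1 / (n : ℝ))
    (ε : ℝ) (hε_pos : 0 < ε) (hε_lt : ε < 1 / StarGraph.barLength l)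
    (T : ℝ) (hT : StarGraph.Tmin l ε < T) :
    ∃ C : ℝ, 0 < C ∧
      ∀ vT ∈ StarGraph.H20 l α, ∀ v : ℝ → StarGraph.Jet l 2,
        StarGraph.IsAdjointSolution l α T vT v →
        ∃ g : Fin n → ℝ → ℂ,
          (∀ j, StarGraph.IsSecondTrace l α T v j.succ (g j)) ∧
          ‖v T‖ ^ 2 ≤ C * ∑ j, ∫ t in (0 : ℝ)..T, ‖g j t‖ ^ 2 := by
  obtain ⟨hn, hα'⟩ := StarGraph.weights_eq hα hα_sum hα_le
  -- The square root defining `Tmin` is nonnegative, so the lower bound on `T` makes `T` positive.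
  obtain ⟨C, hC, H⟩ := StarGraph.exists_observability_inequality hl (Real.sqrt_pos.2 hn)
    (Real.sq_sqrt hn.le) hα' ((StarGraph.Tmin_nonneg ε).trans_lt hT)
  exact ⟨C, hC, fun vT _ v hv => H vT v hv⟩
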